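/- Let $d\ge 2$, $\mu\in\mathbb R^d$, $r>0$, and let $X=\mu+r\,W\,U$, where $W$ is a positive continuous (atomless) real random variable, with a bounded density if $d=2$, $U$ is uniformly distributed (for the surface measure) on a measurable subset of the unit sphere of $\mathbb R^d$, and $W$ and $U$ are independent. Set $r^\star=r\,\mathbb E[W]$ and $\theta=(\mu,r^\star)\in\mathbb R^d\times\mathbb R$; $\mathbb R^d\times\mathbb R$ carries the Euclidean norm. For $z\in\mathbb R^d$ let $$\Gamma(z)=\mathbb E\Big[\frac1{\|X-z\|}\Big(I_d-\frac{(X-z)(X-z)^T}{\|X-z\|^2}\Big)\Big].$$ Assume: - [A1] $\mathbb E\|X-\mu\|^{-2}<\infty$; - [A2] $\mathbb E\|X-\mu\|^{2}<\infty$; - [A3] there are constants $R_\mu,R_r>0$ and $A$ with $\|\mathbb E[U]\|^2<A<1$ such that $$\sup_{\|z-\mu\|\le R_\mu}\lambda_{\max}(\Gamma(z))<\frac{1-\|\mathbb E[U]\|^2/A}{r^\star+\frac32R_r};$$ - [A4] the matrix $$\Gamma_\theta=\begin{pmatrix} I_d-r^\star\,\Gamma(\mu) & \mathbb E\big[\frac{X-\mu}{\|X-\mu\|}\big]\\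 \mathbb E\big[\frac{X-\mu}{\|X-\mu\|}\big]^T & 1\end{pmatrix}$$ (the Hessian at $\theta$ of $G(z,a)=\frac12\mathbb E[(\|X-z\|-a)^2]$) is positive definite; and moreover $\mathbb E\|X-\mu\|^{12}<\infty$. Let $\mathcal K$ be a compact convex subset of $\mathbb R^d\times\mathbb R_+^*$ contained in $\overline{\mathcal B}(\mu,R_\mu)\times\overline{\mathcal B}(r^\star,R_r)$, with $\theta$ in the interior of $\mathcal K$. Let $\pi:\mathbb R^d\times\mathbb R\to\mathcal K$ be a measurable map with $\pi(y)=y$ for $y\in\mathcal K$, with $\|\pi(y)-\pi(y')\|\le\|y-y'\|$ for all $y,y'\in\mathbb R^d\times\mathbb R_+^*$, and with $\pi(y)\in\partial\mathcal K$ for all $y\in(\mathbb R^d\times\mathbb R_+^*)\setminus\mathcal K$. Let $\gamma_n=c_\gamma n^{-\alpha}$ with $c_\gamma>0$ and $\alpha\in(1/2,1)$, let $(X_n)_{n\ge1}$ be i.i.d. random vectors with the law of $X$, and let $\widehat\theta_1$ be a (deterministic or random) point of $\mathcal K$, independent of $(X_n)_{n\ge2}$. Define, for $n\ge1$, $$\widehat\theta_{n+1}=\pi\big(\widehat\theta_n-\gamma_n\,h(X_{n+1},\widehat\theta_n)\big),\qquad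 \overline\theta_n=\frac1n\sum_{k=1}^n\widehat\theta_k,$$ where, for $y=(z,a)$, $h(x,y)=\Big(z-x-a\,\frac{z-x}{\|z-x\|},\ a-\|z-x\|\Big)$ is the gradient in $y$ of $\frac12(\|x-z\|-a)^2$. Then there is a constant $C>0$ such that for all $n\ge1$, $$\mathbb E\big[\|\overline\theta_n-\theta\|^2\big]\le\frac Cn .$$ -/

import Mathlib

open MeasureTheory ProbabilityTheory
open scoped ENNReal

noncomputable section

/-- `ℝ^d` with its Euclidean norm. -/
abbrev Vec (d : ℕ) : Type := EuclideanSpace ℝ (Fin d)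

/-- The parameter space `ℝ^d × ℝ` with the Euclidean norm `‖(z, a)‖² = ‖z‖² + a²`. -/
abbrev Param (d : ℕ) : Type := WithLp 2 (Vec d × ℝ)

/-- The parameter `(z, a)`. -/
def mkParam {d : ℕ} (z : Vec d) (a : ℝ) : Param d := WithLp.toLp 2 (z, a)

/-- The open half-space `ℝ^d × ℝ_+^*`. -/
def posParam (d : ℕ) : Set (Param d) := {y | 0 < y.snd}

/-- The uniform distribution on a subset `S` of the unit sphere: the surface measure of the sphere,
restricted to `S` and normalized. -/
def uniformOnSphere {d : ℕ} (S : Set (Metric.sphere (0 : Vec d) 1)) :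
    Measure (Metric.sphere (0 : Vec d) 1) :=
  (volume : Measure (Vec d)).toSphere[|S]

/-- The model `X = μ + r W U`, where `r > 0`, `W` is a positive continuous (atomless) real random
variable, having moreover a bounded density if `d = 2`, `U` is uniformly distributed on a measurable
subset `S` of the unit sphere, and `W` and `U` are independent. -/
structure IsSphereModel {d : ℕ} {Ω : Type*} [MeasurableSpace Ω] (P : Measure Ω)
    (μ : Vec d) (r : ℝ) (S : Set (Metric.sphere (0 : Vec d) 1))
    (W : Ω → ℝ) (U : Ω → Metric.sphere (0 : Vec d) 1) (X : Ω → Vec d) : Prop where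
  r_pos : 0 < r
  measurableSet_S : MeasurableSet S
  measurable_W : Measurable W
  measurable_U : Measurable U
  measurable_X : Measurable X
  W_pos : ∀ᵐ ω ∂P, 0 < W ω
  W_continuous : ∀ w : ℝ, P {ω | W ω = w} = 0
  W_bounded_density : d = 2 → ∃ (f : ℝ → ℝ≥0∞) (M : ℝ≥0∞), Measurable f ∧ M < ∞ ∧
    (∀ w, f w ≤ M) ∧ P.map W = volume.withDensity f
  U_uniform : P.map U = uniformOnSphere S
  indep : IndepFun W U P
  X_eq : ∀ᵐ ω ∂P, X ω = μ + (r * W ω) • (U ω : Vec d)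

/-- `r⋆ = r E[W]`. -/
def rStar {Ω : Type*} [MeasurableSpace Ω] (P : Measure Ω) (r : ℝ) (W : Ω → ℝ) : ℝ :=
  r * ∫ ω, W ω ∂P

/-- The matrix `Γ(z) = E[‖X - z‖⁻¹ (I_d - (X - z)(X - z)ᵀ / ‖X - z‖²)]`
(the expectation is taken entrywise). -/
def GammaMat {d : ℕ} {Ω : Type*} [MeasurableSpace Ω] (P : Measure Ω) (X : Ω → Vec d) (z : Vec d) :
    Matrix (Fin d) (Fin d) ℝ :=
  Matrix.of fun i j => ∫ ω, ‖X ω - z‖⁻¹ *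
    ((1 : Matrix (Fin d) (Fin d) ℝ) i j - (X ω - z) i * (X ω - z) j / ‖X ω - z‖ ^ 2) ∂P

/-- The largest eigenvalue of a real (symmetric) matrix. -/
def lambdaMax {d : ℕ} (M : Matrix (Fin d) (Fin d) ℝ) : ℝ := sSup (spectrum ℝ M)

/-- Assumption [A1]: `E[‖X - μ‖⁻²] < ∞` (in the model, `X ≠ μ` almost surely). -/
def AssumptionA1 {d : ℕ} {Ω : Type*} [MeasurableSpace Ω] (P : Measure Ω) (X : Ω → Vec d)
    (μ : Vec d) : Prop :=
  Integrable (fun ω => (‖X ω - μ‖ ^ 2)⁻¹) P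

/-- Assumption [A2]: `E[‖X - μ‖²] < ∞`. -/
def AssumptionA2 {d : ℕ} {Ω : Type*} [MeasurableSpace Ω] (P : Measure Ω) (X : Ω → Vec d)
    (μ : Vec d) : Prop :=
  Integrable (fun ω => ‖X ω - μ‖ ^ 2) P

/-- Assumption [A3] for the two constants `Rμ, Rr`: for some `A` with `‖E[U]‖² < A < 1`,
`sup_{‖z - μ‖ ≤ Rμ} λ_max(Γ(z)) < (1 - ‖E[U]‖² / A) / (r⋆ + 3/2 Rr)`. -/
def AssumptionA3 {d : ℕ} {Ω : Type*} [MeasurableSpace Ω] (P : Measure Ω) (X : Ω → Vec d)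
    (U : Ω → Metric.sphere (0 : Vec d) 1) (μ : Vec d) (rs Rμ Rr : ℝ) : Prop :=
  0 < Rμ ∧ 0 < Rr ∧ ∃ A : ℝ, ‖∫ ω, (U ω : Vec d) ∂P‖ ^ 2 < A ∧ A < 1 ∧
    ∃ L : ℝ, IsLUB ((fun z => lambdaMax (GammaMat P X z)) '' Metric.closedBall μ Rμ) L ∧
      L < (1 - ‖∫ ω, (U ω : Vec d) ∂P‖ ^ 2 / A) / (rs + 3 / 2 * Rr)

/-- The Hessian `Γ_θ` at `θ = (μ, r⋆)`, a block matrix of size `d + 1`. -/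
def hessianMat {d : ℕ} {Ω : Type*} [MeasurableSpace Ω] (P : Measure Ω) (X : Ω → Vec d)
    (μ : Vec d) (rs : ℝ) : Matrix (Fin d ⊕ Unit) (Fin d ⊕ Unit) ℝ :=
  Matrix.fromBlocks
    (1 - rs • GammaMat P X μ)
    (Matrix.of fun i _ => ∫ ω, (X ω - μ) i / ‖X ω - μ‖ ∂P)
    (Matrix.of fun _ j => ∫ ω, (X ω - μ) j / ‖X ω - μ‖ ∂P)
    1

/-- Assumption [A4]: `Γ_θ` is positive definite. -/
def AssumptionA4 {d : ℕ} {Ω : Type*} [MeasurableSpace Ω] (P : Measure Ω) (X : Ω → Vec d)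
    (μ : Vec d) (rs : ℝ) : Prop :=
  (hessianMat P X μ rs).PosDef

/-- The stochastic gradient at `y = (z, a)` for the observation `x`: the vector
`(z - x - a (z - x) / ‖z - x‖, a - ‖z - x‖)`, i.e. the gradient in `y` of `(‖x - z‖ - a)² / 2`,
whose expectation for `x = X` is the gradient of `G(y) = E[(‖X - z‖ - a)²] / 2`. -/
def stochGrad {d : ℕ} (x : Vec d) (y : Param d) : Param d :=
  mkParam (y.fst - x - (y.snd / ‖y.fst - x‖) • (y.fst - x)) (y.snd - ‖y.fst - x‖)

/-- The admissible constraint sets: `K` is a compact convex subset of `ℝ^d × ℝ_+^*`, contained in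
`closedBall(μ, Rμ) × closedBall(r⋆, Rr)`, and `θ = (μ, r⋆)` is an interior point of `K`. -/
structure IsConstraintSet {d : ℕ} (K : Set (Param d)) (μ : Vec d) (rs Rμ Rr : ℝ) : Prop where
  isCompact : IsCompact K
  convex : Convex ℝ K
  pos : K ⊆ posParam d
  subset_balls : ∀ y ∈ K, y.fst ∈ Metric.closedBall μ Rμ ∧ y.snd ∈ Metric.closedBall rs Rr
  mem_interior : mkParam μ rs ∈ interior K

/-- `π` is a projection onto `K`, `1`-Lipschitz on `ℝ^d × ℝ_+^*` and sending the points of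
`ℝ^d × ℝ_+^*` outside `K` to the frontier of `K`. As an iterate may have a nonpositive
last coordinate when the step is larger than `1`, `π` is a measurable map defined on all of
`ℝ^d × ℝ`; off `ℝ^d × ℝ_+^*` its values in `K` are arbitrary. -/
structure IsProjection {d : ℕ} (π : Param d → Param d) (K : Set (Param d)) : Prop where
  measurable : Measurable π
  mapsTo : ∀ y, π y ∈ K
  eq_self : ∀ y ∈ K, π y = y
  lipschitz : ∀ y ∈ posParam d, ∀ y' ∈ posParam d, ‖π y - π y'‖ ≤ ‖y - y'‖
  frontier : ∀ y ∈ posParam d, y ∉ K → π y ∈ frontier K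

/-- The projected Robbins-Monro sequence `θ̂_n`, `n ≥ 1`: it starts at `θ̂_1 = θ₁` and
`θ̂_{n+1} = π (θ̂_n - γ_n ∇g(X_{n+1}, θ̂_n))`. (The index `0` is not used.) -/
def prm {d : ℕ} {Ω : Type*} (π : Param d → Param d) (γ : ℕ → ℝ) (X : ℕ → Ω → Vec d)
    (θ₁ : Ω → Param d) : ℕ → Ω → Param d
  | 0 => θ₁
  | 1 => θ₁
  | n + 2 => fun ω =>
      π (prm π γ X θ₁ (n + 1) ω -
        γ (n + 1) • stochGrad (X (n + 2) ω) (prm π γ X θ₁ (n + 1) ω))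

/-- The averaged sequence `θ̄_n = (1/n) ∑_{k=1}^n θ̂_k`. -/
def averagedPrm {d : ℕ} {Ω : Type*} (π : Param d → Param d) (γ : ℕ → ℝ) (X : ℕ → Ω → Vec d)
    (θ₁ : Ω → Param d) (n : ℕ) (ω : Ω) : Param d :=
  (n : ℝ)⁻¹ • ∑ k ∈ Finset.Icc 1 n, prm π γ X θ₁ k ω

end

/-!
# Quadratic mean rate of the averaged projected Robbins–Monro algorithm for a noisy sphere

Let `Φ(y) = E[h(X, y)]` be the mean field, i.e. the gradient of the objective, `e_k = θ̂_k - θ`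
the error and `ε_k = Φ(θ̂_k) - h(X_{k+1}, θ̂_k)` the noise, a martingale increment. Two properties
of `Φ` on `K` are used.

* *Strong monotonicity*, `κ ‖y - θ‖² ≤ ⟨y - θ, Φ(y)⟩` (`IsRadialLaw.strongly_monotone`). For
  `y = (μ + w, rs + b)`, the inner product is `‖w‖² + b² + 2 b ⟨w, E[U]⟩` minus a nonnegative
  combination of Taylor remainders of `z ↦ E‖X - z‖` along the segment from `μ` to `μ + w`, at
  least when `b ≥ 0`. The second derivative of this function at `z` is `Γ(z)`, so [A3] bounds the
  remainders by `L (rs + 3/2 Rr) ‖w‖²`, and `2 |b| |⟨w, E[U]⟩| ≤ A b² + ‖E[U]‖² ‖w‖² / A`. This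
  needs `E‖X - z‖⁻¹ < ∞`, for the entries of `Γ(z)` to be genuine expectations. As `d ≥ 2`, that
  holds for almost every `z` whatever the law of `X`, by Tonelli; the bound is therefore integrated
  along almost every segment (`ae_integral_gap_le`), and extended to all of them by continuity
  (`integral_gap_le`).
* *Linearization*, `‖Φ(y) - T (y - θ)‖ ≤ C ‖y - θ‖²` (`IsRadialLaw.norm_meanField_sub_hessian_le`):
  the gradient `h(x, ·)` has a second order expansion at `θ` whose error is at most a constant times
  `(1 + ‖x - μ‖⁻²) ‖y - θ‖²`, and [A1] makes this integrable.

The rest holds for any such scheme (`IsProjectedScheme`). Expanding `‖e_{k+1}‖²` and `‖e_{k+1}‖⁴`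
and using monotonicity gives recursions that yield `E‖e_k‖² = O(γ_k)` and `E‖e_k‖⁴ = O(γ_k²)`
(`exists_integral_error_sq_le`, `exists_integral_error_pow_four_le`). Writing each step as
`e_{k+1} = e_k - γ_k Φ(θ̂_k) + γ_k ε_k + (effect of the projection)`, dividing by `γ_k` and summing
by parts gives
`T (∑ e_k) = ∑ ε_k + ∑ (remainders) - e_{n+1} / γ_n`.
The martingale has variance `O(n)`. Each remainder has second moment `O(1 / k)`, because
`α > 1 / 2`: the error of linearization is at most `C ‖e_k‖²`, and the projection acts only if
`‖e_k‖` or `γ_k ‖h‖` exceeds half the distance from `θ` to the boundary of `K`. The sum of the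
remainders and the boundary term are then `O(√n)` in quadratic mean. Since `T` inherits the strong
monotonicity of `Φ`, `κ ‖v‖ ≤ ‖T v‖`, and dividing by `n` gives the rate `1 / n`
(`exists_integral_average_sq_le`).

The map `π` is arbitrary where the radius coordinate is not positive. Such points are at a distance
bounded below from `K`, so projecting still moves the error by at most a multiple of the length of
the step (`IsProjection.exists_bound`).
-/

set_option linter.unusedSectionVars false

/-! ### Step sequences and sums -/

/-- The steps `γ_k = c k ^ (-α)`, `α < 1`, decrease so slowly that
`γ_k ^ p (1 - κ γ_k / 2) ≤ γ_{k+1} ^ p` eventually: the relative decrease is `O(1 / k) = o(γ_k)`. -/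
lemma step_succ_pow_ge {c α κ : ℝ} (hc : 0 < c) (hα₀ : 0 < α) (hα₁ : α < 1) (hκ : 0 < κ) (p : ℕ) :
    ∀ᶠ k : ℕ in Filter.atTop, κ * (c * (k : ℝ) ^ (-α)) ≤ 1 ∧
      (c * (k : ℝ) ^ (-α)) ^ p * (1 - κ / 2 * (c * (k : ℝ) ^ (-α)))
        ≤ (c * ((k + 1 : ℕ) : ℝ) ^ (-α)) ^ p := by
  have h1 : Filter.Tendsto (fun k : ℕ => κ * (c * (k : ℝ) ^ (-α))) Filter.atTop (nhds 0) := by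
    have := ((tendsto_rpow_neg_atTop hα₀).comp tendsto_natCast_atTop_atTop).const_mul (κ * c)
    simpa [mul_assoc, Function.comp_def] using this
  have h2 : Filter.Tendsto (fun k : ℕ => (k : ℝ) ^ (1 - α)) Filter.atTop Filter.atTop :=
    (tendsto_rpow_atTop (by linarith)).comp tendsto_natCast_atTop_atTop
  filter_upwards [h1.eventually_le_const one_pos, h2.eventually_ge_atTop (2 * p / (κ * c)),
    Filter.eventually_ge_atTop 1] with k hk1 hk2 hk
  refine ⟨hk1, ?_⟩
  have hk0 : (0 : ℝ) < k := by exact_mod_cast hk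
  have hk1' : (0 : ℝ) < k + 1 := by linarith
  set s : ℝ := k / (k + 1) with hs
  have hs0 : 0 < s := by positivity
  have hs1 : s ≤ 1 := by rw [hs, div_le_one hk1']; linarith
  -- the ratio of consecutive steps is `s ^ α ≥ s`
  have hratio : c * ((k + 1 : ℕ) : ℝ) ^ (-α) = c * (k : ℝ) ^ (-α) * s ^ α := by
    push_cast
    rw [hs, Real.div_rpow hk0.le hk1'.le, Real.rpow_neg hk0.le, Real.rpow_neg hk1'.le]
    have := (Real.rpow_pos_of_pos hk0 α).ne'
    field_simp
  have hsα : s ≤ s ^ α := by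
    simpa using Real.rpow_le_rpow_of_exponent_ge hs0 hs1 hα₁.le
  have hbern : 1 - p / (k : ℝ) ≤ s ^ p := by
    have h := one_add_mul_le_pow (a := s - 1) (by linarith) p
    have hs' : s - 1 = - (1 / (k + 1)) := by rw [hs]; field_simp; ring
    have : (p : ℝ) * (1 / (k + 1)) ≤ p / k := by
      rw [mul_one_div]; gcongr; linarith
    have e : (1 + (s - 1)) = s := by ring
    rw [e] at h
    rw [hs'] at h
    linarith
  have hpk : p / (k : ℝ) ≤ κ / 2 * (c * (k : ℝ) ^ (-α)) := by
    rw [div_le_iff₀ (by positivity)] at hk2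
    have : (k : ℝ) ^ (1 - α) = k * (k : ℝ) ^ (-α) := by
      rw [sub_eq_add_neg, Real.rpow_add hk0, Real.rpow_one]
    rw [div_le_iff₀ hk0]
    rw [this] at hk2
    linarith
  rw [hratio, mul_pow _ (s ^ α)]
  refine mul_le_mul_of_nonneg_left ?_ (by positivity)
  calc 1 - κ / 2 * (c * (k : ℝ) ^ (-α)) ≤ s ^ p := by linarith
    _ ≤ (s ^ α) ^ p := by gcongr

/-- The basic recursion of stochastic approximation: a contraction by `1 - κ γ_k` perturbed by
`γ_k ^ (p + 1)` forces the rate `γ_k ^ p`, for the steps `γ_k = c k ^ (-α)` with `α < 1`. -/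
lemma le_const_mul_step_pow {c α κ B D : ℝ} (hc : 0 < c) (hα₀ : 0 < α) (hα₁ : α < 1)
    (hκ : 0 < κ) (hB : 0 ≤ B) (p : ℕ) {u : ℕ → ℝ} (hD : ∀ k, 1 ≤ k → u k ≤ D)
    (hu : ∀ k : ℕ, 1 ≤ k → u (k + 1) ≤ (1 - κ * (c * (k : ℝ) ^ (-α))) * u k
      + B * (c * (k : ℝ) ^ (-α)) ^ (p + 1)) :
    ∃ C : ℝ, 0 ≤ C ∧ ∀ k : ℕ, 1 ≤ k → u k ≤ C * (c * (k : ℝ) ^ (-α)) ^ p := by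
  obtain ⟨N, hN⟩ := Filter.eventually_atTop.1 (step_succ_pow_ge hc hα₀ hα₁ hκ p)
  set γ : ℕ → ℝ := fun k => c * (k : ℝ) ^ (-α) with hγ
  have γpos : ∀ k, 1 ≤ k → 0 < γ k := fun k hk =>
    mul_pos hc (Real.rpow_pos_of_pos (by exact_mod_cast hk) _)
  have γanti : ∀ j k, 1 ≤ j → j ≤ k → γ k ≤ γ j := fun j k hj hjk =>
    mul_le_mul_of_nonneg_left (Real.rpow_le_rpow_of_nonpos (by exact_mod_cast hj)
      (by exact_mod_cast hjk) (by linarith)) hc.le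
  set n := max N 1 with hn
  have hn1 : 1 ≤ n := le_max_right _ _
  -- the first term absorbs `B`, the second one takes care of the first `n` indices
  set C := 2 * B / κ + max D 0 / γ n ^ p with hC
  have hnp := pow_pos (γpos n hn1) p
  have hC0 : 0 ≤ C := by positivity
  have hstart : ∀ k, 1 ≤ k → k ≤ n → u k ≤ C * γ k ^ p := by
    intro k hk hkn
    have h1 : γ n ^ p ≤ γ k ^ p := by
      have := γpos n hn1
      gcongr
      exact γanti k n hk hkn
    calc u k ≤ max D 0 := (hD k hk).trans (le_max_left _ _)
      _ = max D 0 / γ n ^ p * γ n ^ p := by field_simp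
      _ ≤ C * γ n ^ p := by
        gcongr
        exact le_add_of_nonneg_left (by positivity)
      _ ≤ C * γ k ^ p := by gcongr
  refine ⟨C, hC0, fun k hk => ?_⟩
  rcases le_total k n with h | h
  · exact hstart k hk h
  · induction k, h using Nat.le_induction with
    | base => exact hstart n hn1 le_rfl
    | succ k hnk ih =>
      have hk1 : 1 ≤ k := hn1.trans hnk
      obtain ⟨h1, h2⟩ := hN k ((le_max_left _ _).trans hnk)
      have hgp := γpos k hk1
      have ih' := ih hk1
      have hBC : B ≤ C * κ / 2 := by
        have : 2 * B / κ ≤ C := le_add_of_nonneg_right (by positivity)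
        rw [div_le_iff₀ hκ] at this; linarith
      calc u (k + 1) ≤ (1 - κ * γ k) * u k + B * γ k ^ (p + 1) := hu k hk1
        _ ≤ (1 - κ * γ k) * (C * γ k ^ p) + (C * κ / 2) * γ k ^ (p + 1) := by
          gcongr
        _ = C * (γ k ^ p * (1 - κ / 2 * γ k)) := by ring
        _ ≤ C * γ (k + 1) ^ p := by gcongr

lemma sum_one_div_sqrt_le (n : ℕ) :
    ∑ k ∈ Finset.Icc 1 n, 1 / √(k : ℝ) ≤ 2 * √(n : ℝ) := by
  induction n with
  | zero => simp
  | succ n ih =>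
    rw [Finset.sum_Icc_succ_top (by omega)]
    have h0 : (0 : ℝ) < √((n + 1 : ℕ) : ℝ) := Real.sqrt_pos.2 (by positivity)
    have h1 : √(n : ℝ) ^ 2 = n := Real.sq_sqrt (by positivity)
    have h2 : √((n + 1 : ℕ) : ℝ) ^ 2 = n + 1 := by rw [Real.sq_sqrt (by positivity)]; push_cast; ring
    have h3 : 1 / √((n + 1 : ℕ) : ℝ) ≤ 2 * (√((n + 1 : ℕ) : ℝ) - √(n : ℝ)) := by
      rw [div_le_iff₀ h0]
      nlinarith [sq_nonneg (√((n + 1 : ℕ) : ℝ) - √(n : ℝ))]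
    linarith

lemma rpow_sub_rpow_pred_le {α : ℝ} (hα₀ : 0 ≤ α) (hα₁ : α ≤ 1) {k : ℕ} (hk : 1 ≤ k) :
    0 ≤ (k : ℝ) ^ α - ((k - 1 : ℕ) : ℝ) ^ α ∧
      (k : ℝ) ^ α - ((k - 1 : ℕ) : ℝ) ^ α ≤ (k : ℝ) ^ α / k := by
  have hk0 : (0 : ℝ) < k := by exact_mod_cast hk
  have hk1 : (1 : ℝ) ≤ k := by exact_mod_cast hk
  rw [Nat.cast_sub hk, Nat.cast_one]
  constructor
  · rw [sub_nonneg]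
    exact Real.rpow_le_rpow (by linarith) (by linarith) hα₀
  · have e : (k : ℝ) - 1 = k * ((k - 1) / k) := by field_simp
    have hs0 : 0 ≤ ((k : ℝ) - 1) / k := div_nonneg (by linarith) hk0.le
    have hs1 : ((k : ℝ) - 1) / k ≤ 1 := by rw [div_le_one hk0]; linarith
    have h : ((k : ℝ) - 1) / k ≤ (((k : ℝ) - 1) / k) ^ α := by
      rcases hs0.eq_or_lt with h0 | h0
      · rw [← h0]; exact Real.rpow_nonneg le_rfl _
      · simpa using Real.rpow_le_rpow_of_exponent_ge h0 hs1 hα₁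
    rw [e, Real.mul_rpow hk0.le hs0]
    have hp := Real.rpow_nonneg hk0.le α
    have : (k : ℝ) ^ α / k = (k : ℝ) ^ α * (1 - ((k : ℝ) - 1) / k) := by field_simp; ring
    rw [this]
    nlinarith

/-- If `E‖Z_k‖² ≤ C / k` then `E‖∑_{k ≤ n} Z_k‖² = O(n)`, without any independence: weighted
Cauchy–Schwarz with the weights `1 / √k`. -/
lemma integral_norm_sum_sq_le {Ω E : Type*} [MeasurableSpace Ω] {P : Measure Ω}
    [NormedAddCommGroup E] {Z : ℕ → Ω → E} {C : ℝ} (n : ℕ)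
    (hZ : ∀ k, 1 ≤ k → Integrable (fun ω => ‖Z k ω‖ ^ 2) P)
    (hC : ∀ k : ℕ, 1 ≤ k → ∫ ω, ‖Z k ω‖ ^ 2 ∂P ≤ C / k) :
    ∫ ω, ‖∑ k ∈ Finset.Icc 1 n, Z k ω‖ ^ 2 ∂P ≤ 4 * C * n := by
  have hpt : ∀ ω, ‖∑ k ∈ Finset.Icc 1 n, Z k ω‖ ^ 2
      ≤ 2 * √(n : ℝ) * ∑ k ∈ Finset.Icc 1 n, √(k : ℝ) * ‖Z k ω‖ ^ 2 := by
    intro ω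
    calc ‖∑ k ∈ Finset.Icc 1 n, Z k ω‖ ^ 2 ≤ (∑ k ∈ Finset.Icc 1 n, ‖Z k ω‖) ^ 2 := by
          gcongr; exact norm_sum_le _ _
      _ ≤ (∑ k ∈ Finset.Icc 1 n, 1 / √(k : ℝ))
            * ∑ k ∈ Finset.Icc 1 n, √(k : ℝ) * ‖Z k ω‖ ^ 2 := by
          apply Finset.sum_sq_le_sum_mul_sum_of_sq_le_mul
          · intro i _; positivity
          · intro i _; positivity
          · intro i hi
            have : (0 : ℝ) < √(i : ℝ) :=
              Real.sqrt_pos.2 (by exact_mod_cast (Finset.mem_Icc.1 hi).1)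
            apply le_of_eq
            field_simp
      _ ≤ _ := by
          gcongr
          exact sum_one_div_sqrt_le n
  have hint : ∀ k ∈ Finset.Icc 1 n, Integrable (fun ω => √(k : ℝ) * ‖Z k ω‖ ^ 2) P :=
    fun k hk => (hZ k (Finset.mem_Icc.1 hk).1).const_mul _
  calc ∫ ω, ‖∑ k ∈ Finset.Icc 1 n, Z k ω‖ ^ 2 ∂P
      ≤ ∫ ω, 2 * √(n : ℝ) * ∑ k ∈ Finset.Icc 1 n, √(k : ℝ) * ‖Z k ω‖ ^ 2 ∂P :=
        integral_mono_of_nonneg (Filter.Eventually.of_forall fun ω => by positivity)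
          ((integrable_finsetSum _ hint).const_mul _) (Filter.Eventually.of_forall hpt)
    _ = 2 * √(n : ℝ) * ∑ k ∈ Finset.Icc 1 n, √(k : ℝ) * ∫ ω, ‖Z k ω‖ ^ 2 ∂P := by
        rw [integral_const_mul, integral_finsetSum _ hint]
        simp_rw [integral_const_mul]
    _ ≤ 2 * √(n : ℝ) * ∑ k ∈ Finset.Icc 1 n, C * (1 / √(k : ℝ)) := by
        refine mul_le_mul_of_nonneg_left (Finset.sum_le_sum fun k hk => ?_) (by positivity)
        have hk1 := (Finset.mem_Icc.1 hk).1
        have h0 : (0 : ℝ) < √(k : ℝ) := Real.sqrt_pos.2 (by exact_mod_cast hk1)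
        have h2 : √(k : ℝ) * √(k : ℝ) = k := Real.mul_self_sqrt (by positivity)
        calc √(k : ℝ) * ∫ ω, ‖Z k ω‖ ^ 2 ∂P ≤ √(k : ℝ) * (C / k) := by gcongr; exact hC k hk1
          _ = √(k : ℝ) * (C / (√(k : ℝ) * √(k : ℝ))) := by rw [h2]
          _ = C * (1 / √(k : ℝ)) := by field_simp
    _ ≤ 2 * √(n : ℝ) * (C * (2 * √(n : ℝ))) := by
        rw [← Finset.mul_sum]
        have hC0 : 0 ≤ C := by
          have := (integral_nonneg fun ω => by positivity).trans (hC 1 le_rfl)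
          simpa using this
        gcongr
        exact sum_one_div_sqrt_le n
    _ = 4 * C * n := by
        have h2 : √(n : ℝ) * √(n : ℝ) = n := Real.mul_self_sqrt (by positivity)
        linear_combination 4 * C * h2

/-! ### Projected Robbins–Monro schemes -/

/-- The mean field `Φ(v) = E[H(ξ, v)]` of a stochastic gradient `H`, for an observation `ξ` of
law `ν`. -/
noncomputable def meanField {𝒳 E : Type*} [MeasurableSpace 𝒳] [NormedAddCommGroup E]
    [NormedSpace ℝ E] (ν : Measure 𝒳) (H : 𝒳 → E → E) (v : E) : E :=
  ∫ x, H x v ∂ν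

/-- A projected Robbins–Monro scheme `V (k + 1) = π (V k - γ k • H (ξ (k + 1)) (V k))`, `k ≥ 1`,
for a mean field with a zero at `θ`, near which it is linearized by `T`. The observations
`ξ (k + 1)` have law `ν` and are independent of the past `ℱ k`; `q` is an envelope of the stochastic
gradient `H` on the bounded set `K`, which contains the ball of radius `δ` about `θ`. The map `π` is the identity on `K` and is only required not to
move away from `θ` and from the points of `K`, up to a multiple `B` of the length of the step. -/
structure IsProjectedScheme {Ω 𝒳 E : Type*} [m : MeasurableSpace Ω] [MeasurableSpace 𝒳]
    [NormedAddCommGroup E] [InnerProductSpace ℝ E] [MeasurableSpace E]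
    (P : Measure Ω) (ν : Measure 𝒳) (H : 𝒳 → E → E) (q : 𝒳 → ℝ) (K : Set E) (θ : E) (π : E → E)
    (T : E →L[ℝ] E) (κ C B D δ : ℝ) (γ : ℕ → ℝ) (ℱ : ℕ → MeasurableSpace Ω) (ξ : ℕ → Ω → 𝒳)
    (V : ℕ → Ω → E) : Prop where
  κ_pos : 0 < κ
  δ_pos : 0 < δ
  B_nonneg : 0 ≤ B
  filtration_le : ∀ k, ℱ k ≤ m
  filtration_mono : Monotone ℱ
  noise_adapted : ∀ k, 1 ≤ k → Measurable[ℱ (k + 1)] (ξ (k + 1))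
  noise_indep : ∀ k, 1 ≤ k → Indep (ℱ k) (MeasurableSpace.comap (ξ (k + 1)) inferInstance) P
  noise_law : ∀ k, 1 ≤ k → P.map (ξ (k + 1)) = ν
  init_adapted : Measurable[ℱ 1] (V 1)
  init_mem : ∀ ω, V 1 ω ∈ K
  step : ∀ k, 1 ≤ k → ∀ ω, V (k + 1) ω = π (V k ω - γ k • H (ξ (k + 1) ω) (V k ω))
  measurable_grad : Measurable (Function.uncurry H)
  measurable_envelope : Measurable q
  norm_grad_le : ∀ x, ∀ v ∈ K, ‖H x v‖ ≤ q x
  envelope_moment : Integrable (fun x => q x ^ 4) ν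
  measurable_proj : Measurable π
  proj_mem : ∀ y, π y ∈ K
  proj_eq_self : ∀ y ∈ K, π y = y
  norm_proj_sub_target_le : ∀ v ∈ K, ∀ y, ‖π y - θ‖ ≤ max ‖y - θ‖ (B * ‖y - v‖)
  norm_proj_sub_le : ∀ v ∈ K, ∀ y, ‖π y - v‖ ≤ B * ‖y - v‖
  norm_sub_target_le : ∀ v ∈ K, ‖v - θ‖ ≤ D
  ball_subset : Metric.ball θ δ ⊆ K
  strongly_monotone : ∀ v ∈ K, κ * ‖v - θ‖ ^ 2 ≤ inner ℝ (v - θ) (meanField ν H v)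
  linearization : ∀ v ∈ K, ‖meanField ν H v - T (v - θ)‖ ≤ C * ‖v - θ‖ ^ 2
  step_pos : ∀ k, 1 ≤ k → 0 < γ k

namespace IsProjectedScheme

variable {Ω 𝒳 E : Type*} [m : MeasurableSpace Ω] [MeasurableSpace 𝒳]
  [NormedAddCommGroup E] [InnerProductSpace ℝ E] [MeasurableSpace E] [BorelSpace E]
  [SecondCountableTopology E] [CompleteSpace E]
  {P : Measure Ω} [IsProbabilityMeasure P] {ν : Measure 𝒳} [IsProbabilityMeasure ν]
  {H : 𝒳 → E → E} {q : 𝒳 → ℝ} {K : Set E} {θ : E} {π : E → E} {T : E →L[ℝ] E}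
  {κ C B D δ : ℝ} {γ : ℕ → ℝ} {ℱ : ℕ → MeasurableSpace Ω} {ξ : ℕ → Ω → 𝒳} {V : ℕ → Ω → E}

lemma target_mem (h : IsProjectedScheme P ν H q K θ π T κ C B D δ γ ℱ ξ V) : θ ∈ K :=
  h.ball_subset (Metric.mem_ball_self h.δ_pos)

lemma envelope_nonneg (h : IsProjectedScheme P ν H q K θ π T κ C B D δ γ ℱ ξ V) (x : 𝒳) :
    0 ≤ q x :=
  (norm_nonneg _).trans (h.norm_grad_le x θ h.target_mem)

lemma iterate_mem (h : IsProjectedScheme P ν H q K θ π T κ C B D δ γ ℱ ξ V) {k : ℕ}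
    (hk : 1 ≤ k) (ω : Ω) : V k ω ∈ K := by
  obtain rfl | hk := hk.eq_or_lt
  · exact h.init_mem ω
  · obtain ⟨k, rfl⟩ := Nat.exists_eq_add_of_lt hk
    rw [h.step (1 + k) (by omega)]
    exact h.proj_mem _

lemma iterate_adapted (h : IsProjectedScheme P ν H q K θ π T κ C B D δ γ ℱ ξ V) {k : ℕ}
    (hk : 1 ≤ k) : Measurable[ℱ k] (V k) := by
  induction k, hk using Nat.le_induction with
  | base => exact h.init_adapted
  | succ k hk ih =>
    have hV : Measurable[ℱ (k + 1)] (V k) := ih.mono (h.filtration_mono k.le_succ) le_rfl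
    have hξ := h.noise_adapted k hk
    have hstep : V (k + 1) = fun ω => π (V k ω - γ k • H (ξ (k + 1) ω) (V k ω)) :=
      funext (h.step k hk)
    rw [hstep]
    have hf : Measurable fun p : 𝒳 × E => π (p.2 - γ k • H p.1 p.2) :=
      h.measurable_proj.comp (measurable_snd.sub (h.measurable_grad.const_smul (γ k)))
    exact hf.comp (hξ.prodMk hV)

lemma measurable_iterate (h : IsProjectedScheme P ν H q K θ π T κ C B D δ γ ℱ ξ V) {k : ℕ}
    (hk : 1 ≤ k) : Measurable (V k) :=
  (h.iterate_adapted hk).mono (h.filtration_le k) le_rfl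

lemma measurable_noise (h : IsProjectedScheme P ν H q K θ π T κ C B D δ γ ℱ ξ V) {k : ℕ}
    (hk : 1 ≤ k) : Measurable (ξ (k + 1)) :=
  (h.noise_adapted k hk).mono (h.filtration_le _) le_rfl

lemma measurable_grad_iterate (h : IsProjectedScheme P ν H q K θ π T κ C B D δ γ ℱ ξ V) {k : ℕ}
    (hk : 1 ≤ k) : Measurable fun ω => H (ξ (k + 1) ω) (V k ω) :=
  h.measurable_grad.comp ((h.measurable_noise hk).prodMk (h.measurable_iterate hk))

lemma norm_grad_iterate_le (h : IsProjectedScheme P ν H q K θ π T κ C B D δ γ ℱ ξ V) {k : ℕ}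
    (hk : 1 ≤ k) (ω : Ω) : ‖H (ξ (k + 1) ω) (V k ω)‖ ≤ q (ξ (k + 1) ω) :=
  h.norm_grad_le _ _ (h.iterate_mem hk ω)

lemma norm_error_le (h : IsProjectedScheme P ν H q K θ π T κ C B D δ γ ℱ ξ V) {k : ℕ}
    (hk : 1 ≤ k) (ω : Ω) : ‖V k ω - θ‖ ≤ D :=
  h.norm_sub_target_le _ (h.iterate_mem hk ω)

lemma indepFun (h : IsProjectedScheme P ν H q K θ π T κ C B D δ γ ℱ ξ V) {k : ℕ} (hk : 1 ≤ k)
    {𝒜 : Type*} [MeasurableSpace 𝒜] {A : Ω → 𝒜} (hA : Measurable[ℱ k] A) :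
    IndepFun A (ξ (k + 1)) P :=
  (IndepFun_iff_Indep _ _ _).2
    (indep_of_indep_of_le_left (h.noise_indep k hk) hA.comap_le)

lemma integrable_envelope_pow (h : IsProjectedScheme P ν H q K θ π T κ C B D δ γ ℱ ξ V) {j : ℕ}
    (hj : j ≤ 4) : Integrable (fun x => q x ^ j) ν := by
  refine ((integrable_const (1 : ℝ)).add h.envelope_moment).mono'
    (h.measurable_envelope.pow_const j).aestronglyMeasurable (.of_forall fun x => ?_)
  have hq := h.envelope_nonneg x
  rw [Real.norm_of_nonneg (by positivity), Pi.add_apply]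
  rcases le_total (q x) 1 with h1 | h1
  · have := pow_le_one₀ (n := j) hq h1
    have : 0 ≤ q x ^ 4 := by positivity
    linarith
  · have := pow_le_pow_right₀ h1 hj
    linarith

lemma integrable_envelope_noise_pow (h : IsProjectedScheme P ν H q K θ π T κ C B D δ γ ℱ ξ V)
    {k : ℕ} (hk : 1 ≤ k) {j : ℕ} (hj : j ≤ 4) :
    Integrable (fun ω => q (ξ (k + 1) ω) ^ j) P := by
  have hi := h.integrable_envelope_pow hj
  rw [← h.noise_law k hk] at hi
  exact hi.comp_measurable (h.measurable_noise hk)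

lemma integral_envelope_noise_pow (h : IsProjectedScheme P ν H q K θ π T κ C B D δ γ ℱ ξ V)
    {k : ℕ} (hk : 1 ≤ k) (j : ℕ) :
    ∫ ω, q (ξ (k + 1) ω) ^ j ∂P = ∫ x, q x ^ j ∂ν := by
  rw [← h.noise_law k hk, integral_map (h.measurable_noise hk).aemeasurable
    (h.measurable_envelope.pow_const j).aestronglyMeasurable]

lemma integrable_error_pow (h : IsProjectedScheme P ν H q K θ π T κ C B D δ γ ℱ ξ V)
    {k : ℕ} (hk : 1 ≤ k) (i : ℕ) : Integrable (fun ω => ‖V k ω - θ‖ ^ i) P := by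
  refine (integrable_const (D ^ i)).mono'
    (((h.measurable_iterate hk).sub_const θ).norm.pow_const i).aestronglyMeasurable
    (.of_forall fun ω => ?_)
  rw [Real.norm_of_nonneg (by positivity)]
  gcongr
  exact h.norm_error_le hk ω

lemma indepFun_error_envelope (h : IsProjectedScheme P ν H q K θ π T κ C B D δ γ ℱ ξ V)
    {k : ℕ} (hk : 1 ≤ k) (i j : ℕ) :
    IndepFun (fun ω => ‖V k ω - θ‖ ^ i) (fun ω => q (ξ (k + 1) ω) ^ j) P :=
  (h.indepFun hk (h.iterate_adapted hk)).comp (φ := fun v => ‖v - θ‖ ^ i) (ψ := fun x => q x ^ j)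
    (measurable_id.sub_const θ |>.norm.pow_const i) (h.measurable_envelope.pow_const j)

lemma integrable_error_pow_mul_envelope_pow
    (h : IsProjectedScheme P ν H q K θ π T κ C B D δ γ ℱ ξ V) {k : ℕ} (hk : 1 ≤ k) (i : ℕ) {j : ℕ}
    (hj : j ≤ 4) : Integrable (fun ω => ‖V k ω - θ‖ ^ i * q (ξ (k + 1) ω) ^ j) P :=
  (h.indepFun_error_envelope hk i j).integrable_mul (h.integrable_error_pow hk i)
    (h.integrable_envelope_noise_pow hk hj)

lemma integral_error_pow_mul_envelope_pow
    (h : IsProjectedScheme P ν H q K θ π T κ C B D δ γ ℱ ξ V) {k : ℕ} (hk : 1 ≤ k) (i : ℕ) {j : ℕ}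
    (hj : j ≤ 4) :
    ∫ ω, ‖V k ω - θ‖ ^ i * q (ξ (k + 1) ω) ^ j ∂P
      = (∫ ω, ‖V k ω - θ‖ ^ i ∂P) * ∫ x, q x ^ j ∂ν := by
  rw [(h.indepFun_error_envelope hk i j).integral_fun_mul_eq_mul_integral
    (h.integrable_error_pow hk i).aestronglyMeasurable
    (h.integrable_envelope_noise_pow hk hj).aestronglyMeasurable,
    h.integral_envelope_noise_pow hk]

lemma integrable_grad (h : IsProjectedScheme P ν H q K θ π T κ C B D δ γ ℱ ξ V) {v : E}
    (hv : v ∈ K) : Integrable (fun x => H x v) ν := by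
  have hq : Integrable q ν := by simpa using h.integrable_envelope_pow (j := 1) (by norm_num)
  exact hq.mono' (h.measurable_grad.comp (measurable_id.prodMk measurable_const)).aestronglyMeasurable
    (.of_forall fun x => h.norm_grad_le x v hv)

lemma norm_meanField_le (h : IsProjectedScheme P ν H q K θ π T κ C B D δ γ ℱ ξ V) {v : E}
    (hv : v ∈ K) : ‖meanField ν H v‖ ≤ ∫ x, q x ∂ν := by
  have hq : Integrable q ν := by simpa using h.integrable_envelope_pow (j := 1) (by norm_num)
  exact norm_integral_le_of_norm_le hq (.of_forall fun x => h.norm_grad_le x v hv)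

lemma measurable_meanField (h : IsProjectedScheme P ν H q K θ π T κ C B D δ γ ℱ ξ V) :
    Measurable (meanField ν H) :=
  (StronglyMeasurable.integral_prod_right (f := fun v x => H x v)
    (h.measurable_grad.comp measurable_swap).stronglyMeasurable).measurable

/-- The centred noise `Φ(V_k) - H(ξ_{k+1}, V_k)` of the `k`-th step, with the sign it has in the
increment of `V`. -/
noncomputable def centredNoise (ν : Measure 𝒳) (H : 𝒳 → E → E) (ξ : ℕ → Ω → 𝒳) (V : ℕ → Ω → E)
    (k : ℕ) (ω : Ω) : E :=
  meanField ν H (V k ω) - H (ξ (k + 1) ω) (V k ω)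

lemma measurable_centredNoise (h : IsProjectedScheme P ν H q K θ π T κ C B D δ γ ℱ ξ V) {k : ℕ}
    (hk : 1 ≤ k) : Measurable (centredNoise ν H ξ V k) :=
  (h.measurable_meanField.comp (h.measurable_iterate hk)).sub (h.measurable_grad_iterate hk)

lemma centredNoise_adapted (h : IsProjectedScheme P ν H q K θ π T κ C B D δ γ ℱ ξ V) {k : ℕ}
    (hk : 1 ≤ k) : Measurable[ℱ (k + 1)] (centredNoise ν H ξ V k) := by
  have hV : Measurable[ℱ (k + 1)] (V k) :=
    (h.iterate_adapted hk).mono (h.filtration_mono k.le_succ) le_rfl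
  exact ((h.measurable_meanField.comp measurable_snd).sub h.measurable_grad).comp
    ((h.noise_adapted k hk).prodMk hV)

lemma norm_centredNoise_sq_le (h : IsProjectedScheme P ν H q K θ π T κ C B D δ γ ℱ ξ V) {k : ℕ}
    (hk : 1 ≤ k) (ω : Ω) :
    ‖centredNoise ν H ξ V k ω‖ ^ 2 ≤ 2 * (∫ x, q x ∂ν) ^ 2 + 2 * q (ξ (k + 1) ω) ^ 2 := by
  have h1 := h.norm_meanField_le (h.iterate_mem hk ω)
  have h2 := h.norm_grad_iterate_le hk ω
  have h3 : ‖centredNoise ν H ξ V k ω‖ ≤ (∫ x, q x ∂ν) + q (ξ (k + 1) ω) :=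
    (norm_sub_le _ _).trans (add_le_add h1 h2)
  calc ‖centredNoise ν H ξ V k ω‖ ^ 2 ≤ ((∫ x, q x ∂ν) + q (ξ (k + 1) ω)) ^ 2 := by gcongr
    _ ≤ _ := by nlinarith [sq_nonneg ((∫ x, q x ∂ν) - q (ξ (k + 1) ω))]

lemma integrable_centredNoise_sq (h : IsProjectedScheme P ν H q K θ π T κ C B D δ γ ℱ ξ V) {k : ℕ}
    (hk : 1 ≤ k) : Integrable (fun ω => ‖centredNoise ν H ξ V k ω‖ ^ 2) P := by
  refine ((integrable_const (2 * (∫ x, q x ∂ν) ^ 2)).add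
    ((h.integrable_envelope_noise_pow hk (j := 2) (by norm_num)).const_mul 2)).mono'
    ((h.measurable_centredNoise hk).norm.pow_const 2).aestronglyMeasurable (.of_forall fun ω => ?_)
  rw [Real.norm_of_nonneg (by positivity)]
  exact h.norm_centredNoise_sq_le hk ω

lemma integral_centredNoise_sq_le (h : IsProjectedScheme P ν H q K θ π T κ C B D δ γ ℱ ξ V) {k : ℕ}
    (hk : 1 ≤ k) : ∫ ω, ‖centredNoise ν H ξ V k ω‖ ^ 2 ∂P
      ≤ 2 * (∫ x, q x ∂ν) ^ 2 + 2 * ∫ x, q x ^ 2 ∂ν := by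
  have hi := (h.integrable_envelope_noise_pow hk (j := 2) (by norm_num)).const_mul 2
  calc _ ≤ ∫ ω, (2 * (∫ x, q x ∂ν) ^ 2 + 2 * q (ξ (k + 1) ω) ^ 2) ∂P :=
        integral_mono (h.integrable_centredNoise_sq hk) ((integrable_const _).add hi)
          (h.norm_centredNoise_sq_le hk)
    _ = _ := by
        rw [integral_add (integrable_const _) hi, integral_const_mul _ fun ω => q (ξ (k + 1) ω) ^ 2,
          h.integral_envelope_noise_pow hk]
        simp

lemma integrable_inner_centredNoise (h : IsProjectedScheme P ν H q K θ π T κ C B D δ γ ℱ ξ V)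
    {k : ℕ} (hk : 1 ≤ k) {A : Ω → E} (hA : Measurable[ℱ k] A)
    (hA2 : Integrable (fun ω => ‖A ω‖ ^ 2) P) :
    Integrable (fun ω => inner ℝ (A ω) (centredNoise ν H ξ V k ω)) P := by
  refine (hA2.add (h.integrable_centredNoise_sq hk)).mono'
    ((hA.mono (h.filtration_le k) le_rfl).inner
      (h.measurable_centredNoise hk)).aestronglyMeasurable (.of_forall fun ω => ?_)
  have h1 := norm_inner_le_norm (𝕜 := ℝ) (A ω) (centredNoise ν H ξ V k ω)
  rw [Pi.add_apply]
  nlinarith [sq_nonneg (‖A ω‖ - ‖centredNoise ν H ξ V k ω‖),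
    sq_nonneg (‖A ω‖), sq_nonneg (‖centredNoise ν H ξ V k ω‖)]

/-- The centred noise is a martingale increment: it is orthogonal to every square integrable
function of the past. -/
lemma integral_inner_centredNoise (h : IsProjectedScheme P ν H q K θ π T κ C B D δ γ ℱ ξ V)
    {k : ℕ} (hk : 1 ≤ k) {A : Ω → E} (hA : Measurable[ℱ k] A)
    (hA2 : Integrable (fun ω => ‖A ω‖ ^ 2) P) :
    ∫ ω, inner ℝ (A ω) (centredNoise ν H ξ V k ω) ∂P = 0 := by
  have hint := h.integrable_inner_centredNoise hk hA hA2
  have hAm : Measurable A := hA.mono (h.filtration_le k) le_rfl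
  have hpast : Measurable fun ω => (A ω, V k ω) := hAm.prodMk (h.measurable_iterate hk)
  have hξ := h.measurable_noise hk
  have hlaw : P.map (fun ω => ((A ω, V k ω), ξ (k + 1) ω))
      = (P.map fun ω => (A ω, V k ω)).prod ν := by
    rw [← h.noise_law k hk]
    exact (indepFun_iff_map_prod_eq_prod_map_map hpast.aemeasurable hξ.aemeasurable).1
      (h.indepFun hk (hA.prodMk (h.iterate_adapted hk)))
  set f : (E × E) × 𝒳 → ℝ := fun p => inner ℝ p.1.1 (meanField ν H p.1.2 - H p.2 p.1.2) with hf
  have hfm : Measurable f :=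
    (measurable_fst.comp measurable_fst).inner
      ((h.measurable_meanField.comp (measurable_snd.comp measurable_fst)).sub
        (h.measurable_grad.comp (measurable_snd.prodMk (measurable_snd.comp measurable_fst))))
  have hfi : Integrable f ((P.map fun ω => (A ω, V k ω)).prod ν) := by
    rw [← hlaw, integrable_map_measure hfm.aestronglyMeasurable (hpast.prodMk hξ).aemeasurable]
    exact hint
  have hprob : IsProbabilityMeasure (P.map fun ω => (A ω, V k ω)) :=
    Measure.isProbabilityMeasure_map hpast.aemeasurable
  calc ∫ ω, inner ℝ (A ω) (centredNoise ν H ξ V k ω) ∂P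
      = ∫ p, f p ∂(P.map fun ω => ((A ω, V k ω), ξ (k + 1) ω)) :=
        (integral_map (hpast.prodMk hξ).aemeasurable hfm.aestronglyMeasurable).symm
    _ = ∫ a, ∫ x, f (a, x) ∂ν ∂(P.map fun ω => (A ω, V k ω)) := by
        rw [hlaw, integral_prod _ hfi]
    _ = ∫ ω, ∫ x, f ((A ω, V k ω), x) ∂ν ∂P :=
        integral_map hpast.aemeasurable
          (hfm.stronglyMeasurable.integral_prod_right' (ν := ν)).aestronglyMeasurable
    _ = ∫ _, (0 : ℝ) ∂P := by
        congr 1 with ω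
        have hg := h.integrable_grad (h.iterate_mem hk ω)
        simp only [hf]
        have hsub : Integrable (fun x => meanField ν H (V k ω) - H x (V k ω)) ν :=
          (integrable_const _).sub hg
        rw [integral_inner hsub, integral_sub (integrable_const _) hg]
        simp [meanField]
    _ = 0 := by simp

end IsProjectedScheme

namespace IsProjectedScheme

variable {Ω 𝒳 E : Type*} [m : MeasurableSpace Ω] [MeasurableSpace 𝒳]
  [NormedAddCommGroup E] [InnerProductSpace ℝ E] [MeasurableSpace E] [BorelSpace E]
  [SecondCountableTopology E] [CompleteSpace E]
  {P : Measure Ω} [IsProbabilityMeasure P] {ν : Measure 𝒳} [IsProbabilityMeasure ν]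
  {H : 𝒳 → E → E} {q : 𝒳 → ℝ} {K : Set E} {θ : E} {π : E → E} {T : E →L[ℝ] E}
  {κ C B D δ : ℝ} {γ : ℕ → ℝ} {ℱ : ℕ → MeasurableSpace Ω} {ξ : ℕ → Ω → 𝒳} {V : ℕ → Ω → E}

/-! ### Convergence rates of the iterates -/

/-- The second term of the maximum accounts for the places where `π` is not `1`-Lipschitz; being
proportional to the step, it only contributes to the quadratic terms of the recursions. -/
lemma norm_error_succ_le (h : IsProjectedScheme P ν H q K θ π T κ C B D δ γ ℱ ξ V) {k : ℕ}
    (hk : 1 ≤ k) (ω : Ω) : ‖V (k + 1) ω - θ‖ ≤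
      max ‖(V k ω - θ) - γ k • H (ξ (k + 1) ω) (V k ω)‖ (B * (γ k * q (ξ (k + 1) ω))) := by
  have hγ := h.step_pos k hk
  rw [h.step k hk]
  refine (h.norm_proj_sub_target_le _ (h.iterate_mem hk ω) _).trans (max_le_max ?_ ?_)
  · rw [sub_right_comm]
  · rw [sub_sub_cancel_left, norm_neg, norm_smul, Real.norm_of_nonneg hγ.le]
    have := h.B_nonneg
    gcongr
    exact h.norm_grad_iterate_le hk ω

lemma inner_error_grad_ge (h : IsProjectedScheme P ν H q K θ π T κ C B D δ γ ℱ ξ V) {k : ℕ}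
    (hk : 1 ≤ k) (ω : Ω) : κ * ‖V k ω - θ‖ ^ 2 - inner ℝ (V k ω - θ) (centredNoise ν H ξ V k ω)
      ≤ inner ℝ (V k ω - θ) (H (ξ (k + 1) ω) (V k ω)) := by
  have := h.strongly_monotone _ (h.iterate_mem hk ω)
  rw [centredNoise, inner_sub_right]
  linarith

lemma error_adapted (h : IsProjectedScheme P ν H q K θ π T κ C B D δ γ ℱ ξ V) {k : ℕ}
    (hk : 1 ≤ k) : Measurable[ℱ k] fun ω => V k ω - θ :=
  (measurable_id.sub_const θ).comp (h.iterate_adapted hk)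

lemma integral_error_sq_succ_le (h : IsProjectedScheme P ν H q K θ π T κ C B D δ γ ℱ ξ V) {k : ℕ}
    (hk : 1 ≤ k) : ∫ ω, ‖V (k + 1) ω - θ‖ ^ 2 ∂P ≤
      (1 - 2 * κ * γ k) * (∫ ω, ‖V k ω - θ‖ ^ 2 ∂P)
        + ((1 + B ^ 2) * ∫ x, q x ^ 2 ∂ν) * γ k ^ 2 := by
  have hγ := h.step_pos k hk
  have he := h.integrable_error_pow hk 2
  have hG := h.integrable_envelope_noise_pow hk (j := 2) (by norm_num)
  have hN := h.integrable_inner_centredNoise hk (h.error_adapted hk) he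
  have hN0 := h.integral_inner_centredNoise hk (h.error_adapted hk) he
  have hpt : ∀ ω, ‖V (k + 1) ω - θ‖ ^ 2 ≤ (1 - 2 * κ * γ k) * ‖V k ω - θ‖ ^ 2
      + 2 * γ k * inner ℝ (V k ω - θ) (centredNoise ν H ξ V k ω)
      + (1 + B ^ 2) * γ k ^ 2 * q (ξ (k + 1) ω) ^ 2 := by
    intro ω
    have h1 := h.norm_error_succ_le hk ω
    have h2 := h.norm_grad_iterate_le hk ω
    have h3 := h.inner_error_grad_ge hk ω
    have hG0 := h.envelope_nonneg (ξ (k + 1) ω)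
    have h4 : ‖(V k ω - θ) - γ k • H (ξ (k + 1) ω) (V k ω)‖ ^ 2
        ≤ (1 - 2 * κ * γ k) * ‖V k ω - θ‖ ^ 2
          + 2 * γ k * inner ℝ (V k ω - θ) (centredNoise ν H ξ V k ω)
          + γ k ^ 2 * q (ξ (k + 1) ω) ^ 2 := by
      rw [norm_sub_sq_real, inner_smul_right, norm_smul, Real.norm_of_nonneg hγ.le, mul_pow]
      have h5 : ‖H (ξ (k + 1) ω) (V k ω)‖ ^ 2 ≤ q (ξ (k + 1) ω) ^ 2 := by gcongr
      have h6 := mul_le_mul_of_nonneg_left h5 (sq_nonneg (γ k))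
      have h7 := mul_le_mul_of_nonneg_left h3 hγ.le
      linarith
    rcases le_max_iff.1 h1 with h5 | h5
    · have h6 : ‖V (k + 1) ω - θ‖ ^ 2 ≤ _ := pow_le_pow_left₀ (norm_nonneg _) h5 2
      have : 0 ≤ B ^ 2 * γ k ^ 2 * q (ξ (k + 1) ω) ^ 2 := by positivity
      linarith
    · have h6 : ‖V (k + 1) ω - θ‖ ^ 2 ≤ _ := pow_le_pow_left₀ (norm_nonneg _) h5 2
      have := (sq_nonneg _).trans h4
      nlinarith
  calc ∫ ω, ‖V (k + 1) ω - θ‖ ^ 2 ∂P ≤ ∫ ω, ((1 - 2 * κ * γ k) * ‖V k ω - θ‖ ^ 2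
      + 2 * γ k * inner ℝ (V k ω - θ) (centredNoise ν H ξ V k ω)
      + (1 + B ^ 2) * γ k ^ 2 * q (ξ (k + 1) ω) ^ 2) ∂P :=
        integral_mono (h.integrable_error_pow (by omega) 2)
          (((he.const_mul _).add (hN.const_mul _)).add (hG.const_mul _)) hpt
    _ = _ := by
      rw [integral_add ((he.const_mul _).fun_add (hN.const_mul _)) (hG.const_mul _),
        integral_add (he.const_mul _) (hN.const_mul _), integral_const_mul, integral_const_mul,
        integral_const_mul, hN0, h.integral_envelope_noise_pow hk 2]
      ring

/-- Expansion of the fourth power of a gradient step. -/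
lemma norm_sub_smul_pow_four_le {e g : E} {t G : ℝ} (ht : 0 ≤ t) (hg : ‖g‖ ≤ G) :
    ‖e - t • g‖ ^ 4 ≤ ‖e‖ ^ 4 - 4 * t * (‖e‖ ^ 2 * inner ℝ e g) + 8 * t ^ 2 * (‖e‖ ^ 2 * G ^ 2)
      + 3 * t ^ 4 * G ^ 4 := by
  have hG : 0 ≤ G := (norm_nonneg g).trans hg
  have hp : |inner ℝ e g| ≤ ‖e‖ * G :=
    (abs_real_inner_le_norm e g).trans (by gcongr)
  have h0 : ‖e - t • g‖ ^ 4 = (‖e‖ ^ 2 - 2 * t * inner ℝ e g + t ^ 2 * ‖g‖ ^ 2) ^ 2 := by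
    have : ‖e - t • g‖ ^ 2 = ‖e‖ ^ 2 - 2 * t * inner ℝ e g + t ^ 2 * ‖g‖ ^ 2 := by
      rw [norm_sub_sq_real, inner_smul_right, norm_smul, Real.norm_of_nonneg ht]; ring
    rw [← this]; ring
  have hs := norm_nonneg e
  have hn := norm_nonneg g
  generalize ‖e‖ = s at *
  generalize ‖g‖ = n at *
  generalize inner ℝ e g = p at *
  have h1 : t ^ 2 * p ^ 2 ≤ t ^ 2 * (s * G) ^ 2 := by
    gcongr ?_ * ?_
    exact sq_le_sq' (neg_le_of_abs_le hp) (le_of_abs_le hp)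
  have h2 : n ^ 2 ≤ G ^ 2 := by gcongr
  have h3 : t ^ 2 * s ^ 2 * n ^ 2 ≤ t ^ 2 * s ^ 2 * G ^ 2 := by gcongr
  have h4 : t ^ 4 * (n ^ 2) ^ 2 ≤ t ^ 4 * (G ^ 2) ^ 2 := by gcongr
  have h5 : -(t ^ 3 * (p * n ^ 2)) ≤ t ^ 3 * (s * G * G ^ 2) := by
    have : -(p * n ^ 2) ≤ s * G * G ^ 2 := by
      calc -(p * n ^ 2) = (-p) * n ^ 2 := by ring
        _ ≤ (s * G) * n ^ 2 := by gcongr; exact neg_le_of_abs_le hp |> fun h => by linarith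
        _ ≤ s * G * G ^ 2 := by gcongr
    calc -(t ^ 3 * (p * n ^ 2)) = t ^ 3 * -(p * n ^ 2) := by ring
      _ ≤ _ := by gcongr
  have h6 : 2 * (t ^ 3 * (s * G * G ^ 2)) ≤ t ^ 2 * G ^ 2 * s ^ 2 + t ^ 4 * G ^ 4 := by
    nlinarith [sq_nonneg (t * G * s - t ^ 2 * G ^ 2)]
  rw [h0]
  nlinarith

lemma integral_error_pow_four_succ_le (h : IsProjectedScheme P ν H q K θ π T κ C B D δ γ ℱ ξ V)
    {k : ℕ} (hk : 1 ≤ k) : ∫ ω, ‖V (k + 1) ω - θ‖ ^ 4 ∂P ≤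
      (1 - 4 * κ * γ k) * (∫ ω, ‖V k ω - θ‖ ^ 4 ∂P)
        + 8 * γ k ^ 2 * ((∫ ω, ‖V k ω - θ‖ ^ 2 ∂P) * ∫ x, q x ^ 2 ∂ν)
        + (3 + B ^ 4) * γ k ^ 4 * ∫ x, q x ^ 4 ∂ν := by
  have hγ := h.step_pos k hk
  have he := h.integrable_error_pow hk 4
  have hG := h.integrable_envelope_noise_pow hk (j := 4) le_rfl
  have heG := h.integrable_error_pow_mul_envelope_pow hk 2 (j := 2) (by norm_num)
  -- the noise enters through its inner product with `‖e‖² e`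
  have hA : Measurable[ℱ k] fun ω => ‖V k ω - θ‖ ^ 2 • (V k ω - θ) :=
    (((measurable_id.sub_const θ).norm.pow_const 2).smul (measurable_id.sub_const θ)).comp
      (h.iterate_adapted hk)
  have hA2 : Integrable (fun ω => ‖‖V k ω - θ‖ ^ 2 • (V k ω - θ)‖ ^ 2) P := by
    refine (h.integrable_error_pow hk 6).congr (.of_forall fun ω => ?_)
    simp only [norm_smul, norm_pow, norm_norm]
    ring
  have hN := h.integrable_inner_centredNoise hk hA hA2
  have hN0 := h.integral_inner_centredNoise hk hA hA2
  simp_rw [real_inner_smul_left] at hN hN0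
  have hpt : ∀ ω, ‖V (k + 1) ω - θ‖ ^ 4 ≤ (1 - 4 * κ * γ k) * ‖V k ω - θ‖ ^ 4
      + 4 * γ k * (‖V k ω - θ‖ ^ 2 * inner ℝ (V k ω - θ) (centredNoise ν H ξ V k ω))
      + 8 * γ k ^ 2 * (‖V k ω - θ‖ ^ 2 * q (ξ (k + 1) ω) ^ 2)
      + (3 + B ^ 4) * γ k ^ 4 * q (ξ (k + 1) ω) ^ 4 := by
    intro ω
    have h1 := h.norm_error_succ_le hk ω
    have h2 := h.norm_grad_iterate_le hk ω
    have h3 := mul_le_mul_of_nonneg_left (h.inner_error_grad_ge hk ω)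
      (show 0 ≤ 4 * γ k * ‖V k ω - θ‖ ^ 2 by positivity)
    have h4 := norm_sub_smul_pow_four_le (e := V k ω - θ) hγ.le h2
    have h4' : 0 ≤ ‖V k ω - θ - γ k • H (ξ (k + 1) ω) (V k ω)‖ ^ 4 := by positivity
    rcases le_max_iff.1 h1 with h5 | h5
    · have h6 : ‖V (k + 1) ω - θ‖ ^ 4 ≤ _ := pow_le_pow_left₀ (norm_nonneg _) h5 4
      have : 0 ≤ B ^ 4 * γ k ^ 4 * q (ξ (k + 1) ω) ^ 4 := by positivity
      linarith
    · have h6 : ‖V (k + 1) ω - θ‖ ^ 4 ≤ _ := pow_le_pow_left₀ (norm_nonneg _) h5 4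
      rw [mul_pow, mul_pow] at h6
      linarith
  calc ∫ ω, ‖V (k + 1) ω - θ‖ ^ 4 ∂P ≤ ∫ ω, ((1 - 4 * κ * γ k) * ‖V k ω - θ‖ ^ 4
      + 4 * γ k * (‖V k ω - θ‖ ^ 2 * inner ℝ (V k ω - θ) (centredNoise ν H ξ V k ω))
      + 8 * γ k ^ 2 * (‖V k ω - θ‖ ^ 2 * q (ξ (k + 1) ω) ^ 2)
      + (3 + B ^ 4) * γ k ^ 4 * q (ξ (k + 1) ω) ^ 4) ∂P :=
        integral_mono (h.integrable_error_pow (by omega) 4)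
          ((((he.const_mul _).add (hN.const_mul _)).add (heG.const_mul _)).add (hG.const_mul _)) hpt
    _ = _ := by
      rw [integral_add (((he.const_mul _).fun_add (hN.const_mul _)).fun_add (heG.const_mul _))
          (hG.const_mul _), integral_add ((he.const_mul _).fun_add (hN.const_mul _)) (heG.const_mul _),
        integral_add (he.const_mul _) (hN.const_mul _), integral_const_mul, integral_const_mul,
        integral_const_mul, integral_const_mul, hN0, h.integral_envelope_noise_pow hk 4,
        h.integral_error_pow_mul_envelope_pow hk 2 (by norm_num)]
      ring

lemma integral_envelope_pow_nonneg (h : IsProjectedScheme P ν H q K θ π T κ C B D δ γ ℱ ξ V)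
    (j : ℕ) : 0 ≤ ∫ x, q x ^ j ∂ν :=
  integral_nonneg fun x => pow_nonneg (h.envelope_nonneg x) j

lemma integral_error_pow_le (h : IsProjectedScheme P ν H q K θ π T κ C B D δ γ ℱ ξ V)
    {k : ℕ} (hk : 1 ≤ k) (j : ℕ) : ∫ ω, ‖V k ω - θ‖ ^ j ∂P ≤ D ^ j := by
  have := integral_mono (h.integrable_error_pow hk j) (integrable_const (D ^ j))
    (fun ω => pow_le_pow_left₀ (norm_nonneg _) (h.norm_error_le hk ω) j)
  simpa using this

section PowerStep

variable {c α : ℝ}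

/-- The quadratic mean rate `E‖V_k - θ‖² = O(γ_k)`. -/
lemma exists_integral_error_sq_le
    (h : IsProjectedScheme P ν H q K θ π T κ C B D δ (fun k => c * (k : ℝ) ^ (-α)) ℱ ξ V)
    (hc : 0 < c) (hα₀ : 0 < α) (hα₁ : α < 1) :
    ∃ C₂ : ℝ, 0 ≤ C₂ ∧ ∀ k : ℕ, 1 ≤ k →
      ∫ ω, ‖V k ω - θ‖ ^ 2 ∂P ≤ C₂ * (c * (k : ℝ) ^ (-α)) := by
  have hκ := h.κ_pos
  have hq2 := h.integral_envelope_pow_nonneg 2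
  obtain ⟨C₂, h0, hC₂⟩ := le_const_mul_step_pow (u := fun k => ∫ ω, ‖V k ω - θ‖ ^ 2 ∂P)
    (κ := 2 * κ) (B := (1 + B ^ 2) * ∫ x, q x ^ 2 ∂ν) (D := D ^ 2) hc hα₀ hα₁ (by positivity)
    (by positivity) 1 (fun k hk => h.integral_error_pow_le hk 2)
    (fun k hk => h.integral_error_sq_succ_le hk)
  exact ⟨C₂, h0, fun k hk => by simpa using hC₂ k hk⟩

lemma step_le (hc : 0 < c) (hα₀ : 0 < α) {k : ℕ} (hk : 1 ≤ k) : c * (k : ℝ) ^ (-α) ≤ c := by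
  have : (k : ℝ) ^ (-α) ≤ 1 :=
    Real.rpow_le_one_of_one_le_of_nonpos (by exact_mod_cast hk) (by linarith)
  nlinarith

/-- The fourth moment rate `E‖V_k - θ‖⁴ = O(γ_k²)`. -/
lemma exists_integral_error_pow_four_le
    (h : IsProjectedScheme P ν H q K θ π T κ C B D δ (fun k => c * (k : ℝ) ^ (-α)) ℱ ξ V)
    (hc : 0 < c) (hα₀ : 0 < α) (hα₁ : α < 1) :
    ∃ C₄ : ℝ, 0 ≤ C₄ ∧ ∀ k : ℕ, 1 ≤ k →
      ∫ ω, ‖V k ω - θ‖ ^ 4 ∂P ≤ C₄ * (c * (k : ℝ) ^ (-α)) ^ 2 := by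
  have hκ := h.κ_pos
  have hq2 := h.integral_envelope_pow_nonneg 2
  have hq4 := h.integral_envelope_pow_nonneg 4
  obtain ⟨C₂, h0, hC₂⟩ := h.exists_integral_error_sq_le hc hα₀ hα₁
  refine le_const_mul_step_pow (u := fun k => ∫ ω, ‖V k ω - θ‖ ^ 4 ∂P) (κ := 4 * κ)
    (B := 8 * C₂ * (∫ x, q x ^ 2 ∂ν) + (3 + B ^ 4) * c * ∫ x, q x ^ 4 ∂ν) (D := D ^ 4)
    hc hα₀ hα₁ (by positivity) (by positivity) 2 (fun k hk => h.integral_error_pow_le hk 4)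
    (fun k hk => (h.integral_error_pow_four_succ_le hk).trans ?_)
  have hγ : 0 < c * (k : ℝ) ^ (-α) := h.step_pos k hk
  have h1 := hC₂ k hk
  have h2 := step_le hc hα₀ hk
  generalize c * (k : ℝ) ^ (-α) = g at *
  have h3 : 8 * g ^ 2 * ((∫ ω, ‖V k ω - θ‖ ^ 2 ∂P) * ∫ x, q x ^ 2 ∂ν)
      ≤ 8 * g ^ 2 * ((C₂ * g) * ∫ x, q x ^ 2 ∂ν) := by gcongr
  have h4 : (3 + B ^ 4) * (g ^ 3 * g) * (∫ x, q x ^ 4 ∂ν)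
      ≤ (3 + B ^ 4) * (g ^ 3 * c) * ∫ x, q x ^ 4 ∂ν := by gcongr
  have h5 := add_le_add
    (add_le_add (le_refl ((1 - 4 * κ * g) * ∫ ω, ‖V k ω - θ‖ ^ 4 ∂P)) h3) h4
  convert h5 using 1 <;> ring

end PowerStep

end IsProjectedScheme

namespace IsProjectedScheme

variable {Ω 𝒳 E : Type*} [m : MeasurableSpace Ω] [MeasurableSpace 𝒳]
  [NormedAddCommGroup E] [InnerProductSpace ℝ E] [MeasurableSpace E] [BorelSpace E]
  [SecondCountableTopology E] [CompleteSpace E]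
  {P : Measure Ω} [IsProbabilityMeasure P] {ν : Measure 𝒳} [IsProbabilityMeasure ν]
  {H : 𝒳 → E → E} {q : 𝒳 → ℝ} {K : Set E} {θ : E} {π : E → E} {T : E →L[ℝ] E}
  {κ C B D δ : ℝ} {γ : ℕ → ℝ} {ℱ : ℕ → MeasurableSpace Ω} {ξ : ℕ → Ω → 𝒳} {V : ℕ → Ω → E}

/-! ### Averaging -/

/-- The linearization inherits the strong monotonicity of the mean field, by scaling. -/
lemma inner_linearization_ge (h : IsProjectedScheme P ν H q K θ π T κ C B D δ γ ℱ ξ V) (v : E) :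
    κ * ‖v‖ ^ 2 ≤ inner ℝ v (T v) := by
  have hlim : Filter.Tendsto (fun s : ℝ => inner ℝ v (T v) + s * (C * ‖v‖ ^ 3))
      (nhdsWithin 0 (Set.Ioi 0)) (nhds (inner ℝ v (T v))) := by
    have : Filter.Tendsto (fun s : ℝ => inner ℝ v (T v) + s * (C * ‖v‖ ^ 3)) (nhds 0)
        (nhds (inner ℝ v (T v) + 0 * (C * ‖v‖ ^ 3))) :=
      Continuous.tendsto (by fun_prop) _
    simpa using this.mono_left nhdsWithin_le_nhds
  have hball : ∀ᶠ s : ℝ in nhdsWithin 0 (Set.Ioi 0), θ + s • v ∈ K := by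
    have : Filter.Tendsto (fun s : ℝ => θ + s • v) (nhds 0) (nhds (θ + (0 : ℝ) • v)) :=
      Continuous.tendsto (by fun_prop) _
    rw [zero_smul, add_zero] at this
    exact (this.mono_left nhdsWithin_le_nhds).eventually
      (Filter.mem_of_superset (Metric.ball_mem_nhds θ h.δ_pos) h.ball_subset)
  refine ge_of_tendsto hlim ?_
  filter_upwards [hball, self_mem_nhdsWithin] with s hs hs0
  rw [Set.mem_Ioi] at hs0
  have h1 := h.strongly_monotone _ hs
  have h2 := h.linearization _ hs
  rw [add_sub_cancel_left] at h1 h2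
  have h3 : inner ℝ (s • v) (meanField ν H (θ + s • v))
      ≤ inner ℝ (s • v) (T (s • v)) + ‖s • v‖ * (C * ‖s • v‖ ^ 2) := by
    have h4 := real_inner_le_norm (s • v) (meanField ν H (θ + s • v) - T (s • v))
    rw [inner_sub_right] at h4
    have := mul_le_mul_of_nonneg_left h2 (norm_nonneg (s • v))
    linarith
  rw [map_smul, real_inner_smul_left _ (s • T v), real_inner_smul_right, norm_smul,
    Real.norm_of_nonneg hs0.le] at h3
  rw [norm_smul, Real.norm_of_nonneg hs0.le] at h1
  have h5 : s ^ 2 * (κ * ‖v‖ ^ 2) ≤ s ^ 2 * (inner ℝ v (T v) + s * (C * ‖v‖ ^ 3)) := by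
    linarith
  exact le_of_mul_le_mul_left h5 (by positivity)

lemma norm_le_norm_linearization (h : IsProjectedScheme P ν H q K θ π T κ C B D δ γ ℱ ξ V)
    (v : E) : κ * ‖v‖ ≤ ‖T v‖ := by
  rcases eq_or_ne v 0 with rfl | hv
  · simp
  · have h1 := (h.inner_linearization_ge v).trans (real_inner_le_norm v (T v))
    have hv0 : 0 < ‖v‖ := norm_pos_iff.2 hv
    exact le_of_mul_le_mul_left (by linarith) hv0

/-- The displacement due to the projection at the `k`-th step. -/
def projError (H : 𝒳 → E → E) (γ : ℕ → ℝ) (ξ : ℕ → Ω → 𝒳) (V : ℕ → Ω → E) (k : ℕ) (ω : Ω) : E :=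
  V (k + 1) ω - (V k ω - γ k • H (ξ (k + 1) ω) (V k ω))

/-- The projection acts only when the iterate or the step is large, hence its effect, relative to
the step, is of second order. -/
lemma norm_projError_sq_le (h : IsProjectedScheme P ν H q K θ π T κ C B D δ γ ℱ ξ V) {k : ℕ}
    (hk : 1 ≤ k) (ω : Ω) : ‖(γ k)⁻¹ • projError H γ ξ V k ω‖ ^ 2 ≤
      (B + 1) ^ 2 * (16 / δ ^ 4 * (‖V k ω - θ‖ ^ 4 * q (ξ (k + 1) ω) ^ 2)
        + 4 / δ ^ 2 * (γ k ^ 2 * q (ξ (k + 1) ω) ^ 4)) := by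
  have hγ := h.step_pos k hk
  have hδ := h.δ_pos
  have hG0 := h.envelope_nonneg (ξ (k + 1) ω)
  have hG := h.norm_grad_iterate_le hk ω
  have hB := h.B_nonneg
  rw [projError, h.step k hk]
  set y := V k ω - γ k • H (ξ (k + 1) ω) (V k ω) with hy
  by_cases hyK : y ∈ K
  · rw [h.proj_eq_self y hyK]
    rw [sub_self, smul_zero, norm_zero, zero_pow two_ne_zero]
    positivity
  have hyV : ‖y - V k ω‖ ≤ γ k * q (ξ (k + 1) ω) := by
    rw [hy, sub_sub_cancel_left, norm_neg, norm_smul, Real.norm_of_nonneg hγ.le]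
    gcongr
  have hr : ‖(γ k)⁻¹ • (π y - y)‖ ≤ (B + 1) * q (ξ (k + 1) ω) := by
    have h1 : ‖π y - y‖ ≤ (B + 1) * (γ k * q (ξ (k + 1) ω)) := by
      calc ‖π y - y‖ = ‖(π y - V k ω) - (y - V k ω)‖ := by rw [sub_sub_sub_cancel_right]
        _ ≤ ‖π y - V k ω‖ + ‖y - V k ω‖ := norm_sub_le _ _
        _ ≤ B * ‖y - V k ω‖ + ‖y - V k ω‖ := by
          gcongr; exact h.norm_proj_sub_le _ (h.iterate_mem hk ω) y
        _ = (B + 1) * ‖y - V k ω‖ := by ring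
        _ ≤ _ := by gcongr
    rw [norm_smul, norm_inv, Real.norm_of_nonneg hγ.le, inv_mul_le_iff₀ hγ]
    linarith
  -- `y` lies outside the ball of radius `δ` about `θ`
  have hfar : δ ≤ ‖V k ω - θ‖ + γ k * q (ξ (k + 1) ω) := by
    have h1 : δ ≤ ‖y - θ‖ := by
      by_contra hlt
      exact hyK (h.ball_subset (by rw [mem_ball_iff_norm]; linarith))
    have h2 : ‖y - θ‖ ≤ ‖y - V k ω‖ + ‖V k ω - θ‖ := norm_sub_le_norm_sub_add_norm_sub _ _ _
    linarith
  have hone : 1 ≤ 16 / δ ^ 4 * ‖V k ω - θ‖ ^ 4 + 4 / δ ^ 2 * (γ k * q (ξ (k + 1) ω)) ^ 2 := by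
    rcases le_total (δ / 2) ‖V k ω - θ‖ with h1 | h1
    · have h2 : (δ / 2) ^ 4 ≤ ‖V k ω - θ‖ ^ 4 := by gcongr
      have h3 : 1 ≤ 16 / δ ^ 4 * ‖V k ω - θ‖ ^ 4 := by
        calc (1 : ℝ) = 16 / δ ^ 4 * (δ / 2) ^ 4 := by field_simp; norm_num
          _ ≤ _ := by gcongr
      have : 0 ≤ 4 / δ ^ 2 * (γ k * q (ξ (k + 1) ω)) ^ 2 := by positivity
      linarith
    · have h1' : δ / 2 ≤ γ k * q (ξ (k + 1) ω) := by linarith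
      have h2 : (δ / 2) ^ 2 ≤ (γ k * q (ξ (k + 1) ω)) ^ 2 := by gcongr
      have h3 : 1 ≤ 4 / δ ^ 2 * (γ k * q (ξ (k + 1) ω)) ^ 2 := by
        calc (1 : ℝ) = 4 / δ ^ 2 * (δ / 2) ^ 2 := by field_simp; norm_num
          _ ≤ _ := by gcongr
      have : 0 ≤ 16 / δ ^ 4 * ‖V k ω - θ‖ ^ 4 := by positivity
      linarith
  calc ‖(γ k)⁻¹ • (π y - y)‖ ^ 2 ≤ ((B + 1) * q (ξ (k + 1) ω)) ^ 2 := by gcongr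
    _ = ((B + 1) * q (ξ (k + 1) ω)) ^ 2 * 1 := by ring
    _ ≤ ((B + 1) * q (ξ (k + 1) ω)) ^ 2 *
        (16 / δ ^ 4 * ‖V k ω - θ‖ ^ 4 + 4 / δ ^ 2 * (γ k * q (ξ (k + 1) ω)) ^ 2) := by gcongr
    _ = _ := by ring

/-- The negligible part of `T (V_k - θ)`: a summation by parts term, the error of linearization, and
the effect of the projection. -/
noncomputable def remainder (ν : Measure 𝒳) (H : 𝒳 → E → E) (θ : E) (T : E →L[ℝ] E) (γ : ℕ → ℝ)
    (ξ : ℕ → Ω → 𝒳) (V : ℕ → Ω → E) (k : ℕ) (ω : Ω) : E :=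
  ((γ k)⁻¹ - (γ (k - 1))⁻¹) • (V k ω - θ) + (T (V k ω - θ) - meanField ν H (V k ω))
    + (γ k)⁻¹ • projError H γ ξ V k ω

/-- Summation by parts in the recursion divided by the step. With the convention `γ 0 = 0`, for which
`(γ 0)⁻¹ = 0`, there is no boundary term at the lower end. -/
lemma linearization_sum (h : IsProjectedScheme P ν H q K θ π T κ C B D δ γ ℱ ξ V) (h0 : γ 0 = 0)
    (n : ℕ) (ω : Ω) : T (∑ k ∈ Finset.Icc 1 n, (V k ω - θ)) =
      ∑ k ∈ Finset.Icc 1 n, remainder ν H θ T γ ξ V k ω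
        + ∑ k ∈ Finset.Icc 1 n, centredNoise ν H ξ V k ω - (γ n)⁻¹ • (V (n + 1) ω - θ) := by
  induction n with
  | zero => simp [h0]
  | succ n ih =>
    have hγ : γ (n + 1) ≠ 0 := (h.step_pos (n + 1) (by omega)).ne'
    rw [Finset.sum_Icc_succ_top (by omega), Finset.sum_Icc_succ_top (by omega),
      Finset.sum_Icc_succ_top (by omega), map_add, ih, remainder, centredNoise, projError,
      Nat.add_sub_cancel]
    simp only [smul_sub, sub_smul, smul_smul, inv_mul_cancel₀ hγ, one_smul, map_sub]
    abel

lemma measurable_remainder (h : IsProjectedScheme P ν H q K θ π T κ C B D δ γ ℱ ξ V) {k : ℕ}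
    (hk : 1 ≤ k) : Measurable (remainder ν H θ T γ ξ V k) := by
  have hV := h.measurable_iterate hk
  have hV' := h.measurable_iterate (k := k + 1) (by omega)
  have hH := h.measurable_grad_iterate hk
  have hΦ := h.measurable_meanField.comp hV
  exact (((hV.sub_const θ).const_smul _).add
    ((T.continuous.measurable.comp (hV.sub_const θ)).sub hΦ)).add
    ((hV'.sub (hV.sub (hH.const_smul _))).const_smul _)

lemma norm_add_three_sq_le (a b c : E) : ‖a + b + c‖ ^ 2 ≤ 3 * (‖a‖ ^ 2 + ‖b‖ ^ 2 + ‖c‖ ^ 2) := by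
  calc ‖a + b + c‖ ^ 2 ≤ (‖a‖ + ‖b‖ + ‖c‖) ^ 2 := by gcongr; exact norm_add₃_le
    _ ≤ _ := by
      nlinarith [sq_nonneg (‖a‖ - ‖b‖), sq_nonneg (‖a‖ - ‖c‖), sq_nonneg (‖b‖ - ‖c‖)]

lemma norm_remainder_sq_le (h : IsProjectedScheme P ν H q K θ π T κ C B D δ γ ℱ ξ V) {k : ℕ}
    (hk : 1 ≤ k) (ω : Ω) : ‖remainder ν H θ T γ ξ V k ω‖ ^ 2 ≤
      3 * (((γ k)⁻¹ - (γ (k - 1))⁻¹) ^ 2 * ‖V k ω - θ‖ ^ 2 + C ^ 2 * ‖V k ω - θ‖ ^ 4 +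
        (B + 1) ^ 2 * (16 / δ ^ 4 * (‖V k ω - θ‖ ^ 4 * q (ξ (k + 1) ω) ^ 2)
        + 4 / δ ^ 2 * (γ k ^ 2 * q (ξ (k + 1) ω) ^ 4))) := by
  refine (norm_add_three_sq_le _ _ _).trans ?_
  have h1 : ‖((γ k)⁻¹ - (γ (k - 1))⁻¹) • (V k ω - θ)‖ ^ 2
      = ((γ k)⁻¹ - (γ (k - 1))⁻¹) ^ 2 * ‖V k ω - θ‖ ^ 2 := by
    rw [norm_smul, mul_pow, Real.norm_eq_abs, sq_abs]
  have h2 : ‖T (V k ω - θ) - meanField ν H (V k ω)‖ ^ 2 ≤ C ^ 2 * ‖V k ω - θ‖ ^ 4 := by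
    have h3 := h.linearization _ (h.iterate_mem hk ω)
    rw [norm_sub_rev] at h3
    calc _ ≤ (C * ‖V k ω - θ‖ ^ 2) ^ 2 := by gcongr
      _ = _ := by ring
  have h3 := h.norm_projError_sq_le hk ω
  gcongr
  exact h1.le

lemma integral_remainder_sq_le (h : IsProjectedScheme P ν H q K θ π T κ C B D δ γ ℱ ξ V) {k : ℕ}
    (hk : 1 ≤ k) : Integrable (fun ω => ‖remainder ν H θ T γ ξ V k ω‖ ^ 2) P ∧
      ∫ ω, ‖remainder ν H θ T γ ξ V k ω‖ ^ 2 ∂P ≤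
      3 * (((γ k)⁻¹ - (γ (k - 1))⁻¹) ^ 2 * (∫ ω, ‖V k ω - θ‖ ^ 2 ∂P)
        + C ^ 2 * (∫ ω, ‖V k ω - θ‖ ^ 4 ∂P) +
        (B + 1) ^ 2 * (16 / δ ^ 4 * ((∫ ω, ‖V k ω - θ‖ ^ 4 ∂P) * ∫ x, q x ^ 2 ∂ν)
        + 4 / δ ^ 2 * (γ k ^ 2 * ∫ x, q x ^ 4 ∂ν))) := by
  have h2 := (h.integrable_error_pow hk 2).const_mul (((γ k)⁻¹ - (γ (k - 1))⁻¹) ^ 2)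
  have h4 := (h.integrable_error_pow hk 4).const_mul (C ^ 2)
  have hm := (h.integrable_error_pow_mul_envelope_pow hk 4 (j := 2) (by norm_num)).const_mul
    (16 / δ ^ 4)
  have hq := ((h.integrable_envelope_noise_pow hk (j := 4) le_rfl).const_mul
    (γ k ^ 2)).const_mul (4 / δ ^ 2)
  have hall := (((h2.fun_add h4).fun_add ((hm.fun_add hq).const_mul ((B + 1) ^ 2))).const_mul 3)
  have hint : Integrable (fun ω => ‖remainder ν H θ T γ ξ V k ω‖ ^ 2) P :=
    hall.mono' ((h.measurable_remainder hk).norm.pow_const 2).aestronglyMeasurable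
      (.of_forall fun ω => by
        rw [Real.norm_of_nonneg (by positivity)]; exact h.norm_remainder_sq_le hk ω)
  refine ⟨hint, (integral_mono hint hall (h.norm_remainder_sq_le hk)).trans_eq ?_⟩
  rw [integral_const_mul, integral_add (h2.fun_add h4) ((hm.fun_add hq).const_mul _),
    integral_add h2 h4, integral_const_mul, integral_const_mul, integral_const_mul,
    integral_add hm hq, integral_const_mul, integral_const_mul, integral_const_mul,
    h.integral_error_pow_mul_envelope_pow hk 4 (by norm_num), h.integral_envelope_noise_pow hk 4]

lemma sum_centredNoise_adapted (h : IsProjectedScheme P ν H q K θ π T κ C B D δ γ ℱ ξ V) (n : ℕ) :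
    Measurable[ℱ (n + 1)] fun ω => ∑ k ∈ Finset.Icc 1 n, centredNoise ν H ξ V k ω := by
  refine Finset.measurable_sum _ fun k hk => ?_
  rw [Finset.mem_Icc] at hk
  exact (h.centredNoise_adapted hk.1).mono (h.filtration_mono (by omega)) le_rfl

/-- The variance of the martingale grows linearly, by orthogonality of its increments. -/
lemma integral_sum_centredNoise_sq_le (h : IsProjectedScheme P ν H q K θ π T κ C B D δ γ ℱ ξ V)
    (n : ℕ) : Integrable (fun ω => ‖∑ k ∈ Finset.Icc 1 n, centredNoise ν H ξ V k ω‖ ^ 2) P ∧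
      ∫ ω, ‖∑ k ∈ Finset.Icc 1 n, centredNoise ν H ξ V k ω‖ ^ 2 ∂P ≤
        (2 * (∫ x, q x ∂ν) ^ 2 + 2 * ∫ x, q x ^ 2 ∂ν) * n := by
  induction n with
  | zero => simp
  | succ n ih =>
    have hn : 1 ≤ n + 1 := by omega
    have hN := h.integrable_centredNoise_sq hn
    have hM := h.sum_centredNoise_adapted n
    have hI := (h.integrable_inner_centredNoise hn hM ih.1).const_mul 2
    have h0 := h.integral_inner_centredNoise hn hM ih.1
    simp_rw [Finset.sum_Icc_succ_top (show 1 ≤ n + 1 by omega), norm_add_sq_real]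
    refine ⟨(ih.1.fun_add hI).fun_add hN, ?_⟩
    rw [integral_add (ih.1.fun_add hI) hN, integral_add ih.1 hI, integral_const_mul, h0]
    have := h.integral_centredNoise_sq_le hn
    push_cast
    linarith [ih.2]

section PowerStep

variable {c α : ℝ}

lemma step_sq_le (hα : 1 / 2 ≤ α) {k : ℕ} (hk : 1 ≤ k) :
    (c * (k : ℝ) ^ (-α)) ^ 2 ≤ c ^ 2 / k := by
  have hk0 : (0 : ℝ) < k := by exact_mod_cast hk
  have h1 : ((k : ℝ) ^ (-α)) ^ 2 ≤ (k : ℝ)⁻¹ := by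
    rw [← Real.rpow_natCast, ← Real.rpow_mul hk0.le, ← Real.rpow_neg_one]
    exact Real.rpow_le_rpow_of_exponent_le (by exact_mod_cast hk) (by push_cast; linarith)
  rw [mul_pow, div_eq_mul_inv]
  gcongr

lemma inv_step_le (hc : 0 < c) (hα₁ : α ≤ 1) {k : ℕ} (hk : 1 ≤ k) :
    (c * (k : ℝ) ^ (-α))⁻¹ ≤ k / c := by
  have hk0 : (0 : ℝ) < k := by exact_mod_cast hk
  have h1 : (k : ℝ) ^ α ≤ k := by
    simpa using Real.rpow_le_rpow_of_exponent_le (x := (k : ℝ)) (by exact_mod_cast hk) hα₁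
  rw [mul_inv, Real.rpow_neg hk0.le, inv_inv, div_eq_inv_mul]
  gcongr

lemma inv_step_sub_sq_mul_step_le (hc : 0 < c) (hα₀ : 0 < α) (hα₁ : α < 1) {k : ℕ} (hk : 1 ≤ k) :
    ((c * (k : ℝ) ^ (-α))⁻¹ - (c * ((k - 1 : ℕ) : ℝ) ^ (-α))⁻¹) ^ 2 * (c * (k : ℝ) ^ (-α))
      ≤ 1 / (c * k) := by
  have hk0 : (0 : ℝ) < k := by exact_mod_cast hk
  obtain ⟨h1, h2⟩ := rpow_sub_rpow_pred_le hα₀.le hα₁.le hk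
  have hg : 0 < c * (k : ℝ) ^ (-α) := mul_pos hc (Real.rpow_pos_of_pos hk0 _)
  have h3 : (c * (k : ℝ) ^ (-α))⁻¹ - (c * ((k - 1 : ℕ) : ℝ) ^ (-α))⁻¹
      = ((k : ℝ) ^ α - ((k - 1 : ℕ) : ℝ) ^ α) / c := by
    rw [mul_inv, mul_inv, Real.rpow_neg hk0.le, Real.rpow_neg (Nat.cast_nonneg _), inv_inv, inv_inv]
    field_simp
  have h4 : ((k : ℝ) ^ α - ((k - 1 : ℕ) : ℝ) ^ α) / c ≤ (c * (k : ℝ) ^ (-α))⁻¹ / k := by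
    rw [mul_inv, Real.rpow_neg hk0.le, inv_inv]
    calc _ ≤ ((k : ℝ) ^ α / k) / c := by gcongr
      _ = _ := by field_simp
  have h5 := inv_step_le hc hα₁.le hk
  rw [h3]
  calc (((k : ℝ) ^ α - ((k - 1 : ℕ) : ℝ) ^ α) / c) ^ 2 * (c * (k : ℝ) ^ (-α))
      ≤ ((c * (k : ℝ) ^ (-α))⁻¹ / k) ^ 2 * (c * (k : ℝ) ^ (-α)) := by
        gcongr
    _ = (c * (k : ℝ) ^ (-α))⁻¹ / k ^ 2 := by field_simp
    _ ≤ (k / c) / k ^ 2 := by gcongr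
    _ = 1 / (c * k) := by field_simp

/-- The averaged iterates converge in quadratic mean at the rate `1 / n`. -/
theorem exists_integral_average_sq_le
    (h : IsProjectedScheme P ν H q K θ π T κ C B D δ (fun k => c * (k : ℝ) ^ (-α)) ℱ ξ V)
    (hc : 0 < c) (hα₀ : 1 / 2 < α) (hα₁ : α < 1) :
    ∃ C' : ℝ, 0 < C' ∧ ∀ n : ℕ, 1 ≤ n →
      Integrable (fun ω => ‖(n : ℝ)⁻¹ • ∑ k ∈ Finset.Icc 1 n, V k ω - θ‖ ^ 2) P ∧
      ∫ ω, ‖(n : ℝ)⁻¹ • ∑ k ∈ Finset.Icc 1 n, V k ω - θ‖ ^ 2 ∂P ≤ C' / n := by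
  have hα : 0 < α := by linarith
  have hκ := h.κ_pos
  have hδ := h.δ_pos
  have hB := h.B_nonneg
  have hq2 := h.integral_envelope_pow_nonneg 2
  have hq4 := h.integral_envelope_pow_nonneg 4
  obtain ⟨C₂, hC₂0, hC₂⟩ := h.exists_integral_error_sq_le hc hα hα₁
  obtain ⟨C₄, hC₄0, hC₄⟩ := h.exists_integral_error_pow_four_le hc hα hα₁
  set A : ℝ := 3 * (C₂ / c + C ^ 2 * (C₄ * c ^ 2) +
    (B + 1) ^ 2 * (16 / δ ^ 4 * (C₄ * c ^ 2 * ∫ x, q x ^ 2 ∂ν)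
      + 4 / δ ^ 2 * (c ^ 2 * ∫ x, q x ^ 4 ∂ν))) with hA
  set R := remainder ν H θ T (fun k => c * (k : ℝ) ^ (-α)) ξ V with hR
  have hR2 : ∀ k : ℕ, 1 ≤ k → ∫ ω, ‖R k ω‖ ^ 2 ∂P ≤ A / k := by
    intro k hk
    have hk0 : (0 : ℝ) < k := by exact_mod_cast hk
    refine (h.integral_remainder_sq_le hk).2.trans ?_
    have h1 : ((c * (k : ℝ) ^ (-α))⁻¹ - (c * ((k - 1 : ℕ) : ℝ) ^ (-α))⁻¹) ^ 2
        * (∫ ω, ‖V k ω - θ‖ ^ 2 ∂P) ≤ C₂ / c / k := by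
      calc _ ≤ ((c * (k : ℝ) ^ (-α))⁻¹ - (c * ((k - 1 : ℕ) : ℝ) ^ (-α))⁻¹) ^ 2
            * (C₂ * (c * (k : ℝ) ^ (-α))) := by gcongr; exact hC₂ k hk
        _ = C₂ * (((c * (k : ℝ) ^ (-α))⁻¹ - (c * ((k - 1 : ℕ) : ℝ) ^ (-α))⁻¹) ^ 2
            * (c * (k : ℝ) ^ (-α))) := by ring
        _ ≤ C₂ * (1 / (c * k)) := by gcongr; exact inv_step_sub_sq_mul_step_le hc hα hα₁ hk
        _ = C₂ / c / k := by field_simp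
    have h3 := step_sq_le (c := c) hα₀.le hk
    have h2 : (∫ ω, ‖V k ω - θ‖ ^ 4 ∂P) ≤ C₄ * (c ^ 2 / k) := (hC₄ k hk).trans (by gcongr)
    calc _ ≤ 3 * (C₂ / c / k + C ^ 2 * (C₄ * (c ^ 2 / k)) +
          (B + 1) ^ 2 * (16 / δ ^ 4 * (C₄ * (c ^ 2 / k) * ∫ x, q x ^ 2 ∂ν)
          + 4 / δ ^ 2 * (c ^ 2 / k * ∫ x, q x ^ 4 ∂ν))) := by gcongr
      _ = A / k := by rw [hA]; ring
  set M : ℝ := 2 * (∫ x, q x ∂ν) ^ 2 + 2 * ∫ x, q x ^ 2 ∂ν with hM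
  set C' : ℝ := 3 * (4 * A + M + C₂ / c) / κ ^ 2 with hC'
  have hA0 : 0 ≤ A := by positivity
  have hM0 : 0 ≤ M := by positivity
  have hC'0 : 0 ≤ C' := by positivity
  have key : ∀ n : ℕ, 1 ≤ n →
      Integrable (fun ω => ‖(n : ℝ)⁻¹ • ∑ k ∈ Finset.Icc 1 n, V k ω - θ‖ ^ 2) P ∧
      ∫ ω, ‖(n : ℝ)⁻¹ • ∑ k ∈ Finset.Icc 1 n, V k ω - θ‖ ^ 2 ∂P ≤ C' / n := by
    intro n hn
    have hn0 : (0 : ℝ) < n := by exact_mod_cast hn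
    have hγ : 0 < c * (n : ℝ) ^ (-α) := h.step_pos n hn
    -- `0 ^ (-α) = 0`, the convention required by `linearization_sum`
    have h0 : c * ((0 : ℕ) : ℝ) ^ (-α) = 0 := by
      rw [Nat.cast_zero, Real.zero_rpow (by linarith), mul_zero]
    have hsum : ∀ ω, (n : ℝ)⁻¹ • ∑ k ∈ Finset.Icc 1 n, V k ω - θ
        = (n : ℝ)⁻¹ • ∑ k ∈ Finset.Icc 1 n, (V k ω - θ) := by
      intro ω
      rw [Finset.sum_sub_distrib, Finset.sum_const, Nat.card_Icc, Nat.add_sub_cancel, smul_sub,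
        ← Nat.cast_smul_eq_nsmul ℝ, smul_smul, inv_mul_cancel₀ hn0.ne', one_smul]
    have hRi : ∀ k, 1 ≤ k → Integrable (fun ω => ‖R k ω‖ ^ 2) P :=
      fun k hk => (h.integral_remainder_sq_le hk).1
    have hSR := integral_norm_sum_sq_le n hRi hR2
    have hSN := h.integral_sum_centredNoise_sq_le n
    have hL : ∫ ω, ‖V (n + 1) ω - θ‖ ^ 2 ∂P ≤ C₂ * (c * (n : ℝ) ^ (-α)) := by
      refine (hC₂ (n + 1) (by omega)).trans ?_
      gcongr ?_ * (_ * ?_)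
      exact Real.rpow_le_rpow_of_nonpos hn0 (by push_cast; linarith) (by linarith)
    have hSRi : Integrable (fun ω => ‖∑ k ∈ Finset.Icc 1 n, R k ω‖ ^ 2) P := by
      have hmem : ∀ k ∈ Finset.Icc 1 n, MemLp (R k) 2 P := fun k hk =>
        (memLp_two_iff_integrable_sq_norm
          (h.measurable_remainder (Finset.mem_Icc.1 hk).1).aestronglyMeasurable).2
          (hRi k (Finset.mem_Icc.1 hk).1)
      have := memLp_finsetSum _ hmem
      exact (memLp_two_iff_integrable_sq_norm this.1).1 this
    have hLi := (h.integrable_error_pow (k := n + 1) (by omega) 2).const_mul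
      ((c * (n : ℝ) ^ (-α))⁻¹ ^ 2)
    have hall := ((hSRi.fun_add hSN.1).fun_add hLi).const_mul (3 / (κ ^ 2 * n ^ 2))
    have hpt : ∀ ω, ‖(n : ℝ)⁻¹ • ∑ k ∈ Finset.Icc 1 n, V k ω - θ‖ ^ 2 ≤ 3 / (κ ^ 2 * n ^ 2) *
        (‖∑ k ∈ Finset.Icc 1 n, R k ω‖ ^ 2 + ‖∑ k ∈ Finset.Icc 1 n, centredNoise ν H ξ V k ω‖ ^ 2
          + (c * (n : ℝ) ^ (-α))⁻¹ ^ 2 * ‖V (n + 1) ω - θ‖ ^ 2) := by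
      intro ω
      rw [hsum, norm_smul, norm_inv, Real.norm_of_nonneg hn0.le, mul_pow]
      have h1 := h.norm_le_norm_linearization (∑ k ∈ Finset.Icc 1 n, (V k ω - θ))
      rw [h.linearization_sum h0, sub_eq_add_neg] at h1
      have h2 : (κ * ‖∑ k ∈ Finset.Icc 1 n, (V k ω - θ)‖) ^ 2 ≤ _ :=
        (pow_le_pow_left₀ (by positivity) h1 2).trans (norm_add_three_sq_le _ _ _)
      rw [norm_neg, norm_smul, norm_inv, Real.norm_of_nonneg hγ.le, mul_pow, mul_pow] at h2
      rw [div_mul_eq_mul_div, le_div_iff₀ (by positivity)]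
      calc _ = κ ^ 2 * ‖∑ k ∈ Finset.Icc 1 n, (V k ω - θ)‖ ^ 2 := by field_simp
        _ ≤ _ := h2
    have hmeas : Measurable fun ω => ‖(n : ℝ)⁻¹ • ∑ k ∈ Finset.Icc 1 n, V k ω - θ‖ ^ 2 :=
      (((Finset.measurable_sum _ fun k hk =>
        h.measurable_iterate (Finset.mem_Icc.1 hk).1).const_smul _).sub_const θ).norm.pow_const 2
    have hint : Integrable (fun ω => ‖(n : ℝ)⁻¹ • ∑ k ∈ Finset.Icc 1 n, V k ω - θ‖ ^ 2) P :=
      hall.mono' hmeas.aestronglyMeasurable (.of_forall fun ω => by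
        rw [Real.norm_of_nonneg (by positivity)]; exact hpt ω)
    refine ⟨hint, ?_⟩
    calc _ ≤ _ := integral_mono hint hall hpt
      _ = 3 / (κ ^ 2 * n ^ 2) * ((∫ ω, ‖∑ k ∈ Finset.Icc 1 n, R k ω‖ ^ 2 ∂P)
          + (∫ ω, ‖∑ k ∈ Finset.Icc 1 n, centredNoise ν H ξ V k ω‖ ^ 2 ∂P)
          + (c * (n : ℝ) ^ (-α))⁻¹ ^ 2 * ∫ ω, ‖V (n + 1) ω - θ‖ ^ 2 ∂P) := by
        rw [integral_const_mul, integral_add (hSRi.fun_add hSN.1) hLi, integral_add hSRi hSN.1,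
          integral_const_mul]
      _ ≤ 3 / (κ ^ 2 * n ^ 2) * (4 * A * n + M * n + C₂ / c * n) := by
        have h6 : (c * (n : ℝ) ^ (-α))⁻¹ ^ 2 * ∫ ω, ‖V (n + 1) ω - θ‖ ^ 2 ∂P ≤ C₂ / c * n := by
          calc _ ≤ (c * (n : ℝ) ^ (-α))⁻¹ ^ 2 * (C₂ * (c * (n : ℝ) ^ (-α))) := by gcongr
            _ = C₂ * (c * (n : ℝ) ^ (-α))⁻¹ := by field_simp
            _ ≤ C₂ * (n / c) := by gcongr; exact inv_step_le hc hα₁.le hn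
            _ = _ := by ring
        have h7 := hSN.2
        gcongr
      _ = C' / n := by rw [hC']; field_simp
  -- `C' + 1`, since `C'` may vanish and the constant has to be positive
  refine ⟨C' + 1, by positivity, fun n hn => ⟨(key n hn).1, (key n hn).2.trans ?_⟩⟩
  gcongr
  linarith

end PowerStep

end IsProjectedScheme

/-! ### Expansion of the norm and of the direction -/

section Expansion

variable {F : Type*} [NormedAddCommGroup F] [InnerProductSpace ℝ F]

/-- Second order expansion of the norm, obtained by rationalizing `‖Y - w‖ - ‖Y‖`. -/
lemma abs_norm_sub_sub_norm_add_le {Y : F} (hY : Y ≠ 0) (w : F) :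
    |‖Y - w‖ - ‖Y‖ + inner ℝ Y w / ‖Y‖| ≤ 2 * ‖w‖ ^ 2 / ‖Y‖ := by
  have hn : 0 < ‖Y‖ := norm_pos_iff.2 hY
  have hm : 0 ≤ ‖Y - w‖ := norm_nonneg _
  have hp := abs_real_inner_le_norm Y w
  have hd : |‖Y - w‖ - ‖Y‖| ≤ ‖w‖ := by
    have := abs_norm_sub_norm_le (Y - w) Y
    simpa using this
  have hsq : ‖Y - w‖ ^ 2 = ‖Y‖ ^ 2 - 2 * inner ℝ Y w + ‖w‖ ^ 2 := norm_sub_sq_real Y w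
  have hw : 0 ≤ ‖w‖ := norm_nonneg w
  generalize ‖Y - w‖ = a at *
  generalize ‖Y‖ = n at *
  generalize ‖w‖ = s at *
  generalize inner ℝ Y w = p at *
  have hmn : 0 < a + n := by linarith
  have e : a - n + p / n = s ^ 2 / (a + n) + p / n * (a - n) / (a + n) := by
    field_simp
    nlinarith
  have h1 : |p / n| ≤ s := by
    rw [abs_div, abs_of_pos hn, div_le_iff₀ hn]; linarith
  have h2 : |p / n * (a - n) / (a + n)| ≤ s ^ 2 / (a + n) := by
    rw [abs_div, abs_of_pos hmn, abs_mul, sq]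
    gcongr
  have h3 : s ^ 2 / (a + n) ≤ s ^ 2 / n := by gcongr; linarith
  rw [e]
  calc _ ≤ |s ^ 2 / (a + n)| + |p / n * (a - n) / (a + n)| := abs_add_le _ _
    _ ≤ s ^ 2 / n + s ^ 2 / n := by
      rw [abs_of_nonneg (by positivity)]; linarith
    _ = _ := by ring

lemma norm_inv_smul_self_le (Y : F) : ‖‖Y‖⁻¹ • Y‖ ≤ 1 := by
  rw [norm_smul, norm_inv, norm_norm]
  exact inv_mul_le_one

/-- No condition on `Y - w` is needed: where it vanishes, so does the left direction. -/
lemma norm_direction_sub_le {Y : F} (hY : Y ≠ 0) (w : F) :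
    ‖‖Y - w‖⁻¹ • (Y - w) - ‖Y‖⁻¹ • Y‖ ≤ 2 * ‖w‖ / ‖Y‖ := by
  have hn : 0 < ‖Y‖ := norm_pos_iff.2 hY
  rcases eq_or_ne (Y - w) 0 with h0 | h0
  · have hw : ‖w‖ = ‖Y‖ := by rw [sub_eq_zero.1 h0]
    rw [h0, smul_zero, zero_sub, norm_neg, hw]
    have := norm_inv_smul_self_le Y
    rw [mul_div_assoc, div_self hn.ne']
    linarith
  have hm : 0 < ‖Y - w‖ := norm_pos_iff.2 h0
  have e : ‖Y - w‖⁻¹ • (Y - w) - ‖Y‖⁻¹ • Y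
      = ‖Y‖⁻¹ • ((‖Y‖ - ‖Y - w‖) • (‖Y - w‖⁻¹ • (Y - w)) - w) := by
    rw [sub_smul, smul_smul ‖Y - w‖, mul_inv_cancel₀ hm.ne', one_smul, sub_sub, sub_add_cancel,
      smul_sub ‖Y‖⁻¹, smul_smul ‖Y‖⁻¹ ‖Y‖, inv_mul_cancel₀ hn.ne', one_smul]
  rw [e, norm_smul, norm_inv, norm_norm, inv_mul_eq_div]
  gcongr
  have hd : |‖Y‖ - ‖Y - w‖| ≤ ‖w‖ := by
    have := abs_norm_sub_norm_le Y (Y - w)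
    simpa using this
  calc _ ≤ ‖(‖Y‖ - ‖Y - w‖) • (‖Y - w‖⁻¹ • (Y - w))‖ + ‖w‖ := norm_sub_le _ _
    _ ≤ ‖w‖ * 1 + ‖w‖ := by
      rw [norm_smul, Real.norm_eq_abs]
      gcongr
      exact norm_inv_smul_self_le _
    _ = _ := by ring

/-- Second order expansion of the direction `Y / ‖Y‖`. -/
lemma norm_direction_expansion_le {Y : F} (hY : Y ≠ 0) (w : F) :
    ‖‖Y - w‖⁻¹ • (Y - w) - ‖Y‖⁻¹ • Y + ‖Y‖⁻¹ • (w - (inner ℝ Y w / ‖Y‖ ^ 2) • Y)‖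
      ≤ 4 * ‖w‖ ^ 2 / ‖Y‖ ^ 2 := by
  have hn : 0 < ‖Y‖ := norm_pos_iff.2 hY
  -- the error is controlled by those of the norm and, to first order, of the direction
  have e : ‖Y - w‖⁻¹ • (Y - w) - ‖Y‖⁻¹ • Y + ‖Y‖⁻¹ • (w - (inner ℝ Y w / ‖Y‖ ^ 2) • Y)
      = ‖Y‖⁻¹ • ((inner ℝ Y w / ‖Y‖) • (‖Y - w‖⁻¹ • (Y - w) - ‖Y‖⁻¹ • Y)
        - (‖Y - w‖ - ‖Y‖ + inner ℝ Y w / ‖Y‖) • (‖Y - w‖⁻¹ • (Y - w))) := by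
    have h1 : ‖Y - w‖ • (‖Y - w‖⁻¹ • (Y - w)) = Y - w := by
      rcases eq_or_ne (Y - w) 0 with h0 | h0
      · rw [h0]; simp
      · rw [smul_smul, mul_inv_cancel₀ (norm_ne_zero_iff.2 h0), one_smul]
    have h2 : ‖Y‖ • (‖Y‖⁻¹ • (‖Y - w‖⁻¹ • (Y - w))) = ‖Y - w‖⁻¹ • (Y - w) := by
      rw [smul_smul, mul_inv_cancel₀ hn.ne', one_smul]
    rw [add_smul, sub_smul, h1]
    generalize ‖Y - w‖⁻¹ • (Y - w) = Z at *
    have h3 : ‖Y‖⁻¹ • (‖Y‖ • Z) = Z := by rw [smul_smul, inv_mul_cancel₀ hn.ne', one_smul]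
    have h4 : ‖Y‖⁻¹ • ((inner ℝ Y w / ‖Y‖) • (‖Y‖⁻¹ • Y))
        = ‖Y‖⁻¹ • ((inner ℝ Y w / ‖Y‖ ^ 2) • Y) := by
      rw [smul_smul, smul_smul, smul_smul]; congr 1; field_simp
    simp only [smul_sub, smul_add, h3, h4]
    abel
  have hp : |inner ℝ Y w / ‖Y‖| ≤ ‖w‖ := by
    rw [abs_div, abs_of_pos hn, div_le_iff₀ hn]
    linarith [abs_real_inner_le_norm Y w]
  rw [e, norm_smul, norm_inv, norm_norm, inv_mul_eq_div, div_le_iff₀ hn]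
  calc _ ≤ ‖(inner ℝ Y w / ‖Y‖) • (‖Y - w‖⁻¹ • (Y - w) - ‖Y‖⁻¹ • Y)‖
        + ‖(‖Y - w‖ - ‖Y‖ + inner ℝ Y w / ‖Y‖) • (‖Y - w‖⁻¹ • (Y - w))‖ := norm_sub_le _ _
    _ ≤ ‖w‖ * (2 * ‖w‖ / ‖Y‖) + 2 * ‖w‖ ^ 2 / ‖Y‖ * 1 := by
      rw [norm_smul, norm_smul, Real.norm_eq_abs, Real.norm_eq_abs]
      gcongr
      · exact norm_direction_sub_le hY w
      · exact abs_norm_sub_sub_norm_add_le hY w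
      · exact norm_inv_smul_self_le _
    _ = _ := by field_simp; ring

end Expansion

/-! ### The stochastic gradient -/

section Gradient

variable {d : ℕ}

lemma norm_param_sq (y : Param d) : ‖y‖ ^ 2 = ‖y.fst‖ ^ 2 + y.snd ^ 2 := by
  rw [WithLp.prod_norm_sq_eq_of_L2, Real.norm_eq_abs, sq_abs]

lemma norm_param_le (y : Param d) : ‖y‖ ≤ ‖y.fst‖ + |y.snd| := by
  refine abs_le_of_sq_le_sq' ?_ (by positivity) |>.2
  rw [norm_param_sq, ← sq_abs y.snd]
  nlinarith [norm_nonneg y.fst, abs_nonneg y.snd]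

lemma norm_fst_le_param (y : Param d) : ‖y.fst‖ ≤ ‖y‖ := by
  refine abs_le_of_sq_le_sq' ?_ (by positivity) |>.2
  rw [norm_param_sq]; nlinarith [sq_nonneg y.snd]

lemma abs_snd_le_param (y : Param d) : |y.snd| ≤ ‖y‖ := by
  refine abs_le_of_sq_le_sq' ?_ (by positivity) |>.2
  rw [norm_param_sq, sq_abs]; nlinarith [sq_nonneg ‖y.fst‖]

lemma param_ext {y y' : Param d} (h1 : y.fst = y'.fst) (h2 : y.snd = y'.snd) : y = y' :=
  (WithLp.equiv 2 _).injective (Prod.ext h1 h2)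

lemma stochGrad_fst (x : Vec d) (y : Param d) :
    (stochGrad x y).fst = y.snd • (‖x - y.fst‖⁻¹ • (x - y.fst)) - (x - y.fst) := by
  change y.fst - x - (y.snd / ‖y.fst - x‖) • (y.fst - x) = _
  rw [norm_sub_rev y.fst x, smul_smul, ← div_eq_mul_inv, ← neg_sub x y.fst, smul_neg]
  abel

lemma stochGrad_snd (x : Vec d) (y : Param d) : (stochGrad x y).snd = y.snd - ‖x - y.fst‖ := by
  change y.snd - ‖y.fst - x‖ = _
  rw [norm_sub_rev]

lemma measurable_fst_param : Measurable (fun y : Param d => y.fst) :=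
  (WithLp.prod_continuous_ofLp 2 _ _).fst.measurable

lemma measurable_snd_param : Measurable (fun y : Param d => y.snd) :=
  (WithLp.prod_continuous_ofLp 2 _ _).snd.measurable

lemma measurable_mkParam {Ω : Type*} [MeasurableSpace Ω] {f : Ω → Vec d} {g : Ω → ℝ}
    (hf : Measurable f) (hg : Measurable g) : Measurable fun ω => mkParam (f ω) (g ω) :=
  (WithLp.prod_continuous_toLp 2 _ _).measurable.comp (hf.prodMk hg)

lemma measurable_stochGrad : Measurable (Function.uncurry (stochGrad (d := d))) := by
  have h1 : Measurable fun p : Vec d × Param d => p.2.fst - p.1 :=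
    (measurable_fst_param.comp measurable_snd).sub measurable_fst
  have h2 : Measurable fun p : Vec d × Param d => p.2.snd := measurable_snd_param.comp measurable_snd
  exact measurable_mkParam (h1.sub ((h2.div h1.norm).smul h1)) (h2.sub h1.norm)

lemma norm_stochGrad_le (x μ : Vec d) (y : Param d) :
    ‖stochGrad x y‖ ≤ 2 * (‖x - μ‖ + (‖y.fst - μ‖ + |y.snd|)) := by
  have h1 : ‖x - y.fst‖ ≤ ‖x - μ‖ + ‖y.fst - μ‖ := by
    rw [norm_sub_rev y.fst μ]; exact norm_sub_le_norm_sub_add_norm_sub _ _ _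
  have h2 : ‖(stochGrad x y).fst‖ ≤ |y.snd| + ‖x - y.fst‖ := by
    rw [stochGrad_fst]
    refine (norm_sub_le _ _).trans ?_
    rw [norm_smul, Real.norm_eq_abs]
    gcongr
    exact mul_le_of_le_one_right (abs_nonneg _) (norm_inv_smul_self_le _)
  have h3 : |(stochGrad x y).snd| ≤ |y.snd| + ‖x - y.fst‖ := by
    rw [stochGrad_snd]
    exact (abs_sub _ _).trans (by rw [abs_norm])
  linarith [norm_param_le (stochGrad x y)]

/-- The derivative at `(μ, rs)` of `y ↦ stochGrad x y`, in the direction `e`. -/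
noncomputable def stochGradDeriv (μ : Vec d) (rs : ℝ) (x : Vec d) (e : Param d) : Param d :=
  mkParam (e.fst - rs • (‖x - μ‖⁻¹ • (e.fst - (inner ℝ (x - μ) e.fst / ‖x - μ‖ ^ 2) • (x - μ)))
      + e.snd • (‖x - μ‖⁻¹ • (x - μ)))
    (e.snd + inner ℝ (x - μ) e.fst / ‖x - μ‖)

lemma stochGradDeriv_add (μ : Vec d) (rs : ℝ) (x : Vec d) (e e' : Param d) :
    stochGradDeriv μ rs x (e + e') = stochGradDeriv μ rs x e + stochGradDeriv μ rs x e' := by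
  apply param_ext
  · change (e.fst + e'.fst) - rs • (‖x - μ‖⁻¹ • ((e.fst + e'.fst)
        - (inner ℝ (x - μ) (e.fst + e'.fst) / ‖x - μ‖ ^ 2) • (x - μ)))
      + (e.snd + e'.snd) • (‖x - μ‖⁻¹ • (x - μ)) =
      (e.fst - rs • (‖x - μ‖⁻¹ • (e.fst - (inner ℝ (x - μ) e.fst / ‖x - μ‖ ^ 2) • (x - μ)))
      + e.snd • (‖x - μ‖⁻¹ • (x - μ))) +
      (e'.fst - rs • (‖x - μ‖⁻¹ • (e'.fst - (inner ℝ (x - μ) e'.fst / ‖x - μ‖ ^ 2) • (x - μ)))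
      + e'.snd • (‖x - μ‖⁻¹ • (x - μ)))
    rw [inner_add_right]
    module
  · change (e.snd + e'.snd) + inner ℝ (x - μ) (e.fst + e'.fst) / ‖x - μ‖ =
      (e.snd + inner ℝ (x - μ) e.fst / ‖x - μ‖) + (e'.snd + inner ℝ (x - μ) e'.fst / ‖x - μ‖)
    rw [inner_add_right]
    ring

lemma stochGradDeriv_smul (μ : Vec d) (rs : ℝ) (x : Vec d) (t : ℝ) (e : Param d) :
    stochGradDeriv μ rs x (t • e) = t • stochGradDeriv μ rs x e := by
  apply param_ext
  · change (t • e.fst) - rs • (‖x - μ‖⁻¹ • ((t • e.fst)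
        - (inner ℝ (x - μ) (t • e.fst) / ‖x - μ‖ ^ 2) • (x - μ)))
      + (t * e.snd) • (‖x - μ‖⁻¹ • (x - μ)) =
      t • (e.fst - rs • (‖x - μ‖⁻¹ • (e.fst - (inner ℝ (x - μ) e.fst / ‖x - μ‖ ^ 2) • (x - μ)))
      + e.snd • (‖x - μ‖⁻¹ • (x - μ)))
    rw [inner_smul_right]
    module
  · change (t * e.snd) + inner ℝ (x - μ) (t • e.fst) / ‖x - μ‖ =
      t * (e.snd + inner ℝ (x - μ) e.fst / ‖x - μ‖)
    rw [inner_smul_right]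
    ring

lemma measurable_stochGradDeriv (μ : Vec d) (rs : ℝ) (e : Param d) :
    Measurable fun x => stochGradDeriv μ rs x e := by
  have h1 : Measurable fun x : Vec d => x - μ := measurable_id.sub_const μ
  have h2 : Measurable fun x : Vec d => inner ℝ (x - μ) e.fst := h1.inner_const
  refine measurable_mkParam ?_ ?_
  · exact (measurable_const.sub ((h1.norm.inv.smul (measurable_const.sub
      ((h2.div (h1.norm.pow_const 2)).smul h1))).const_smul rs)).add
      ((h1.norm.inv.smul h1).const_smul e.snd)
  · exact measurable_const.add (h2.div h1.norm)

/-- The error of the first order expansion of the stochastic gradient at `(μ, rs)` is quadratic, with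
a constant that is integrable as soon as `‖X - μ‖⁻²` is. -/
lemma norm_stochGrad_sub_sub_deriv_le {μ : Vec d} {rs : ℝ} (hrs : 0 ≤ rs) {x : Vec d} (hx : x ≠ μ)
    (y : Param d) :
    ‖stochGrad x y - stochGrad x (mkParam μ rs) - stochGradDeriv μ rs x (y - mkParam μ rs)‖
      ≤ ‖y - mkParam μ rs‖ ^ 2 * (4 * rs * (‖x - μ‖ ^ 2)⁻¹ + 3 * ‖x - μ‖⁻¹) := by
  have hY : x - μ ≠ 0 := sub_ne_zero.2 hx
  set e := y - mkParam μ rs with he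
  have hz : x - y.fst = (x - μ) - e.fst := by
    change x - y.fst = (x - μ) - (y.fst - μ); abel
  have ha : y.snd = rs + e.snd := by change y.snd = rs + (y.snd - rs); ring
  set w := e.fst with hw
  set b := e.snd with hb
  set Y := x - μ with hYdef
  have hn : 0 < ‖Y‖ := norm_pos_iff.2 hY
  have h1 : (stochGrad x y - stochGrad x (mkParam μ rs) - stochGradDeriv μ rs x e).fst
      = rs • (‖Y - w‖⁻¹ • (Y - w) - ‖Y‖⁻¹ • Y + ‖Y‖⁻¹ • (w - (inner ℝ Y w / ‖Y‖ ^ 2) • Y))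
        + b • (‖Y - w‖⁻¹ • (Y - w) - ‖Y‖⁻¹ • Y) := by
    change (stochGrad x y).fst - (stochGrad x (mkParam μ rs)).fst - (w
      - rs • (‖Y‖⁻¹ • (w - (inner ℝ Y w / ‖Y‖ ^ 2) • Y)) + b • (‖Y‖⁻¹ • Y)) = _
    rw [stochGrad_fst, stochGrad_fst]
    change y.snd • (‖x - y.fst‖⁻¹ • (x - y.fst)) - (x - y.fst)
      - (rs • (‖Y‖⁻¹ • Y) - Y) - _ = _
    rw [hz, ha]
    module
  have h2 : (stochGrad x y - stochGrad x (mkParam μ rs) - stochGradDeriv μ rs x e).snd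
      = -(‖Y - w‖ - ‖Y‖ + inner ℝ Y w / ‖Y‖) := by
    change (stochGrad x y).snd - (stochGrad x (mkParam μ rs)).snd - (b + inner ℝ Y w / ‖Y‖) = _
    rw [stochGrad_snd, stochGrad_snd]
    change y.snd - ‖x - y.fst‖ - (rs - ‖Y‖) - _ = _
    rw [hz, ha]
    ring
  have hee : ‖e‖ ^ 2 = ‖w‖ ^ 2 + b ^ 2 := norm_param_sq e
  have h3 := norm_direction_expansion_le hY w
  have h4 := norm_direction_sub_le hY w
  have h5 := abs_norm_sub_sub_norm_add_le hY w
  calc _ ≤ _ := norm_param_le _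
    _ ≤ (rs * (4 * ‖w‖ ^ 2 / ‖Y‖ ^ 2) + |b| * (2 * ‖w‖ / ‖Y‖)) + 2 * ‖w‖ ^ 2 / ‖Y‖ := by
      rw [h1, h2, abs_neg]
      refine add_le_add ((norm_add_le _ _).trans ?_) h5
      rw [norm_smul, norm_smul, Real.norm_of_nonneg hrs, Real.norm_eq_abs]
      gcongr
    _ = 4 * rs * (‖Y‖ ^ 2)⁻¹ * ‖w‖ ^ 2 + (2 * |b| * ‖w‖ + 2 * ‖w‖ ^ 2) * ‖Y‖⁻¹ := by
      field_simp
      ring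
    _ ≤ 4 * rs * (‖Y‖ ^ 2)⁻¹ * ‖e‖ ^ 2 + (3 * ‖e‖ ^ 2) * ‖Y‖⁻¹ := by
      have hb2 := sq_abs b
      gcongr
      · exact norm_fst_le_param e
      · nlinarith [sq_nonneg (|b| - ‖w‖)]
    _ = _ := by ring

end Gradient

/-! ### Second derivative of the norm along a segment -/

section Curvature

variable {F : Type*} [NormedAddCommGroup F] [InnerProductSpace ℝ F]

/-- The second derivative of the norm at `Y` in the direction `w`. -/
noncomputable def normCurvature (Y w : F) : ℝ :=
  ‖Y‖⁻¹ * (‖w‖ ^ 2 - inner ℝ Y w ^ 2 / ‖Y‖ ^ 2)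

lemma inner_sq_div_norm_sq_le (Y w : F) : inner ℝ Y w ^ 2 / ‖Y‖ ^ 2 ≤ ‖w‖ ^ 2 := by
  refine div_le_of_le_mul₀ (by positivity) (by positivity) ?_
  rw [← sq_abs, ← mul_pow, mul_comm ‖w‖]
  gcongr
  exact abs_real_inner_le_norm Y w

lemma normCurvature_nonneg (Y w : F) : 0 ≤ normCurvature Y w :=
  mul_nonneg (by positivity) (sub_nonneg.2 (inner_sq_div_norm_sq_le Y w))

lemma normCurvature_le (Y w : F) : normCurvature Y w ≤ ‖Y‖⁻¹ * ‖w‖ ^ 2 := by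
  unfold normCurvature
  gcongr
  have : 0 ≤ inner ℝ Y w ^ 2 / ‖Y‖ ^ 2 := by positivity
  linarith

lemma hasDerivAt_norm_sub_smul {Y w : F} {t : ℝ} (h : Y - t • w ≠ 0) :
    HasDerivAt (fun s : ℝ => ‖Y - s • w‖) (-(inner ℝ (Y - t • w) w / ‖Y - t • w‖)) t := by
  have hn : 0 < ‖Y - t • w‖ := norm_pos_iff.2 h
  have h1 : HasDerivAt (fun s : ℝ => Y - s • w) (-w) t := by
    simpa using ((hasDerivAt_id t).smul_const w).const_sub Y
  have h2 := h1.norm_sq.sqrt (by positivity)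
  simp only [Real.sqrt_sq (norm_nonneg _)] at h2
  convert h2 using 1
  rw [inner_neg_right]
  field_simp

lemma hasDerivAt_inner_div_norm {Y w : F} {t : ℝ} (h : Y - t • w ≠ 0) :
    HasDerivAt (fun s : ℝ => -(inner ℝ (Y - s • w) w / ‖Y - s • w‖))
      (normCurvature (Y - t • w) w) t := by
  have hn : 0 < ‖Y - t • w‖ := norm_pos_iff.2 h
  have h1 : HasDerivAt (fun s : ℝ => Y - s • w) (-w) t := by
    simpa using ((hasDerivAt_id t).smul_const w).const_sub Y
  have h2 : HasDerivAt (fun s : ℝ => inner ℝ (Y - s • w) w) (-‖w‖ ^ 2) t := by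
    have := h1.inner ℝ (hasDerivAt_const t w)
    simpa [inner_neg_left, real_inner_self_eq_norm_sq] using this
  refine (h2.div (hasDerivAt_norm_sub_smul h) hn.ne').neg.congr_deriv ?_
  unfold normCurvature
  field_simp
  ring

/-- The inequality says that `Y` and `w` are not collinear, so that the line through `Y` directed by
`w` avoids the origin. -/
lemma sub_smul_ne_zero {Y w : F} (h : |inner ℝ Y w| ≠ ‖Y‖ * ‖w‖) (t : ℝ) : Y - t • w ≠ 0 := by
  intro h0
  rw [sub_eq_zero] at h0
  apply h
  rw [h0, real_inner_smul_left, real_inner_self_eq_norm_sq, norm_smul, abs_mul, Real.norm_eq_abs,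
    abs_of_nonneg (sq_nonneg ‖w‖)]
  ring

lemma continuous_normCurvature_sub_smul {Y w : F} (h : |inner ℝ Y w| ≠ ‖Y‖ * ‖w‖) :
    Continuous fun t : ℝ => normCurvature (Y - t • w) w := by
  have h0 : ∀ t : ℝ, ‖Y - t • w‖ ≠ 0 := fun t => norm_ne_zero_iff.2 (sub_smul_ne_zero h t)
  have h1 : Continuous fun t : ℝ => Y - t • w := by fun_prop
  exact (h1.norm.inv₀ h0).mul (continuous_const.sub
    (((h1.inner continuous_const).pow 2).div (h1.norm.pow 2) fun t => pow_ne_zero 2 (h0 t)))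

/-- Taylor's formula with integral remainder for a combination of the norm and of its derivative,
between `Y` and `Y - w`, when `Y` is not collinear to `w`. -/
lemma integral_normCurvature {Y w : F} (h : |inner ℝ Y w| ≠ ‖Y‖ * ‖w‖) (a b : ℝ) :
    ∫ t in (0 : ℝ)..1, (a + b * (1 - t)) * normCurvature (Y - t • w) w =
      a * (inner ℝ Y w / ‖Y‖ - inner ℝ (Y - w) w / ‖Y - w‖)
        + b * (‖Y - w‖ - ‖Y‖ + inner ℝ Y w / ‖Y‖) := by
  have hd : ∀ t ∈ Set.uIcc (0 : ℝ) 1, HasDerivAt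
      (fun s => (a + b * (1 - s)) * -(inner ℝ (Y - s • w) w / ‖Y - s • w‖) + b * ‖Y - s • w‖)
      ((a + b * (1 - t)) * normCurvature (Y - t • w) w) t := by
    intro t _
    have h0 := sub_smul_ne_zero h t
    have h1 : HasDerivAt (fun s : ℝ => a + b * (1 - s)) (-b) t := by
      simpa using (((hasDerivAt_id t).const_sub 1).const_mul b).const_add a
    refine ((h1.mul (hasDerivAt_inner_div_norm h0)).add
      ((hasDerivAt_norm_sub_smul h0).const_mul b)).congr_deriv ?_
    ring
  rw [intervalIntegral.integral_eq_sub_of_hasDerivAt hd]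
  · simp only [one_smul, zero_smul, sub_zero]
    ring
  · exact Continuous.intervalIntegrable (by
      have := continuous_normCurvature_sub_smul h
      fun_prop) _ _

end Curvature

/-! ### Generic points: integrability of the inverse distance -/

section Generic

variable {d : ℕ} {ν : Measure (Vec d)} [IsFiniteMeasure ν]

lemma integrable_truncated_inv_norm (hd : 2 ≤ d) :
    Integrable (fun v : Vec d => Set.indicator (Set.Iio 1) (fun r : ℝ => r⁻¹) ‖v‖) := by
  have : Nontrivial (Vec d) := by
    have : Nonempty (Fin d) := ⟨⟨0, by omega⟩⟩
    infer_instance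
  rw [integrable_fun_norm_addHaar, finrank_euclideanSpace_fin]
  have hb : IntegrableOn (Set.indicator (Set.Iio (1 : ℝ)) fun _ => (1 : ℝ)) (Set.Ioi 0) := by
    rw [IntegrableOn, integrable_indicator_iff measurableSet_Iio, IntegrableOn,
      Measure.restrict_restrict measurableSet_Iio]
    refine integrable_const_iff.2 (Or.inr ?_)
    rw [isFiniteMeasure_restrict, Set.Iio_inter_Ioi]
    simp
  refine hb.mono' ?_ ?_
  · exact ((measurable_id.pow_const _).smul
      (measurable_inv.indicator measurableSet_Iio)).aestronglyMeasurable
  · refine (ae_restrict_iff' measurableSet_Ioi).2 (.of_forall fun r hr => ?_)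
    rw [Set.mem_Ioi] at hr
    by_cases h1 : r < 1
    · rw [Set.indicator_of_mem (Set.mem_Iio.2 h1), Set.indicator_of_mem (Set.mem_Iio.2 h1),
        smul_eq_mul, Real.norm_of_nonneg (by positivity)]
      obtain ⟨m, rfl⟩ := Nat.exists_eq_add_of_le hd
      have : r ^ (2 + m - 1) * r⁻¹ = r ^ m := by
        rw [show 2 + m - 1 = m + 1 by omega, pow_succ, mul_assoc, mul_inv_cancel₀ hr.ne', mul_one]
      rw [this]
      exact pow_le_one₀ hr.le h1.le
    · rw [Set.indicator_of_notMem (by simpa using h1), Set.indicator_of_notMem (by simpa using h1)]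
      simp

/-- In dimension at least two the potential `z ↦ E‖X - z‖⁻¹` is finite almost
everywhere, whatever the law of `X`, since `‖·‖⁻¹` is locally integrable. -/
lemma ae_integrable_inv_norm_sub (hd : 2 ≤ d) :
    ∀ᵐ z : Vec d, Integrable (fun x => ‖x - z‖⁻¹) ν := by
  have h := ((integrable_const (1 : ℝ)).convolution_integrand (ν := ν) (ContinuousLinearMap.mul ℝ ℝ)
    (integrable_truncated_inv_norm hd)).prod_right_ae
  filter_upwards [h] with z hz
  refine (hz.add (integrable_const (1 : ℝ))).mono'
    (measurable_id.sub_const z).norm.inv.aestronglyMeasurable (.of_forall fun x => ?_)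
  rw [norm_inv, norm_norm, Pi.add_apply, ContinuousLinearMap.mul_apply', one_mul, norm_sub_rev z x]
  by_cases h1 : ‖x - z‖ < 1
  · rw [Set.indicator_of_mem (Set.mem_Iio.2 h1)]
    linarith
  · rw [Set.indicator_of_notMem (by simpa using h1), zero_add]
    exact inv_le_one_of_one_le₀ (by linarith)

/-- The potential is finite at almost every point of almost every line through `μ`. -/
lemma ae_ae_integrable_inv_norm_sub (hd : 2 ≤ d) (μ : Vec d) :
    ∀ᵐ w : Vec d, ∀ᵐ t : ℝ, Integrable (fun x => ‖x - (μ + t • w)‖⁻¹) ν := by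
  obtain ⟨N, hN, hNm, hN0⟩ := exists_measurable_superset_of_null
    (ae_iff.1 (ae_integrable_inv_norm_sub (ν := ν) hd))
  have h : ∀ᵐ w : Vec d, ∀ᵐ t : ℝ, μ + t • w ∉ N := by
    have hm : Measurable fun p : Vec d × ℝ => μ + p.2 • p.1 := by fun_prop
    rw [Measure.ae_ae_comm (p := fun w t => μ + t • w ∉ N) (hm hNm.compl)]
    have h0 : ∀ᵐ t : ℝ, t ≠ 0 := Measure.ae_ne volume 0
    filter_upwards [h0] with t ht
    have hq := (measurePreserving_add_left (volume : Measure (Vec d)) μ).quasiMeasurePreserving.comp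
      (Measure.quasiMeasurePreserving_smul (volume : Measure (Vec d)) ht)
    exact hq.ae (measure_eq_zero_iff_ae_notMem.1 hN0)
  filter_upwards [h] with w hw
  filter_upwards [hw] with t ht
  by_contra hcon
  exact ht (hN hcon)

/-- Almost every direction is collinear to `X - μ` with probability zero. -/
lemma ae_ae_abs_inner_ne (hd : 2 ≤ d) {μ : Vec d} (hμ : ∀ᵐ x ∂ν, x ≠ μ) :
    ∀ᵐ w : Vec d, ∀ᵐ x ∂ν, |inner ℝ (x - μ) w| ≠ ‖x - μ‖ * ‖w‖ := by
  have hm : MeasurableSet {p : Vec d × Vec d | |inner ℝ (p.2 - μ) p.1| ≠ ‖p.2 - μ‖ * ‖p.1‖} :=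
    (isClosed_eq (by fun_prop) (by fun_prop)).measurableSet.compl
  rw [Measure.ae_ae_comm hm]
  filter_upwards [hμ] with x hx
  have hY : x - μ ≠ 0 := sub_ne_zero.2 hx
  have htop : Submodule.span ℝ {x - μ} ≠ ⊤ := by
    intro h
    have h1 := finrank_span_singleton (K := ℝ) hY
    rw [h, finrank_top, finrank_euclideanSpace_fin] at h1
    omega
  have h0 := Measure.addHaar_submodule (volume : Measure (Vec d)) _ htop
  filter_upwards [measure_eq_zero_iff_ae_notMem.1 h0] with w hw heq
  rcases eq_or_ne w 0 with rfl | hw0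
  · exact hw (Submodule.zero_mem _)
  · obtain ⟨r, -, hr⟩ := (norm_inner_eq_norm_iff (𝕜 := ℝ) hY hw0).1 heq
    exact hw (hr ▸ Submodule.smul_mem _ _ (Submodule.mem_span_singleton_self _))

end Generic

/-! ### The matrix `Γ` and its largest eigenvalue -/

section Gamma

variable {d : ℕ}

lemma inner_mulVec_le_lambdaMax {M : Matrix (Fin d) (Fin d) ℝ} (hM : M.IsHermitian) (w : Vec d) :
    inner ℝ w (Matrix.toEuclideanLin M w) ≤ lambdaMax M * ‖w‖ ^ 2 := by
  have hsymm := Matrix.isSymmetric_toEuclideanLin_iff.2 hM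
  set b := hM.eigenvectorBasis
  have hb : ∀ i, Matrix.toEuclideanLin M (b i) = hM.eigenvalues i • b i := by
    intro i
    have := hM.mulVec_eigenvectorBasis i
    ext j
    simpa using congrFun this j
  have hle : ∀ i, hM.eigenvalues i ≤ lambdaMax M := fun i =>
    le_csSup (Matrix.finite_real_spectrum (𝕜 := ℝ)).bddAbove (hM.eigenvalues_mem_spectrum_real i)
  rw [← b.sum_inner_mul_inner w, ← b.sum_sq_norm_inner_right w, Finset.mul_sum]
  refine Finset.sum_le_sum fun i _ => ?_
  have h1 : inner ℝ (b i) (Matrix.toEuclideanLin M w) = hM.eigenvalues i * inner ℝ (b i) w := by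
    rw [← hsymm, hb, real_inner_smul_left]
  rw [h1, real_inner_comm, Real.norm_eq_abs, sq_abs]
  nlinarith [hle i, sq_nonneg (inner ℝ (b i) w)]

lemma gammaMat_isHermitian {Ω : Type*} [MeasurableSpace Ω] (P : Measure Ω) (X : Ω → Vec d)
    (z : Vec d) : (GammaMat P X z).IsHermitian := by
  refine Matrix.IsHermitian.ext fun i j => ?_
  simp only [GammaMat, Matrix.of_apply, star_trivial]
  congr 1 with ω
  rw [Matrix.one_apply, Matrix.one_apply, mul_comm ((X ω - z) j)]
  simp only [eq_comm]

lemma gammaMat_map {Ω : Type*} [MeasurableSpace Ω] {P : Measure Ω} {X : Ω → Vec d}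
    (hX : Measurable X) (z : Vec d) : GammaMat P X z = GammaMat (P.map X) id z := by
  ext i j
  simp only [GammaMat, Matrix.of_apply, id]
  rw [integral_map hX.aemeasurable]
  have h1 : Measurable fun x : Vec d => x - z := measurable_id.sub_const z
  have h2 : ∀ i, Measurable fun x : Vec d => (x - z) i := fun i => by fun_prop
  exact (h1.norm.inv.mul (measurable_const.sub
    (((h2 i).mul (h2 j)).div (h1.norm.pow_const 2)))).aestronglyMeasurable

variable {ν : Measure (Vec d)}

lemma integrable_normCurvature {z : Vec d} (hz : Integrable (fun x => ‖x - z‖⁻¹) ν) (w : Vec d) :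
    Integrable (fun x => normCurvature (x - z) w) ν := by
  refine (hz.mul_const (‖w‖ ^ 2)).mono' ?_ (.of_forall fun x => ?_)
  · have h1 : Measurable fun x : Vec d => x - z := measurable_id.sub_const z
    exact (h1.norm.inv.mul (measurable_const.sub
      ((h1.inner_const.pow_const 2).div (h1.norm.pow_const 2)))).aestronglyMeasurable
  · rw [Real.norm_of_nonneg (normCurvature_nonneg _ _)]
    exact normCurvature_le _ _

/-- `Γ(z)` is the matrix of the quadratic form `w ↦ E[normCurvature (X - z) w]`, when the entries
of `Γ(z)` are genuine expectations. -/
lemma inner_gammaMat {z : Vec d} (hz : Integrable (fun x => ‖x - z‖⁻¹) ν) (w : Vec d) :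
    inner ℝ w (Matrix.toEuclideanLin (GammaMat ν id z) w) = ∫ x, normCurvature (x - z) w ∂ν := by
  have hint : ∀ i j, Integrable (fun x : Vec d => ‖x - z‖⁻¹ *
      ((1 : Matrix (Fin d) (Fin d) ℝ) i j - (x - z) i * (x - z) j / ‖x - z‖ ^ 2)) ν := by
    intro i j
    refine (hz.mul_const 2).mono' ?_ (.of_forall fun x => ?_)
    · have h1 : Measurable fun x : Vec d => x - z := measurable_id.sub_const z
      have h2 : ∀ i, Measurable fun x : Vec d => (x - z) i := fun i => by fun_prop
      exact (h1.norm.inv.mul (measurable_const.sub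
        (((h2 i).mul (h2 j)).div (h1.norm.pow_const 2)))).aestronglyMeasurable
    · rw [norm_mul, norm_inv, norm_norm]
      gcongr
      have h3 : ‖(1 : Matrix (Fin d) (Fin d) ℝ) i j‖ ≤ 1 := by
        rw [Matrix.one_apply]; split_ifs <;> simp
      have h4 : ‖(x - z) i * (x - z) j / ‖x - z‖ ^ 2‖ ≤ 1 := by
        rw [norm_div, norm_mul, norm_pow, norm_norm, sq]
        have hi := PiLp.norm_apply_le (x - z) i
        have hj := PiLp.norm_apply_le (x - z) j
        exact div_le_one_of_le₀ (by gcongr) (by positivity)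
      linarith [norm_sub_le ((1 : Matrix (Fin d) (Fin d) ℝ) i j)
        ((x - z) i * (x - z) j / ‖x - z‖ ^ 2)]
  have hsum : inner ℝ w (Matrix.toEuclideanLin (GammaMat ν id z) w)
      = ∑ i, ∑ j, (w i * w j) * ∫ x, ‖x - z‖⁻¹ *
      ((1 : Matrix (Fin d) (Fin d) ℝ) i j - (x - z) i * (x - z) j / ‖x - z‖ ^ 2) ∂ν := by
    simp only [PiLp.inner_apply, Matrix.toLpLin_apply, Matrix.mulVec, dotProduct, GammaMat,
      Matrix.of_apply, RCLike.inner_apply, conj_trivial, id, Finset.sum_mul]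
    refine Finset.sum_congr rfl fun i _ => Finset.sum_congr rfl fun j _ => by ring
  rw [hsum]
  simp_rw [← integral_const_mul]
  have hint' : ∀ i, ∀ j ∈ Finset.univ, Integrable (fun x : Vec d => (w i * w j) * (‖x - z‖⁻¹ *
      ((1 : Matrix (Fin d) (Fin d) ℝ) i j - (x - z) i * (x - z) j / ‖x - z‖ ^ 2))) ν :=
    fun i j _ => (hint i j).const_mul _
  simp_rw [← integral_finsetSum _ (hint' _)]
  rw [← integral_finsetSum _ fun i _ => integrable_finsetSum _ (hint' i)]
  congr 1 with x
  have h1 : ‖w‖ ^ 2 = ∑ i, w i * w i := by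
    rw [EuclideanSpace.norm_sq_eq]
    exact Finset.sum_congr rfl fun i _ => by rw [Real.norm_eq_abs, sq_abs, sq]
  have h2 : inner ℝ (x - z) w = ∑ i, (x - z) i * w i := by
    simp [PiLp.inner_apply, mul_comm]
  rw [normCurvature, h1, h2, sq (∑ i, _), Finset.sum_mul_sum, Finset.sum_div, ← Finset.sum_sub_distrib,
    Finset.mul_sum]
  refine Finset.sum_congr rfl fun i _ => ?_
  have h3 : w i * w i = ∑ j, w i * w j * (1 : Matrix (Fin d) (Fin d) ℝ) i j := by
    simp [Matrix.one_apply]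
  rw [h3, Finset.sum_div, ← Finset.sum_sub_distrib, Finset.mul_sum]
  refine Finset.sum_congr rfl fun j _ => by ring

lemma integral_normCurvature_le {z : Vec d} (hz : Integrable (fun x => ‖x - z‖⁻¹) ν) {L : ℝ}
    (hL : lambdaMax (GammaMat ν id z) ≤ L) (w : Vec d) :
    ∫ x, normCurvature (x - z) w ∂ν ≤ L * ‖w‖ ^ 2 := by
  rw [← inner_gammaMat hz]
  exact (inner_mulVec_le_lambdaMax (gammaMat_isHermitian ν id z) w).trans (by gcongr)

end Gamma

/-! ### Taylor remainders of the mean distance -/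

/-- What the model provides about the law `ν` of `X`: it has no atom, `X - μ` has enough moments,
and `E‖X - μ‖ = rs`, `E[(X - μ) / ‖X - μ‖] = u`, `E[X - μ] = rs u`. -/
structure IsRadialLaw {d : ℕ} (ν : Measure (Vec d)) (μ : Vec d) (rs : ℝ) (u : Vec d) : Prop where
  ne : ∀ z, ∀ᵐ x ∂ν, x ≠ z
  integrable_inv_sq : Integrable (fun x => (‖x - μ‖ ^ 2)⁻¹) ν
  integrable_pow_four : Integrable (fun x => ‖x - μ‖ ^ 4) ν
  integral_norm : ∫ x, ‖x - μ‖ ∂ν = rs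
  integral_direction : ∫ x, ‖x - μ‖⁻¹ • (x - μ) ∂ν = u
  integral_sub : ∫ x, (x - μ) ∂ν = rs • u

section Gap

variable {F : Type*} [NormedAddCommGroup F] [InnerProductSpace ℝ F]

/-- The first order Taylor remainder of the norm, between `Y` and `Y - w`. -/
noncomputable def normGap (Y w : F) : ℝ := ‖Y - w‖ - ‖Y‖ + inner ℝ Y w / ‖Y‖

/-- The increment of the derivative of the norm in the direction `w`, between `Y` and `Y - w`. -/
noncomputable def directionGap (Y w : F) : ℝ := inner ℝ Y w / ‖Y‖ - inner ℝ (Y - w) w / ‖Y - w‖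

lemma abs_inner_div_norm_le (Y w : F) : |inner ℝ Y w / ‖Y‖| ≤ ‖w‖ := by
  rw [abs_div, abs_norm]
  refine div_le_of_le_mul₀ (norm_nonneg _) (norm_nonneg _) ?_
  rw [mul_comm]
  exact abs_real_inner_le_norm Y w

lemma abs_normGap_le (Y w : F) : |normGap Y w| ≤ 2 * ‖w‖ := by
  have h1 := abs_inner_div_norm_le Y w
  have h2 : |‖Y - w‖ - ‖Y‖| ≤ ‖w‖ := by simpa using abs_norm_sub_norm_le (Y - w) Y
  have := abs_add_le (‖Y - w‖ - ‖Y‖) (inner ℝ Y w / ‖Y‖)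
  rw [normGap]
  linarith

lemma abs_directionGap_le (Y w : F) : |directionGap Y w| ≤ 2 * ‖w‖ := by
  have h1 := abs_inner_div_norm_le Y w
  have h2 := abs_inner_div_norm_le (Y - w) w
  have := abs_sub (inner ℝ Y w / ‖Y‖) (inner ℝ (Y - w) w / ‖Y - w‖)
  rw [directionGap]
  linarith

lemma continuousAt_normGap (Y w : F) : ContinuousAt (normGap Y) w := by
  unfold normGap
  fun_prop

lemma continuousAt_directionGap {Y w : F} (h : Y ≠ w) : ContinuousAt (directionGap Y) w := by
  have h0 : ‖Y - w‖ ≠ 0 := norm_ne_zero_iff.2 (sub_ne_zero.2 h)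
  unfold directionGap
  exact ContinuousAt.sub (by fun_prop) (ContinuousAt.div (by fun_prop) (by fun_prop) h0)

end Gap

/-- A linear endomorphism of a finite dimensional normed space, as a continuous linear map. It is
stated for an abstract space, where the topology of the norm is the only one in sight; on `Param d`
instance search has to compare it with the product topology. -/
noncomputable def continuousOfFiniteDimensional {F : Type*} [NormedAddCommGroup F] [NormedSpace ℝ F]
    [FiniteDimensional ℝ F] (l : F →ₗ[ℝ] F) : F →L[ℝ] F :=
  ⟨l, l.continuous_of_finiteDimensional⟩

section Monotone

variable {d : ℕ} {ν : Measure (Vec d)} [IsProbabilityMeasure ν] {μ u : Vec d} {rs : ℝ}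

lemma measurable_inner_div_norm (z w : Vec d) :
    Measurable fun x : Vec d => inner ℝ (x - z) w / ‖x - z‖ := by
  have h1 : Measurable fun x : Vec d => x - z := measurable_id.sub_const z
  exact h1.inner_const.div h1.norm

lemma measurable_normGap (μ w : Vec d) : Measurable fun x : Vec d => normGap (x - μ) w := by
  have h1 : Measurable fun x : Vec d => x - μ := measurable_id.sub_const μ
  exact ((h1.sub_const w).norm.sub h1.norm).add (measurable_inner_div_norm μ w)

lemma measurable_directionGap (μ w : Vec d) :
    Measurable fun x : Vec d => directionGap (x - μ) w := by
  have h1 := (measurable_inner_div_norm μ w).sub (measurable_inner_div_norm (μ + w) w)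
  have e : (fun x : Vec d => directionGap (x - μ) w) = fun x => inner ℝ (x - μ) w / ‖x - μ‖
      - inner ℝ (x - (μ + w)) w / ‖x - (μ + w)‖ := by
    funext x
    rw [directionGap, sub_sub]
  rw [e]
  exact h1

lemma integrable_normGap (w : Vec d) : Integrable (fun x => normGap (x - μ) w) ν :=
  (integrable_const (2 * ‖w‖)).mono' (measurable_normGap μ w).aestronglyMeasurable
    (.of_forall fun _ => abs_normGap_le _ _)

lemma integrable_directionGap (w : Vec d) : Integrable (fun x => directionGap (x - μ) w) ν :=
  (integrable_const (2 * ‖w‖)).mono' (measurable_directionGap μ w).aestronglyMeasurable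
    (.of_forall fun _ => abs_directionGap_le _ _)

/-- The bound on the second derivative of `z ↦ E‖X - z‖` given by the matrices `Γ`, integrated along
the segment from `μ` to `μ + w`. For a generic `w` the norm is smooth along the segment, and Tonelli
applies. -/
lemma ae_integral_gap_le (hd : 2 ≤ d) (hμ : ∀ᵐ x ∂ν, x ≠ μ) {R L a b : ℝ} (ha : 0 ≤ a) (hb : 0 ≤ b)
    (hL0 : 0 ≤ L) (hL : ∀ z ∈ Metric.closedBall μ R, lambdaMax (GammaMat ν id z) ≤ L) :
    ∀ᵐ w : Vec d, ‖w‖ ≤ R →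
      0 ≤ a * (∫ x, directionGap (x - μ) w ∂ν) + b * (∫ x, normGap (x - μ) w ∂ν) ∧
      a * (∫ x, directionGap (x - μ) w ∂ν) + b * (∫ x, normGap (x - μ) w ∂ν)
        ≤ (a + b / 2) * (L * ‖w‖ ^ 2) := by
  filter_upwards [ae_ae_integrable_inv_norm_sub (ν := ν) hd μ, ae_ae_abs_inner_ne hd hμ]
    with w hw hcol hwR
  set f : Vec d → ℝ := fun x => a * directionGap (x - μ) w + b * normGap (x - μ) w with hf
  have hfi : Integrable f ν :=
    ((integrable_directionGap w).const_mul a).add ((integrable_normGap w).const_mul b)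
  have hint : ∫ x, f x ∂ν
      = a * (∫ x, directionGap (x - μ) w ∂ν) + b * (∫ x, normGap (x - μ) w ∂ν) := by
    rw [integral_add ((integrable_directionGap w).const_mul a) ((integrable_normGap w).const_mul b),
      integral_const_mul, integral_const_mul]
  have hk : ∀ t ∈ Set.Ioc (0 : ℝ) 1, 0 ≤ a + b * (1 - t) := fun t ht =>
    add_nonneg ha (mul_nonneg hb (by linarith [ht.2]))
  have hpos : ∀ x, ∀ t ∈ Set.Ioc (0 : ℝ) 1,
      0 ≤ (a + b * (1 - t)) * normCurvature (x - μ - t • w) w := fun x t ht =>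
    mul_nonneg (hk t ht) (normCurvature_nonneg _ _)
  have hfeq : ∀ᵐ x ∂ν, f x = ∫ t in Set.Ioc (0 : ℝ) 1,
      (a + b * (1 - t)) * normCurvature (x - μ - t • w) w := by
    filter_upwards [hcol] with x hx
    rw [← intervalIntegral.integral_of_le zero_le_one, integral_normCurvature hx]
    rfl
  have hf0 : 0 ≤ᵐ[ν] f := by
    filter_upwards [hfeq] with x hx
    rw [hx]
    exact setIntegral_nonneg measurableSet_Ioc (hpos x)
  rw [← hint]
  refine ⟨integral_nonneg_of_ae hf0, ?_⟩
  have hmeas : Measurable fun p : Vec d × ℝ =>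
      ENNReal.ofReal ((a + b * (1 - p.2)) * normCurvature (p.1 - μ - p.2 • w) w) := by
    have h1 : Measurable fun p : Vec d × ℝ => p.1 - μ - p.2 • w := by fun_prop
    have h2 : Measurable fun p : Vec d × ℝ => normCurvature (p.1 - μ - p.2 • w) w :=
      h1.norm.inv.mul (measurable_const.sub ((h1.inner_const.pow_const 2).div (h1.norm.pow_const 2)))
    exact (Measurable.mul (by fun_prop) h2).ennreal_ofReal
  have hB : 0 ≤ (a + b / 2) * (L * ‖w‖ ^ 2) := by positivity
  rw [integral_eq_lintegral_of_nonneg_ae hf0 hfi.aestronglyMeasurable]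
  refine ENNReal.toReal_le_of_le_ofReal hB ?_
  calc ∫⁻ x, ENNReal.ofReal (f x) ∂ν
      = ∫⁻ x, (∫⁻ t in Set.Ioc (0 : ℝ) 1,
          ENNReal.ofReal ((a + b * (1 - t)) * normCurvature (x - μ - t • w) w)) ∂ν := by
        refine lintegral_congr_ae ?_
        filter_upwards [hfeq, hcol] with x hx hxc
        rw [hx, ofReal_integral_eq_lintegral_ofReal]
        · have := continuous_normCurvature_sub_smul hxc
          exact (Continuous.integrableOn_Icc (by fun_prop)).mono_set Set.Ioc_subset_Icc_self
        · exact (ae_restrict_iff' measurableSet_Ioc).2 (.of_forall (hpos x))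
    _ = ∫⁻ t in Set.Ioc (0 : ℝ) 1, ∫⁻ x,
          ENNReal.ofReal ((a + b * (1 - t)) * normCurvature (x - μ - t • w) w) ∂ν :=
        lintegral_lintegral_swap hmeas.aemeasurable
    _ ≤ ∫⁻ t in Set.Ioc (0 : ℝ) 1, ENNReal.ofReal ((a + b * (1 - t)) * (L * ‖w‖ ^ 2)) := by
        refine lintegral_mono_ae ?_
        filter_upwards [ae_restrict_of_ae hw, ae_restrict_mem measurableSet_Ioc] with t ht htI
        have hz : μ + t • w ∈ Metric.closedBall μ R := by
          rw [mem_closedBall_iff_norm, add_sub_cancel_left, norm_smul, Real.norm_of_nonneg htI.1.le]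
          exact (mul_le_of_le_one_left (norm_nonneg _) htI.2).trans hwR
        have hi := integrable_normCurvature ht w
        have hle := integral_normCurvature_le ht (hL _ hz) w
        simp only [← sub_sub] at hi hle
        rw [← ofReal_integral_eq_lintegral_ofReal (hi.const_mul _)
          (.of_forall fun x => hpos x t htI), integral_const_mul]
        exact ENNReal.ofReal_le_ofReal (mul_le_mul_of_nonneg_left hle (hk t htI))
    _ = ENNReal.ofReal ((a + b / 2) * (L * ‖w‖ ^ 2)) := by
        rw [← ofReal_integral_eq_lintegral_ofReal]
        · congr 1
          rw [← intervalIntegral.integral_of_le zero_le_one, intervalIntegral.integral_mul_const]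
          congr 1
          have hd' : ∀ t ∈ Set.uIcc (0 : ℝ) 1,
              HasDerivAt (fun s => a * s - b / 2 * (1 - s) ^ 2) (a + b * (1 - t)) t := by
            intro t _
            have h1 : HasDerivAt (fun s : ℝ => (1 - s) ^ 2) (2 * (1 - t) * (-1)) t := by
              simpa using ((hasDerivAt_id t).const_sub 1).fun_pow 2
            refine (((hasDerivAt_id t).const_mul a).sub (h1.const_mul (b / 2))).congr_deriv ?_
            ring
          rw [intervalIntegral.integral_eq_sub_of_hasDerivAt hd'
            (Continuous.intervalIntegrable (by fun_prop) _ _)]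
          ring
        · exact (Continuous.integrableOn_Icc (by fun_prop)).mono_set Set.Ioc_subset_Icc_self
        · exact (ae_restrict_iff' measurableSet_Ioc).2 (.of_forall fun t ht =>
            mul_nonneg (hk t ht) (by positivity))

lemma continuous_integral_normGap : Continuous fun w => ∫ x, normGap (x - μ) w ∂ν := by
  refine continuous_iff_continuousAt.2 fun w => continuousAt_of_dominated
    (bound := fun _ => 2 * (‖w‖ + 1)) (.of_forall fun w => (measurable_normGap μ w).aestronglyMeasurable)
    ?_ (integrable_const _) (.of_forall fun x => continuousAt_normGap _ _)
  filter_upwards [Metric.ball_mem_nhds w one_pos] with v hv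
  refine .of_forall fun x => (abs_normGap_le _ _).trans ?_
  rw [mem_ball_iff_norm] at hv
  linarith [norm_le_norm_add_norm_sub' v w]

lemma continuous_integral_directionGap (hν : ∀ z, ∀ᵐ x ∂ν, x ≠ z) :
    Continuous fun w => ∫ x, directionGap (x - μ) w ∂ν := by
  refine continuous_iff_continuousAt.2 fun w => continuousAt_of_dominated
    (bound := fun _ => 2 * (‖w‖ + 1))
    (.of_forall fun w => (measurable_directionGap μ w).aestronglyMeasurable)
    ?_ (integrable_const _) ?_
  · filter_upwards [Metric.ball_mem_nhds w one_pos] with v hv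
    refine .of_forall fun x => (abs_directionGap_le _ _).trans ?_
    rw [mem_ball_iff_norm] at hv
    linarith [norm_le_norm_add_norm_sub' v w]
  · filter_upwards [hν (μ + w)] with x hx
    exact continuousAt_directionGap fun h => hx (by rw [← h]; abel)

/-- The integrated bound holds for every `w` of the ball, by density of the generic ones. -/
lemma integral_gap_le (hd : 2 ≤ d) (hν : ∀ z, ∀ᵐ x ∂ν, x ≠ z) {R L a b : ℝ} (hR : 0 < R)
    (ha : 0 ≤ a) (hb : 0 ≤ b) (hL0 : 0 ≤ L)
    (hL : ∀ z ∈ Metric.closedBall μ R, lambdaMax (GammaMat ν id z) ≤ L) {w : Vec d} (hw : ‖w‖ ≤ R) :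
    0 ≤ a * (∫ x, directionGap (x - μ) w ∂ν) + b * (∫ x, normGap (x - μ) w ∂ν) ∧
      a * (∫ x, directionGap (x - μ) w ∂ν) + b * (∫ x, normGap (x - μ) w ∂ν)
        ≤ (a + b / 2) * (L * ‖w‖ ^ 2) := by
  have h1 := continuous_integral_normGap (ν := ν) (μ := μ)
  have h2 := continuous_integral_directionGap (μ := μ) hν
  have hg : Continuous fun w =>
      a * (∫ x, directionGap (x - μ) w ∂ν) + b * (∫ x, normGap (x - μ) w ∂ν) := by fun_prop
  have hclosed : IsClosed {w : Vec d |
      0 ≤ a * (∫ x, directionGap (x - μ) w ∂ν) + b * (∫ x, normGap (x - μ) w ∂ν) ∧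
      a * (∫ x, directionGap (x - μ) w ∂ν) + b * (∫ x, normGap (x - μ) w ∂ν)
        ≤ (a + b / 2) * (L * ‖w‖ ^ 2)} :=
    (isClosed_le continuous_const hg).inter (isClosed_le hg (by fun_prop))
  have hdense := Measure.dense_of_ae (ae_integral_gap_le hd (hν μ) ha hb hL0 hL)
  have hsub := hdense.open_subset_closure_inter (Metric.isOpen_ball (x := (0 : Vec d)) (ε := R))
  have hcl : Metric.closedBall (0 : Vec d) R ⊆ _ :=
    (closure_ball (0 : Vec d) hR.ne').symm.subset.trans (closure_minimal hsub isClosed_closure)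
  refine closure_minimal ?_ hclosed (hcl (by simpa using hw))
  rintro v ⟨hv1, hv2⟩
  exact hv2 (by simpa using (Metric.mem_ball.1 hv1).le)

/-! ### Strong monotonicity of the mean field -/

namespace IsRadialLaw

variable (h : IsRadialLaw ν μ rs u)
include h

lemma integrable_sub : Integrable (fun x => x - μ) ν := by
  refine ((integrable_const (1 : ℝ)).add h.integrable_pow_four).mono'
    (measurable_id.sub_const μ).aestronglyMeasurable (.of_forall fun x => ?_)
  rw [Pi.add_apply]
  nlinarith [sq_nonneg (‖x - μ‖ ^ 2 - 1 / 2), sq_nonneg (‖x - μ‖ - 1 / 2)]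

omit h in
lemma integrable_direction : Integrable (fun x => ‖x - μ‖⁻¹ • (x - μ)) ν := by
  have h1 : Measurable fun x : Vec d => x - μ := measurable_id.sub_const μ
  exact (integrable_const (1 : ℝ)).mono' (h1.norm.inv.smul h1).aestronglyMeasurable
    (.of_forall fun x => norm_inv_smul_self_le _)

omit h in
lemma inner_div_norm_eq (x w : Vec d) :
    inner ℝ (x - μ) w / ‖x - μ‖ = inner ℝ w (‖x - μ‖⁻¹ • (x - μ)) := by
  rw [real_inner_smul_right, real_inner_comm, div_eq_inv_mul]

omit h in
lemma integrable_inner_div_norm (w : Vec d) :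
    Integrable (fun x => inner ℝ (x - μ) w / ‖x - μ‖) ν := by
  simp_rw [inner_div_norm_eq]
  exact integrable_direction.const_inner w

lemma integral_inner_div_norm (w : Vec d) :
    ∫ x, inner ℝ (x - μ) w / ‖x - μ‖ ∂ν = inner ℝ w u := by
  simp_rw [inner_div_norm_eq]
  rw [integral_inner integrable_direction, h.integral_direction]

omit [IsProbabilityMeasure ν] h in
lemma inner_stochGrad (x : Vec d) (y : Param d) :
    inner ℝ (y - mkParam μ rs) (stochGrad x y) =
      ‖y.fst - μ‖ ^ 2 + (y.snd - rs) * y.snd - inner ℝ (y.fst - μ) (x - μ)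
        + y.snd * (inner ℝ (x - μ) (y.fst - μ) / ‖x - μ‖)
        - y.snd * directionGap (x - μ) (y.fst - μ)
        - (y.snd - rs) * normGap (x - μ) (y.fst - μ) - (y.snd - rs) * ‖x - μ‖
        + (y.snd - rs) * (inner ℝ (x - μ) (y.fst - μ) / ‖x - μ‖) := by
  have h1 : inner ℝ (y - mkParam μ rs) (stochGrad x y)
      = inner ℝ (y.fst - μ) (stochGrad x y).fst + (y.snd - rs) * (stochGrad x y).snd := by
    rw [WithLp.prod_inner_apply]
    congr 1
    change inner ℝ (y.snd - rs) (stochGrad x y).snd = _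
    simp [mul_comm]
  have hz : x - y.fst = (x - μ) - (y.fst - μ) := by abel
  rw [h1, stochGrad_fst, stochGrad_snd, hz]
  generalize y.fst - μ = w
  generalize x - μ = Y
  rw [inner_sub_right, real_inner_smul_right,
    real_inner_smul_right, inner_sub_right w Y, real_inner_self_eq_norm_sq,
    directionGap, normGap, inner_sub_left, real_inner_self_eq_norm_sq, real_inner_comm w Y]
  ring

lemma integrable_stochGrad (y : Param d) : Integrable (fun x => stochGrad x y) ν := by
  refine ((h.integrable_sub.norm.add (integrable_const (‖y.fst - μ‖ + |y.snd|))).const_mul 2).mono'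
    (measurable_stochGrad.comp (measurable_id.prodMk measurable_const)).aestronglyMeasurable
    (.of_forall fun x => norm_stochGrad_le x μ y)

/-- The mean field has the inner product `‖w‖² + b² + 2 b ⟨w, u⟩` with `y - θ`, up to Taylor
remainders of `z ↦ E‖X - z‖`; the first order terms cancel since `E[X - μ] = rs u`. -/
lemma inner_meanField (y : Param d) :
    inner ℝ (y - mkParam μ rs) (meanField ν stochGrad y) =
      ‖y.fst - μ‖ ^ 2 + (y.snd - rs) ^ 2 + 2 * (y.snd - rs) * inner ℝ (y.fst - μ) u
        - (y.snd * (∫ x, directionGap (x - μ) (y.fst - μ) ∂ν)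
          + (y.snd - rs) * (∫ x, normGap (x - μ) (y.fst - μ) ∂ν)) := by
  have i1 : Integrable (fun _ : Vec d => ‖y.fst - μ‖ ^ 2 + (y.snd - rs) * y.snd) ν :=
    integrable_const _
  have i2 : Integrable (fun x => inner ℝ (y.fst - μ) (x - μ)) ν := h.integrable_sub.const_inner _
  have i3 := (integrable_inner_div_norm (ν := ν) (μ := μ) (y.fst - μ)).const_mul y.snd
  have i4 := (integrable_directionGap (ν := ν) (μ := μ) (y.fst - μ)).const_mul y.snd
  have i5 := (integrable_normGap (ν := ν) (μ := μ) (y.fst - μ)).const_mul (y.snd - rs)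
  have i6 := h.integrable_sub.norm.const_mul (y.snd - rs)
  have i7 := (integrable_inner_div_norm (ν := ν) (μ := μ) (y.fst - μ)).const_mul (y.snd - rs)
  rw [meanField, ← integral_inner (h.integrable_stochGrad y)]
  simp_rw [inner_stochGrad]
  have j2 : Integrable (fun x => ‖y.fst - μ‖ ^ 2 + (y.snd - rs) * y.snd
      - inner ℝ (y.fst - μ) (x - μ)) ν := i1.sub i2
  have j3 := j2.fun_add i3
  have j4 : Integrable (fun x => _ - y.snd * directionGap (x - μ) (y.fst - μ)) ν := j3.sub i4
  have j5 : Integrable (fun x => _ - (y.snd - rs) * normGap (x - μ) (y.fst - μ)) ν := j4.sub i5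
  have j6 : Integrable (fun x => _ - (y.snd - rs) * ‖x - μ‖) ν := j5.sub i6
  rw [integral_add j6 i7, MeasureTheory.integral_sub j5 i6,
    MeasureTheory.integral_sub j4 i5, MeasureTheory.integral_sub j3 i4, integral_add j2 i3,
    MeasureTheory.integral_sub i1 i2,
    integral_const_mul, integral_const_mul, integral_const_mul, integral_const_mul,
    integral_const_mul, integral_inner h.integrable_sub, h.integral_sub, h.integral_norm,
    h.integral_inner_div_norm, real_inner_smul_right]
  simp
  ring

/-- Strong monotonicity of the mean field: the curvature term is controlled by the bound `L` on the
matrices `Γ`, and the cross term `2 b ⟨w, u⟩` by `A b² + ‖u‖² ‖w‖² / A`. -/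
lemma strongly_monotone (hd : 2 ≤ d) (hrs : 0 ≤ rs) {R Rr L A : ℝ} (hR : 0 < R) (hRr : 0 ≤ Rr)
    (hL0 : 0 ≤ L) (hL : ∀ z ∈ Metric.closedBall μ R, lambdaMax (GammaMat ν id z) ≤ L)
    (hA : 0 < A) {y : Param d} (hy1 : ‖y.fst - μ‖ ≤ R) (hy2 : |y.snd - rs| ≤ Rr)
    (hy : 0 ≤ y.snd) :
    min (1 - ‖u‖ ^ 2 / A - L * (rs + 3 / 2 * Rr)) (1 - A) * ‖y - mkParam μ rs‖ ^ 2
      ≤ inner ℝ (y - mkParam μ rs) (meanField ν stochGrad y) := by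
  set w := y.fst - μ with hw
  set b := y.snd - rs with hb
  have hnorm : ‖y - mkParam μ rs‖ ^ 2 = ‖w‖ ^ 2 + b ^ 2 := norm_param_sq (y - mkParam μ rs)
  rw [h.inner_meanField, hnorm, ← hw, ← hb]
  have hcurv : y.snd * (∫ x, directionGap (x - μ) w ∂ν) + b * (∫ x, normGap (x - μ) w ∂ν)
      ≤ (rs + 3 / 2 * Rr) * (L * ‖w‖ ^ 2) := by
    have hLw : 0 ≤ L * ‖w‖ ^ 2 := by positivity
    have hys : y.snd = rs + b := by rw [hb]; ring
    -- for `b ≤ 0` the remainder of the norm has the favourable sign and is discarded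
    rcases le_total 0 b with hb0 | hb0
    · refine (integral_gap_le hd h.ne hR hy hb0 hL0 hL hy1).2.trans ?_
      have := le_of_abs_le hy2
      exact mul_le_mul_of_nonneg_right (by linarith) hLw
    · have h1 := (integral_gap_le hd h.ne hR (zero_le_one' ℝ) le_rfl hL0 hL hy1)
      have h2 := (integral_gap_le hd h.ne hR le_rfl (zero_le_one' ℝ) hL0 hL hy1).1
      simp only [one_mul, zero_mul, add_zero, zero_add, zero_div] at h1 h2
      have h3 : y.snd * (∫ x, directionGap (x - μ) w ∂ν) ≤ rs * (L * ‖w‖ ^ 2) :=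
        mul_le_mul (by linarith) h1.2 h1.1 hrs
      have h4 : b * (∫ x, normGap (x - μ) w ∂ν) ≤ 0 := mul_nonpos_of_nonpos_of_nonneg hb0 h2
      have : 0 ≤ 3 / 2 * Rr * (L * ‖w‖ ^ 2) := by positivity
      linarith
  have hcross : -(A * b ^ 2 + ‖u‖ ^ 2 / A * ‖w‖ ^ 2) ≤ 2 * b * inner ℝ w u := by
    have h1 := abs_real_inner_le_norm w u
    have h2 : inner ℝ w u ^ 2 ≤ (‖w‖ * ‖u‖) ^ 2 := by
      rw [← sq_abs (inner ℝ w u)]; gcongr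
    have h3 : 0 ≤ (A * b + inner ℝ w u) ^ 2 / A := by positivity
    have h4 : (A * b + inner ℝ w u) ^ 2 / A = A * b ^ 2 + 2 * b * inner ℝ w u
        + inner ℝ w u ^ 2 / A := by field_simp; ring
    have h5 : inner ℝ w u ^ 2 / A ≤ ‖u‖ ^ 2 / A * ‖w‖ ^ 2 := by
      calc _ ≤ (‖w‖ * ‖u‖) ^ 2 / A := by gcongr
        _ = _ := by ring
    linarith
  have hmin1 : min (1 - ‖u‖ ^ 2 / A - L * (rs + 3 / 2 * Rr)) (1 - A) * ‖w‖ ^ 2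
      ≤ (1 - ‖u‖ ^ 2 / A - L * (rs + 3 / 2 * Rr)) * ‖w‖ ^ 2 := by gcongr; exact min_le_left _ _
  have hmin2 : min (1 - ‖u‖ ^ 2 / A - L * (rs + 3 / 2 * Rr)) (1 - A) * b ^ 2
      ≤ (1 - A) * b ^ 2 := by gcongr; exact min_le_right _ _
  linarith

/-! ### Linearization of the mean field -/

lemma integrable_inv : Integrable (fun x => ‖x - μ‖⁻¹) ν := by
  refine ((integrable_const (1 : ℝ)).add h.integrable_inv_sq).mono'
    (measurable_id.sub_const μ).norm.inv.aestronglyMeasurable (.of_forall fun x => ?_)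
  rw [norm_inv, norm_norm, Pi.add_apply, ← inv_pow]
  nlinarith [sq_nonneg (‖x - μ‖⁻¹ - 1 / 2)]

lemma integrable_stochGradDeriv (e : Param d) : Integrable (fun x => stochGradDeriv μ rs x e) ν := by
  -- dominated by the stochastic gradients and the error of linearization
  have hrs : 0 ≤ rs := by
    rw [← h.integral_norm]; exact integral_nonneg fun x => norm_nonneg _
  set y := mkParam μ rs + e with hy
  have hye : y - mkParam μ rs = e := by rw [hy]; abel
  have hb := ((h.integrable_inv_sq.const_mul (4 * rs)).add
    (h.integrable_inv.const_mul 3)).const_mul (‖e‖ ^ 2)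
  have hdiff : Integrable (fun x => stochGrad x y - stochGrad x (mkParam μ rs)) ν :=
    (h.integrable_stochGrad y).sub (h.integrable_stochGrad _)
  refine (hdiff.norm.add hb).mono' (measurable_stochGradDeriv μ rs e).aestronglyMeasurable ?_
  filter_upwards [h.ne μ] with x hx
  have h1 := norm_stochGrad_sub_sub_deriv_le hrs hx y
  rw [hye] at h1
  have h2 := norm_le_norm_add_norm_sub (stochGrad x y - stochGrad x (mkParam μ rs))
    (stochGradDeriv μ rs x e)
  simp only [Pi.add_apply] at h1 ⊢
  linarith

omit [IsProbabilityMeasure ν] h in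
lemma integral_stochGradDeriv_smul (t : ℝ) (e : Param d) :
    ∫ x, stochGradDeriv μ rs x (t • e) ∂ν = t • ∫ x, stochGradDeriv μ rs x e ∂ν := by
  simp_rw [stochGradDeriv_smul]
  exact integral_smul t fun x => stochGradDeriv μ rs x e

lemma integral_stochGradDeriv_add (e e' : Param d) :
    ∫ x, stochGradDeriv μ rs x (e + e') ∂ν
      = (∫ x, stochGradDeriv μ rs x e ∂ν) + ∫ x, stochGradDeriv μ rs x e' ∂ν := by
  simp_rw [stochGradDeriv_add]
  exact integral_add (h.integrable_stochGradDeriv e) (h.integrable_stochGradDeriv e')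

/-- The linearization of the mean field at `(μ, rs)`, as a mere linear map. -/
noncomputable def hessianLinear : Param d →ₗ[ℝ] Param d :=
  IsLinearMap.mk' (fun e => ∫ x, stochGradDeriv μ rs x e ∂ν)
    ⟨h.integral_stochGradDeriv_add, integral_stochGradDeriv_smul⟩

/-- The linearization of the mean field at `(μ, rs)`, i.e. the Hessian of the objective. -/
noncomputable def hessian : Param d →L[ℝ] Param d :=
  continuousOfFiniteDimensional h.hessianLinear

lemma meanField_target : meanField ν stochGrad (mkParam μ rs) = 0 := by
  have h1 : ∀ x : Vec d, stochGrad x (mkParam μ rs)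
      = mkParam (rs • (‖x - μ‖⁻¹ • (x - μ)) - (x - μ)) (rs - ‖x - μ‖) := fun x =>
    param_ext (stochGrad_fst x _) (stochGrad_snd x _)
  have i0 := h.integrable_stochGrad (mkParam μ rs)
  rw [meanField]
  apply param_ext
  · change (WithLp.fstL 2 ℝ (Vec d) ℝ) (∫ x, stochGrad x (mkParam μ rs) ∂ν) = 0
    rw [← ContinuousLinearMap.integral_comp_comm _ i0]
    simp_rw [h1]
    change ∫ x, (rs • (‖x - μ‖⁻¹ • (x - μ)) - (x - μ)) ∂ν = 0
    have i3 : Integrable (fun x => rs • (‖x - μ‖⁻¹ • (x - μ))) ν := integrable_direction.smul rs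
    rw [MeasureTheory.integral_sub i3 h.integrable_sub,
      integral_smul rs fun x => ‖x - μ‖⁻¹ • (x - μ), h.integral_direction, h.integral_sub, sub_self]
  · change (WithLp.sndL 2 ℝ (Vec d) ℝ) (∫ x, stochGrad x (mkParam μ rs) ∂ν) = 0
    rw [← ContinuousLinearMap.integral_comp_comm _ i0]
    simp_rw [h1]
    change ∫ x, (rs - ‖x - μ‖) ∂ν = 0
    rw [MeasureTheory.integral_sub (integrable_const rs) h.integrable_sub.norm, h.integral_norm]
    simp

lemma norm_meanField_sub_hessian_le (y : Param d) :
    ‖meanField ν stochGrad y - h.hessian (y - mkParam μ rs)‖ ≤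
      (4 * rs * (∫ x, (‖x - μ‖ ^ 2)⁻¹ ∂ν) + 3 * ∫ x, ‖x - μ‖⁻¹ ∂ν) * ‖y - mkParam μ rs‖ ^ 2 := by
  have hrs : 0 ≤ rs := by
    rw [← h.integral_norm]; exact integral_nonneg fun x => norm_nonneg _
  have i1 := h.integrable_stochGrad y
  have i2 := h.integrable_stochGrad (mkParam μ rs)
  have i3 := h.integrable_stochGradDeriv (y - mkParam μ rs)
  have hb := ((h.integrable_inv_sq.const_mul (4 * rs)).fun_add
    (h.integrable_inv.const_mul 3)).const_mul (‖y - mkParam μ rs‖ ^ 2)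
  have heq : meanField ν stochGrad y - h.hessian (y - mkParam μ rs) =
      ∫ x, (stochGrad x y - stochGrad x (mkParam μ rs)
        - stochGradDeriv μ rs x (y - mkParam μ rs)) ∂ν := by
    have i12 : Integrable (fun x => stochGrad x y - stochGrad x (mkParam μ rs)) ν := i1.sub i2
    rw [MeasureTheory.integral_sub i12 i3, MeasureTheory.integral_sub i1 i2]
    have h0 := h.meanField_target
    rw [meanField] at h0
    rw [h0, sub_zero]
    rfl
  rw [heq]
  refine (norm_integral_le_of_norm_le hb ?_).trans_eq ?_
  · filter_upwards [h.ne μ] with x hx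
    exact norm_stochGrad_sub_sub_deriv_le hrs hx y
  · rw [integral_const_mul, integral_add (h.integrable_inv_sq.const_mul _)
      (h.integrable_inv.const_mul _), integral_const_mul, integral_const_mul]
    ring

end IsRadialLaw

end Monotone

/-! ### The law of the model -/

lemma IsSphereModel.ae_norm_sub_eq {d : ℕ} {Ω₀ : Type*} [MeasurableSpace Ω₀] {P₀ : Measure Ω₀}
    {μ : Vec d} {r : ℝ} {S : Set (Metric.sphere (0 : Vec d) 1)} {W : Ω₀ → ℝ}
    {U : Ω₀ → Metric.sphere (0 : Vec d) 1} {X₀ : Ω₀ → Vec d}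
    (hmodel : IsSphereModel P₀ μ r S W U X₀) :
    ∀ᵐ ω ∂P₀, ‖X₀ ω - μ‖ = r * W ω ∧ ‖X₀ ω - μ‖⁻¹ • (X₀ ω - μ) = U ω ∧
      X₀ ω - μ = (r * W ω) • (U ω : Vec d) := by
  filter_upwards [hmodel.X_eq, hmodel.W_pos] with ω hX hW
  have hrW : 0 < r * W ω := mul_pos hmodel.r_pos hW
  have hU : ‖(U ω : Vec d)‖ = 1 := by simp
  have hsub : X₀ ω - μ = (r * W ω) • (U ω : Vec d) := by rw [hX, add_sub_cancel_left]
  have hnorm : ‖X₀ ω - μ‖ = r * W ω := by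
    rw [hsub, norm_smul, hU, mul_one, Real.norm_of_nonneg hrW.le]
  refine ⟨hnorm, ?_, hsub⟩
  rw [hnorm, hsub, smul_smul, inv_mul_cancel₀ hrW.ne', one_smul]

lemma IsSphereModel.isRadialLaw {d : ℕ} {Ω₀ : Type*} [MeasurableSpace Ω₀] {P₀ : Measure Ω₀}
    [IsProbabilityMeasure P₀]
    {μ : Vec d} {r : ℝ} {S : Set (Metric.sphere (0 : Vec d) 1)} {W : Ω₀ → ℝ}
    {U : Ω₀ → Metric.sphere (0 : Vec d) 1} {X₀ : Ω₀ → Vec d}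
    (hmodel : IsSphereModel P₀ μ r S W U X₀) (hA1 : AssumptionA1 P₀ X₀ μ)
    (hmoment : Integrable (fun ω => ‖X₀ ω - μ‖ ^ 12) P₀) :
    IsRadialLaw (P₀.map X₀) μ (rStar P₀ r W) (∫ ω, (U ω : Vec d) ∂P₀) := by
  have hX := hmodel.measurable_X
  have hm : Measurable fun x : Vec d => x - μ := measurable_id.sub_const μ
  have hU : Measurable fun ω => (U ω : Vec d) := measurable_subtype_coe.comp hmodel.measurable_U
  have hrW : Measurable fun ω => r * W ω := hmodel.measurable_W.const_mul r
  have hae := hmodel.ae_norm_sub_eq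
  refine ⟨fun z => ?_, ?_, ?_, ?_, ?_, ?_⟩
  · refine (ae_map_iff (p := fun x => x ≠ z) hX.aemeasurable (MeasurableSet.singleton z).compl).2 ?_
    have hW : ∀ᵐ ω ∂P₀, W ω ≠ ‖z - μ‖ / r :=
      measure_eq_zero_iff_ae_notMem.1 (hmodel.W_continuous (‖z - μ‖ / r))
    filter_upwards [hae, hW] with ω h1 h2 h3
    apply h2
    have hr := hmodel.r_pos
    rw [← h3, h1.1]
    field_simp
  · have hmeas : Measurable fun x : Vec d => (‖x - μ‖ ^ 2)⁻¹ := (hm.norm.pow_const 2).inv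
    rw [integrable_map_measure hmeas.aestronglyMeasurable hX.aemeasurable]
    exact hA1
  · rw [integrable_map_measure (hm.norm.pow_const 4).aestronglyMeasurable hX.aemeasurable]
    refine ((integrable_const (1 : ℝ)).add hmoment).mono'
      ((hm.norm.pow_const 4).comp hX).aestronglyMeasurable (.of_forall fun ω => ?_)
    rw [Function.comp_apply, Real.norm_of_nonneg (by positivity), Pi.add_apply]
    rcases le_total ‖X₀ ω - μ‖ 1 with h1 | h1
    · have := pow_le_one₀ (n := 4) (norm_nonneg _) h1
      have : 0 ≤ ‖X₀ ω - μ‖ ^ 12 := by positivity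
      linarith
    · have := pow_le_pow_right₀ h1 (show 4 ≤ 12 by norm_num)
      linarith
  · rw [integral_map hX.aemeasurable hm.norm.aestronglyMeasurable, rStar, ← integral_const_mul]
    exact integral_congr_ae (hae.mono fun ω h => h.1)
  · have hmeas : Measurable fun x : Vec d => ‖x - μ‖⁻¹ • (x - μ) := hm.norm.inv.smul hm
    rw [integral_map hX.aemeasurable hmeas.aestronglyMeasurable]
    exact integral_congr_ae (hae.mono fun ω h => h.2.1)
  · rw [integral_map hX.aemeasurable hm.aestronglyMeasurable, rStar, ← integral_const_mul]
    have hind : IndepFun (fun ω => r * W ω) (fun ω => (U ω : Vec d)) P₀ :=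
      hmodel.indep.comp (φ := fun w => r * w) (ψ := fun v : Metric.sphere (0 : Vec d) 1 => (v : Vec d))
        (measurable_const_mul r) measurable_subtype_coe
    rw [← hind.integral_fun_smul_eq_smul_integral hrW.aestronglyMeasurable hU.aestronglyMeasurable]
    exact integral_congr_ae (hae.mono fun ω h => h.2.2)

/-! ### The past of the algorithm -/

/-- If `A` is independent of `(B, C)` and `B` of `C`, then `(A, B)` is independent of `C`. -/
lemma indepFun_prodMk_of_indepFun_prodMk {Ω α β γ : Type*} [MeasurableSpace Ω] [MeasurableSpace α]
    [MeasurableSpace β] [MeasurableSpace γ] {P : Measure Ω} [IsProbabilityMeasure P]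
    {A : Ω → α} {B : Ω → β} {C : Ω → γ} (hA : Measurable A) (hB : Measurable B) (hC : Measurable C)
    (hABC : IndepFun A (fun ω => (B ω, C ω)) P) (hBC : IndepFun B C P) :
    IndepFun (fun ω => (A ω, B ω)) C P := by
  have hAB : IndepFun A B P := hABC.comp (φ := id) (ψ := Prod.fst) measurable_id measurable_fst
  rw [indepFun_iff_map_prod_eq_prod_map_map (hA.prodMk hB).aemeasurable hC.aemeasurable,
    (indepFun_iff_map_prod_eq_prod_map_map hA.aemeasurable hB.aemeasurable).1 hAB]
  have h1 := (indepFun_iff_map_prod_eq_prod_map_map hA.aemeasurable (hB.prodMk hC).aemeasurable).1 hABC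
  rw [(indepFun_iff_map_prod_eq_prod_map_map hB.aemeasurable hC.aemeasurable).1 hBC,
    ← Measure.prodAssoc_prod] at h1
  apply MeasurableEquiv.prodAssoc.map_measurableEquiv_injective
  rw [← h1, Measure.map_map MeasurableEquiv.prodAssoc.measurable ((hA.prodMk hB).prodMk hC)]
  rfl

/-- The initial point together with the observations `X 2, …, X k` used before the `k`-th step. -/
def pastOf {Ω 𝒴 E : Type*} (X : ℕ → Ω → 𝒴) (θ₁ : Ω → E) (k : ℕ) (ω : Ω) :
    E × (Finset.range (k - 1) → 𝒴) :=
  (θ₁ ω, fun i => X (i + 2) ω)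

section Past

variable {Ω 𝒴 E : Type*} [MeasurableSpace Ω] [MeasurableSpace 𝒴] [MeasurableSpace E]
  {X : ℕ → Ω → 𝒴} {θ₁ : Ω → E}

lemma measurable_pastOf (hX : ∀ n, 1 ≤ n → Measurable (X n)) (hθ₁ : Measurable θ₁) (k : ℕ) :
    Measurable (pastOf X θ₁ k) :=
  hθ₁.prodMk (measurable_pi_lambda _ fun _ => hX _ (by omega))

lemma comap_pastOf_mono :
    Monotone fun k => MeasurableSpace.comap (pastOf X θ₁ k) inferInstance := by
  intro j k hjk
  have hsub : ∀ i : Finset.range (j - 1), (i : ℕ) ∈ Finset.range (k - 1) := fun i => by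
    have := Finset.mem_range.1 i.2
    exact Finset.mem_range.2 (by omega)
  have hφ : Measurable fun p : E × (Finset.range (k - 1) → 𝒴) =>
      (p.1, fun i : Finset.range (j - 1) => p.2 ⟨i, hsub i⟩) := by
    refine measurable_fst.prodMk (measurable_pi_lambda _ fun i => ?_)
    exact (measurable_pi_apply _).comp measurable_snd
  have : pastOf X θ₁ j = (fun p : E × (Finset.range (k - 1) → 𝒴) =>
      (p.1, fun i : Finset.range (j - 1) => p.2 ⟨i, hsub i⟩)) ∘ pastOf X θ₁ k := rfl
  simp only
  rw [this, ← MeasurableSpace.comap_comp]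
  exact MeasurableSpace.comap_mono hφ.comap_le

lemma measurable_comap_pastOf_init (k : ℕ) :
    Measurable[MeasurableSpace.comap (pastOf X θ₁ k) inferInstance] θ₁ :=
  measurable_fst.comp (comap_measurable (pastOf X θ₁ k))

lemma measurable_comap_pastOf_noise {k : ℕ} (hk : 1 ≤ k) :
    Measurable[MeasurableSpace.comap (pastOf X θ₁ (k + 1)) inferInstance] (X (k + 1)) := by
  obtain ⟨n, rfl⟩ := Nat.exists_eq_add_of_le' hk
  have h : Measurable fun p : E × (Finset.range (n + 1 + 1 - 1) → 𝒴) =>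
      p.2 ⟨n, Finset.mem_range.2 (by omega)⟩ := (measurable_pi_apply _).comp measurable_snd
  exact h.comp (comap_measurable (pastOf X θ₁ (n + 1 + 1)))

lemma indepFun_pastOf {P : Measure Ω} [IsProbabilityMeasure P]
    (hX : ∀ n, 1 ≤ n → Measurable (X n)) (hθ₁ : Measurable θ₁)
    (hX_indep : iIndepFun (fun n : ℕ => X (n + 1)) P)
    (hθ₁_indep : IndepFun θ₁ (fun ω (n : ℕ) => X (n + 2) ω) P) {k : ℕ} (hk : 1 ≤ k) :
    IndepFun (pastOf X θ₁ k) (X (k + 1)) P := by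
  obtain ⟨n, rfl⟩ := Nat.exists_eq_add_of_le' hk
  have hX2 : ∀ i : ℕ, Measurable (X (i + 2)) := fun i => hX _ (by omega)
  have hB : Measurable fun ω (i : Finset.range (n + 1 - 1)) => X (i + 2) ω :=
    measurable_pi_lambda _ fun i => hX2 i
  have hI : iIndepFun (fun i : ℕ => X (i + 2)) P := hX_indep.precomp (add_left_injective 1)
  refine indepFun_prodMk_of_indepFun_prodMk hθ₁ hB (hX2 n) ?_ ?_
  · refine hθ₁_indep.comp (φ := id)
      (ψ := fun x : ℕ → 𝒴 => (fun i : Finset.range (n + 1 - 1) => x i, x n)) measurable_id ?_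
    exact (measurable_pi_lambda _ fun i => measurable_pi_apply _).prodMk (measurable_pi_apply _)
  · have hdisj : Disjoint (Finset.range (n + 1 - 1)) {n} := by simp
    have h := hI.indepFun_finset (Finset.range (n + 1 - 1)) {n} hdisj hX2
    exact h.comp (φ := id) (ψ := fun x : ({n} : Finset ℕ) → 𝒴 => x ⟨n, by simp⟩) measurable_id
      (measurable_pi_apply _)

end Past

/-! ### The projection -/

section Projection

variable {d : ℕ} {K : Set (Param d)} {μ : Vec d} {rs Rμ Rr : ℝ}

lemma IsConstraintSet.norm_sub_le (hK : IsConstraintSet K μ rs Rμ Rr) {v : Param d} (hv : v ∈ K) :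
    ‖v - mkParam μ rs‖ ≤ Rμ + Rr := by
  obtain ⟨h1, h2⟩ := hK.subset_balls v hv
  rw [mem_closedBall_iff_norm] at h1 h2
  exact (norm_param_le _).trans (add_le_add h1 h2)

/-- Projecting does not move away from the points of `K`, up to a constant. A point `y` outside the
half-space, where the map is arbitrary, is at a distance bounded below from every point of `K`. -/
lemma IsProjection.exists_bound {π : Param d → Param d} (hπ : IsProjection π K)
    (hK : IsConstraintSet K μ rs Rμ Rr) :
    ∃ B : ℝ, 1 ≤ B ∧ ∀ v ∈ K, ∀ v' ∈ K, ∀ y, ‖π y - v'‖ ≤ max ‖y - v'‖ (B * ‖y - v‖) := by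
  have hθ : mkParam μ rs ∈ K := interior_subset hK.mem_interior
  obtain ⟨v₀, hv₀, hmin⟩ := hK.isCompact.exists_isMinOn ⟨_, hθ⟩
    (f := fun y : Param d => y.snd) (WithLp.prod_continuous_ofLp 2 _ _).snd.continuousOn
  have ha : 0 < v₀.snd := hK.pos hv₀
  have hD : 0 ≤ Rμ + Rr := (norm_nonneg _).trans (hK.norm_sub_le hθ)
  refine ⟨1 + 2 * (Rμ + Rr) / v₀.snd, le_add_of_nonneg_right (by positivity),
    fun v hv v' hv' y => ?_⟩
  by_cases hy : y ∈ posParam d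
  · refine le_max_of_le_left ?_
    calc ‖π y - v'‖ = ‖π y - π v'‖ := by rw [hπ.eq_self v' hv']
      _ ≤ _ := hπ.lipschitz y hy v' (hK.pos hv')
  · refine le_max_of_le_right ?_
    have hy0 : y.snd ≤ 0 := not_lt.1 hy
    have h1 : v₀.snd ≤ ‖y - v‖ := by
      have h2 : v₀.snd ≤ v.snd := hmin hv
      have h3 : |y.snd - v.snd| ≤ ‖y - v‖ := abs_snd_le_param (y - v)
      have := neg_le_of_abs_le h3
      linarith
    have h4 : ‖π y - v'‖ ≤ 2 * (Rμ + Rr) := by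
      have h5 := hK.norm_sub_le (hπ.mapsTo y)
      have h6 := hK.norm_sub_le hv'
      rw [← sub_sub_sub_cancel_right (π y) v' (mkParam μ rs)]
      linarith [_root_.norm_sub_le (π y - mkParam μ rs) (v' - mkParam μ rs)]
    calc ‖π y - v'‖ ≤ 2 * (Rμ + Rr) / v₀.snd * v₀.snd := by rwa [div_mul_cancel₀ _ ha.ne']
      _ ≤ 2 * (Rμ + Rr) / v₀.snd * ‖y - v‖ := by gcongr
      _ ≤ (1 + 2 * (Rμ + Rr) / v₀.snd) * ‖y - v‖ := by gcongr; linarith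

end Projection

/-! ### The rate for the averaged algorithm -/

theorem theorem4p3 {d : ℕ} (hd : 2 ≤ d)
    -- the model: the random vector X₀ = μ + r W U and the target θ = (μ, r⋆)
    {Ω₀ : Type*} [MeasurableSpace Ω₀] (P₀ : Measure Ω₀) [IsProbabilityMeasure P₀]
    (μ : Vec d) (r : ℝ) (S : Set (Metric.sphere (0 : Vec d) 1))
    (W : Ω₀ → ℝ) (U : Ω₀ → Metric.sphere (0 : Vec d) 1) (X₀ : Ω₀ → Vec d)
    (hmodel : IsSphereModel P₀ μ r S W U X₀)
    (Rμ Rr : ℝ)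
    (hA1 : AssumptionA1 P₀ X₀ μ)
    (hA2 : AssumptionA2 P₀ X₀ μ)
    (hA3 : AssumptionA3 P₀ X₀ U μ (rStar P₀ r W) Rμ Rr)
    (hA4 : AssumptionA4 P₀ X₀ μ (rStar P₀ r W))
    (hmoment : Integrable (fun ω => ‖X₀ ω - μ‖ ^ 12) P₀)
    -- the constraint set, the projection and the step sequence
    (K : Set (Param d)) (hK : IsConstraintSet K μ (rStar P₀ r W) Rμ Rr)
    (π : Param d → Param d) (hπ : IsProjection π K)
    (c α : ℝ) (hc : 0 < c) (hα₁ : 1 / 2 < α) (hα₂ : α < 1)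
    -- the i.i.d. observations X 1, X 2, … and the initial point
    {Ω : Type*} [MeasurableSpace Ω] (P : Measure Ω) [IsProbabilityMeasure P]
    (X : ℕ → Ω → Vec d) (hX_meas : ∀ n, 1 ≤ n → Measurable (X n))
    (hX_indep : iIndepFun (fun n : ℕ => X (n + 1)) P)
    (hX_law : ∀ n, 1 ≤ n → IdentDistrib (X n) X₀ P P₀)
    (θ₁ : Ω → Param d) (hθ₁_meas : Measurable θ₁) (hθ₁_mem : ∀ ω, θ₁ ω ∈ K)
    (hθ₁_indep : IndepFun θ₁ (fun ω (n : ℕ) => X (n + 2) ω) P) :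
    ∃ C : ℝ, 0 < C ∧ ∀ n : ℕ, 1 ≤ n →
      Integrable (fun ω =>
        ‖averagedPrm π (fun k => c * (k : ℝ) ^ (-α)) X θ₁ n ω - mkParam μ (rStar P₀ r W)‖ ^ 2) P ∧
      ∫ ω, ‖averagedPrm π (fun k => c * (k : ℝ) ^ (-α)) X θ₁ n ω
        - mkParam μ (rStar P₀ r W)‖ ^ 2 ∂P ≤ C / n := by
  have hlaw := hmodel.isRadialLaw hA1 hmoment
  have hprob : IsProbabilityMeasure (P₀.map X₀) :=
    Measure.isProbabilityMeasure_map hmodel.measurable_X.aemeasurable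
  obtain ⟨hRμ, hRr, A, huA, hA, L, hLUB, hL⟩ := hA3
  set rs := rStar P₀ r W
  set u : Vec d := ∫ ω, (U ω : Vec d) ∂P₀
  set ν := P₀.map X₀
  have hrs : 0 ≤ rs := by
    rw [← hlaw.integral_norm]; exact integral_nonneg fun x => norm_nonneg _
  have hA0 : 0 < A := (sq_nonneg _).trans_lt huA
  have hLmax : ∀ z ∈ Metric.closedBall μ Rμ, lambdaMax (GammaMat ν id z) ≤ max L 0 := by
    intro z hz
    rw [← gammaMat_map hmodel.measurable_X]
    exact (hLUB.1 ⟨z, hz, rfl⟩).trans (le_max_left _ _)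
  -- replacing `L` by `max L 0` keeps the first term positive, since `‖E[U]‖² < A`
  have hgap : 0 < min (1 - ‖u‖ ^ 2 / A - max L 0 * (rs + 3 / 2 * Rr)) (1 - A) := by
    refine lt_min ?_ (by linarith)
    have h1 : ‖u‖ ^ 2 / A < 1 := by rw [div_lt_one hA0]; exact huA
    rcases max_cases L 0 with ⟨h2, -⟩ | ⟨h2, -⟩
    · rw [lt_div_iff₀ (by positivity)] at hL
      rw [h2]; linarith
    · rw [h2]; linarith
  obtain ⟨B, hB1, hB⟩ := hπ.exists_bound hK
  have hθ : mkParam μ rs ∈ K := interior_subset hK.mem_interior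
  obtain ⟨δ, hδ, hball⟩ := Metric.isOpen_iff.1 isOpen_interior _ hK.mem_interior
  have hscheme : IsProjectedScheme P ν stochGrad (fun x => 2 * (‖x - μ‖ + (Rμ + (rs + Rr)))) K
      (mkParam μ rs) π hlaw.hessian
      (min (1 - ‖u‖ ^ 2 / A - max L 0 * (rs + 3 / 2 * Rr)) (1 - A))
      (4 * rs * (∫ x, (‖x - μ‖ ^ 2)⁻¹ ∂ν) + 3 * ∫ x, ‖x - μ‖⁻¹ ∂ν) B (Rμ + Rr) δ
      (fun k => c * (k : ℝ) ^ (-α)) (fun k => MeasurableSpace.comap (pastOf X θ₁ k) inferInstance) X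
      (prm π (fun k => c * (k : ℝ) ^ (-α)) X θ₁) :=
    { κ_pos := hgap
      δ_pos := hδ
      B_nonneg := by linarith
      filtration_le := fun k => (measurable_pastOf hX_meas hθ₁_meas k).comap_le
      filtration_mono := comap_pastOf_mono
      noise_adapted := fun k hk => measurable_comap_pastOf_noise hk
      noise_indep := fun k hk => (IndepFun_iff_Indep _ _ _).1
        (indepFun_pastOf hX_meas hθ₁_meas hX_indep hθ₁_indep hk)
      noise_law := fun k _ => (hX_law (k + 1) (by omega)).map_eq
      init_adapted := measurable_comap_pastOf_init 1
      init_mem := hθ₁_mem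
      step := fun k hk ω => by
        obtain ⟨n, rfl⟩ := Nat.exists_eq_add_of_le' hk
        rfl
      measurable_grad := measurable_stochGrad
      measurable_envelope :=
        ((measurable_id.sub_const μ).norm.add_const _).const_mul 2
      norm_grad_le := fun x v hv => by
        obtain ⟨h1, h2⟩ := hK.subset_balls v hv
        rw [mem_closedBall_iff_norm] at h1 h2
        have h3 : |v.snd| ≤ rs + Rr := by
          have := norm_le_norm_add_norm_sub' v.snd rs
          rw [Real.norm_of_nonneg hrs, Real.norm_eq_abs] at this
          linarith
        refine (norm_stochGrad_le x μ v).trans ?_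
        gcongr
      envelope_moment := by
        refine ((hlaw.integrable_pow_four.add
          (integrable_const ((Rμ + (rs + Rr)) ^ 4))).const_mul 128).mono'
          ((((measurable_id.sub_const μ).norm.add_const _).const_mul 2).pow_const
            4).aestronglyMeasurable (.of_forall fun x => ?_)
        rw [Real.norm_of_nonneg (by positivity), mul_pow, Pi.add_apply]
        have := add_pow_le (norm_nonneg (x - μ)) (show 0 ≤ Rμ + (rs + Rr) by positivity) 4
        norm_num at this ⊢
        linarith
      measurable_proj := hπ.measurable
      proj_mem := hπ.mapsTo
      proj_eq_self := hπ.eq_self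
      norm_proj_sub_target_le := fun v hv y => hB v hv _ hθ y
      norm_proj_sub_le := fun v hv y => (hB v hv v hv y).trans
        (max_le (le_mul_of_one_le_left (norm_nonneg _) hB1) le_rfl)
      norm_sub_target_le := fun v hv => hK.norm_sub_le hv
      ball_subset := hball.trans interior_subset
      strongly_monotone := fun v hv => by
        obtain ⟨h1, h2⟩ := hK.subset_balls v hv
        rw [mem_closedBall_iff_norm] at h1 h2
        exact hlaw.strongly_monotone hd hrs hRμ hRr.le (le_max_right _ _) hLmax hA0 h1 h2
          (hK.pos hv).le
      linearization := fun v _ => hlaw.norm_meanField_sub_hessian_le v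
      step_pos := fun k hk => mul_pos hc (Real.rpow_pos_of_pos (by exact_mod_cast hk) _) }
  exact hscheme.exists_integral_average_sq_le hc hα₁ hα₂
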